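/- **Theorem 5.6 (local efficiency).** Let $d\in\{2,3\}$, let $\Omega\subset\mathbb R^d$ be a bounded polytopal domain (open, connected) with Lipschitz boundary, $z\in\Omega$, $\alpha\in(d-2,d)$ and $\sigma>0$. Write $\mathsf d_z^{\beta}(x)=|x-z|^{\beta}$, let $L^2(\mathsf d_z^{\beta},E)$ be the weighted space with norm $\|v\|_{L^2(\mathsf d_z^{\beta},E)}=(\int_E \mathsf d_z^{\beta}|v|^2)^{1/2}$, let $H^1(\mathsf d_z^{\beta},\Omega)$ be the space of all $v\in L^2(\mathsf d_z^{\beta},\Omega)$ whose weak gradient is in $L^2(\mathsf d_z^{\beta},\Omega)$, with its natural norm, and let $H^1_0(\mathsf d_z^{\beta},\Omega)$ be the closure of $C_0^\infty(\Omega)$ in it; bold letters denote spaces of $\mathbb R^d$-valued functions. Put $a(\mathbf w,\mathbf v)=\int_\Omega\nabla\mathbf w:\nabla\mathbf v$ and $b(\mathbf v,q)=-\int_\Omega q\,\mathrm{div}\,\mathbf v$. There is a constant $C>0$, depending only on $d,\Omega,z,\alpha,\sigma$, such that the following holds. Let $\mathscr T$ be a conforming partition of $\bar\Omega$ into finitely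 many closed nondegenerate simplices such that every $T\in\mathscr T$ contains a closed ball of radius $\sigma h_T$, where $h_T=\mathrm{diam}(T)$. Let $\mathbf V(\mathscr T)\times\mathcal P(\mathscr T)$ be the mini pair or the Taylor–Hood pair: $\mathbf V(\mathscr T)$ consists of the $\mathbf v\in\mathbf C(\bar\Omega)\cap\mathbf H^1_0(\Omega)$ with $\mathbf v|_T\in[\mathbb P_1(T)\oplus\mathbb B(T)]^d$ for all $T$ (mini), respectively $\mathbf v|_T\in\mathbb P_2(T)^d$ for all $T$ (Taylor–Hood), where $\mathbb B(T)$ is spanned by the product of the barycentric coordinates of $T$; in both cases $\mathcal P(\mathscr T)$ consists of the $q\in C(\bar\Omega)$ with $q|_T\in\mathbb P_1(T)$ for all $T$, modulo constants. Let $\mathbf F\in\mathbb R^d$. Let $(\mathbf u,p)\in\mathbf H^1_0(\mathsf d_z^{\alpha},\Omega)\times L^2(\mathsf d_z^{\alpha},\Omega)/\mathbb R$ be the solution of $$a(\mathbf u,\mathbf v)+b(\mathbf v,p)=\langle\mathbf F\delta_z,\mathbf v\rangle\quad\forall\,\mathbf v\in\mathbf H^1_0(\mathsf d_z^{-\alpha},\Omega),\qquad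 b(\mathbf u,q)=0\quad\forall\,q\in L^2(\mathsf d_z^{-\alpha},\Omega)/\mathbb R,$$ where $\langle\mathbf F\delta_z,\cdot\rangle$ is the continuous extension of $\boldsymbol\varphi\mapsto\mathbf F\cdot\boldsymbol\varphi(z)$ from $\mathbf C_0^\infty(\Omega)$, and let $(\mathbf u_{\mathscr T},p_{\mathscr T})\in\mathbf V(\mathscr T)\times\mathcal P(\mathscr T)$ be a solution of $$a(\mathbf u_{\mathscr T},\mathbf v)+b(\mathbf v,p_{\mathscr T})=\mathbf F\cdot\mathbf v(z)\quad\forall\,\mathbf v\in\mathbf V(\mathscr T),\qquad b(\mathbf u_{\mathscr T},q)=0\quad\forall\,q\in\mathcal P(\mathscr T).$$ Put $\mathbf e_{\mathbf u}=\mathbf u-\mathbf u_{\mathscr T}$ and $e_p=p-p_{\mathscr T}$, for arbitrary representatives of $p$ and $p_{\mathscr T}$ modulo constants. For $T\in\mathscr T$ let $D_T=\max_{x\in T}|x-z|$, let $\mathcal N_T$ be the patch formed by $T$ and the elements that share a $(d-1)$-dimensional side with $T$, and let $$\mathscr E_\alpha^2(\mathbf u_{\mathscr T},p_{\mathscr T};T)=h_T^2D_T^\alpha\|\Delta\mathbf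 u_{\mathscr T}-\nabla p_{\mathscr T}\|^2_{\mathbf L^2(T)}+\|\mathrm{div}\,\mathbf u_{\mathscr T}\|^2_{L^2(\mathsf d_z^\alpha,T)}+h_TD_T^\alpha\|[\![(\nabla\mathbf u_{\mathscr T}-p_{\mathscr T}\mathbf I)\cdot\boldsymbol\nu]\!]\|^2_{\mathbf L^2(\partial T\setminus\partial\Omega)}+h_T^{\alpha+2-d}|\mathbf F|^2\chi(\{z\in T\}),$$ where $\chi(\{z\in T\})$ is $1$ if $z\in T$ and $0$ otherwise, and on the internal side shared by $T^+$ and $T^-$ the jump is $[\![\mathbf W\cdot\boldsymbol\nu]\!]=\mathbf W|_{T^+}\cdot\boldsymbol\nu^++\mathbf W|_{T^-}\cdot\boldsymbol\nu^-$, with $\boldsymbol\nu^\pm$ the unit normals pointing towards $T^\pm$. Then, for every $T\in\mathscr T$, $$\mathscr E_\alpha^2(\mathbf u_{\mathscr T},p_{\mathscr T};T)\le C\left(\|\nabla\mathbf e_{\mathbf u}\|^2_{\mathbf L^2(\mathsf d_z^{\alpha},\mathcal N_T)}+\|e_p\|^2_{L^2(\mathsf d_z^{\alpha},\mathcal N_T)}\right).$$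 -/

import Mathlib

open MeasureTheory Filter Topology
open scoped ContDiff

namespace StokesFEM

/-- `ℝ^d` with the Euclidean norm. -/
abbrev Eu (d : ℕ) := EuclideanSpace ℝ (Fin d)

section Domain

variable {d : ℕ}

/-- A bounded Lipschitz domain: open, connected, bounded, and near each boundary point, in suitable
orthonormal coordinates with vertical direction `e`, the region strictly above the graph of a
Lipschitz function (`g` does not depend on the vertical coordinate). -/
structure IsLipschitzDomain (Ω : Set (Eu d)) : Prop where
  isOpen : IsOpen Ω
  isConnected : IsConnected Ω
  isBounded : Bornology.IsBounded Ω
  boundary : ∀ x ∈ frontier Ω, ∃ (e : Eu d) (g : Eu d → ℝ) (K : NNReal) (r : ℝ),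
    ‖e‖ = 1 ∧ LipschitzWith K g ∧ (∀ (y : Eu d) (t : ℝ), g (y + t • e) = g y) ∧ 0 < r ∧
    ∀ y ∈ Metric.ball x r, (y ∈ Ω ↔ g y < inner ℝ y e)

end Domain

section WeightedSpaces

variable {d : ℕ}

/-- The weight `|x - z|^β`. -/
noncomputable def weight (z : Eu d) (β : ℝ) (x : Eu d) : ℝ := ‖x - z‖ ^ β

/-- `f ∈ L²(|x - z|^β, Ω)`. -/
def MemWL2 (z : Eu d) (β : ℝ) (Ω : Set (Eu d)) (f : Eu d → ℝ) : Prop :=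
  LocallyIntegrableOn f Ω ∧ IntegrableOn (fun x => weight z β x * f x ^ 2) Ω

/-- Smooth functions with compact support in `Ω`, with values in a normed space. -/
def IsTest {V : Type*} [NormedAddCommGroup V] [NormedSpace ℝ V]
    (Ω : Set (Eu d)) (φ : Eu d → V) : Prop :=
  ContDiff ℝ ∞ φ ∧ HasCompactSupport φ ∧ tsupport φ ⊆ Ω

/-- The `j`-th standard unit vector. -/
noncomputable def unitVec (j : Fin d) : Eu d := EuclideanSpace.single j 1

/-- The classical Jacobian matrix `(∂_j v_i)_{ij}`. -/
noncomputable def jac (v : Eu d → Eu d) (x : Eu d) : Matrix (Fin d) (Fin d) ℝ :=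
  Matrix.of fun i j => (fderiv ℝ v x (unitVec j)) i

/-- The Frobenius product `A : B`. -/
def frob (A B : Matrix (Fin d) (Fin d) ℝ) : ℝ := ∑ i, ∑ j, A i j * B i j

/-- `G` is the weak (distributional) Jacobian of the vector field `v` in `Ω`. -/
def HasWeakJac (Ω : Set (Eu d)) (v : Eu d → Eu d) (G : Eu d → Matrix (Fin d) (Fin d) ℝ) : Prop :=
  ∀ φ : Eu d → ℝ, IsTest Ω φ → ∀ i j : Fin d,
    ∫ x in Ω, v x i * fderiv ℝ φ x (unitVec j) = - ∫ x in Ω, G x i j * φ x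

/-- `v ∈ H¹(|x - z|^β, Ω)^d`, with weak Jacobian `G`. -/
structure MemWH1 (z : Eu d) (β : ℝ) (Ω : Set (Eu d)) (v : Eu d → Eu d)
    (G : Eu d → Matrix (Fin d) (Fin d) ℝ) : Prop where
  val : ∀ i, MemWL2 z β Ω (fun x => v x i)
  grad : ∀ i j, MemWL2 z β Ω (fun x => G x i j)
  weak : HasWeakJac Ω v G

/-- The squared `H¹(|x - z|^β, Ω)^d` distance between a smooth field `φ` and a field `v` with weak
Jacobian `G`. -/
noncomputable def distSqWH1 (z : Eu d) (β : ℝ) (Ω : Set (Eu d)) (φ v : Eu d → Eu d)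
    (G : Eu d → Matrix (Fin d) (Fin d) ℝ) : ℝ :=
  ∫ x in Ω, weight z β x *
    (‖φ x - v x‖ ^ 2 + frob (jac φ x - G x) (jac φ x - G x))

/-- The test fields `φ n` converge to `v` in `H¹(|x - z|^β, Ω)^d`. -/
def TestApprox (z : Eu d) (β : ℝ) (Ω : Set (Eu d)) (φ : ℕ → Eu d → Eu d) (v : Eu d → Eu d)
    (G : Eu d → Matrix (Fin d) (Fin d) ℝ) : Prop :=
  (∀ n, IsTest Ω (φ n)) ∧ Tendsto (fun n => distSqWH1 z β Ω (φ n) v G) atTop (𝓝 0)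

/-- `v ∈ H¹₀(|x - z|^β, Ω)^d` with weak Jacobian `G`: the closure of the test fields in
`H¹(|x - z|^β, Ω)^d`. -/
def MemWH10 (z : Eu d) (β : ℝ) (Ω : Set (Eu d)) (v : Eu d → Eu d)
    (G : Eu d → Matrix (Fin d) (Fin d) ℝ) : Prop :=
  MemWH1 z β Ω v G ∧ ∃ φ : ℕ → Eu d → Eu d, TestApprox z β Ω φ v G

end WeightedSpaces

section Stokes

variable {d : ℕ}

/-- `a(w, v) = ∫_Ω ∇w : ∇v`, in terms of the Jacobians of `w` and `v`. -/
noncomputable def aForm (Ω : Set (Eu d)) (G H : Eu d → Matrix (Fin d) (Fin d) ℝ) : ℝ :=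
  ∫ x in Ω, frob (G x) (H x)

/-- `b(v, q) = - ∫_Ω q div v`, in terms of the Jacobian of `v`; the divergence is its trace. -/
noncomputable def bForm (Ω : Set (Eu d)) (G : Eu d → Matrix (Fin d) (Fin d) ℝ)
    (q : Eu d → ℝ) : ℝ :=
  - ∫ x in Ω, q x * (G x).trace

/-- `ℓ` is the value `⟨F δ_z, v⟩` for `v ∈ H¹₀(|x - z|^{-α}, Ω)^d`: the extension by continuity of
the functional `φ ↦ F · φ(z)` from the (dense) test fields. -/
def IsDiracValue (z : Eu d) (α : ℝ) (Ω : Set (Eu d)) (F : Eu d) (v : Eu d → Eu d)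
    (G : Eu d → Matrix (Fin d) (Fin d) ℝ) (ℓ : ℝ) : Prop :=
  ∀ φ : ℕ → Eu d → Eu d, TestApprox z (-α) Ω φ v G →
    Tendsto (fun n => inner ℝ F (φ n z)) atTop (𝓝 ℓ)

/-- `(u, p) ∈ H¹₀(|x - z|^α, Ω)^d × L²(|x - z|^α, Ω)/ℝ` is the weak solution of
`-Δu + ∇p = F δ_z`, `div u = 0` in `Ω`, `u = 0` on `∂Ω`. Here `Du` is the weak Jacobian of `u`, and
`p` is an arbitrary representative of its class modulo constants. -/
structure IsStokesSolution (Ω : Set (Eu d)) (z : Eu d) (α : ℝ) (F : Eu d)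
    (u : Eu d → Eu d) (Du : Eu d → Matrix (Fin d) (Fin d) ℝ) (p : Eu d → ℝ) : Prop where
  mem_u : MemWH10 z α Ω u Du
  mem_p : MemWL2 z α Ω p
  momentum : ∀ v Dv, MemWH10 z (-α) Ω v Dv →
    IsDiracValue z α Ω F v Dv (aForm Ω Du Dv + bForm Ω Dv p)
  mass : ∀ q, MemWL2 z (-α) Ω q → bForm Ω Du q = 0

end Stokes

section Mesh

variable {d : ℕ}

/-- The closed simplex with vertex set `T`. -/
def simplex (T : Finset (Eu d)) : Set (Eu d) := convexHull ℝ (T : Set (Eu d))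

/-- A conforming partition of the closure of `Ω` into finitely many closed nondegenerate
`d`-simplices, each recorded through its set of vertices: two simplices meet in the common face
spanned by their common vertices (or not at all). -/
structure Triangulation (Ω : Set (Eu d)) where
  cells : Finset (Finset (Eu d))
  card_eq : ∀ T ∈ cells, T.card = d + 1
  indep : ∀ T ∈ cells, AffineIndependent ℝ (fun a : T => (a : Eu d))
  cover : ⋃ T ∈ cells, simplex T = closure Ω
  conforming : ∀ T ∈ cells, ∀ T' ∈ cells,
    simplex T ∩ simplex T' = convexHull ℝ ((T : Set (Eu d)) ∩ (T' : Set (Eu d)))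

/-- `h_T`, the diameter of the element. -/
noncomputable def hT (T : Finset (Eu d)) : ℝ := Metric.diam (simplex T)

/-- `D_T = max_{x ∈ T} |x - z|`. -/
noncomputable def DT (z : Eu d) (T : Finset (Eu d)) : ℝ := sSup ((fun x => ‖x - z‖) '' simplex T)

/-- Shape regularity with constant `σ`: each element contains a ball of radius `σ h_T`. -/
def ShapeRegular {Ω : Set (Eu d)} (σ : ℝ) (𝒯 : Triangulation Ω) : Prop :=
  ∀ T ∈ 𝒯.cells, ∃ x, Metric.closedBall x (σ * hT T) ⊆ simplex T

open Classical in
/-- The elements of the mesh that share a side with `T` and differ from it. The internal sides of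
the mesh that are sides of `T` are the sets `convexHull (T ∩ T')` with `T'` in this set. -/
noncomputable def neighbours {Ω : Set (Eu d)} (𝒯 : Triangulation Ω) (T : Finset (Eu d)) :
    Finset (Finset (Eu d)) :=
  𝒯.cells.filter fun T' => T' ≠ T ∧ (T ∩ T').card = d

/-- The region covered by the patch `𝒩_T` of `T`: `T` and the elements sharing a side with it. -/
def patch {Ω : Set (Eu d)} (𝒯 : Triangulation Ω) (T : Finset (Eu d)) : Set (Eu d) :=
  simplex T ∪ ⋃ T' ∈ neighbours 𝒯 T, simplex T'

open Classical in
/-- The vertices of the common side of `T` and `T'`. -/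
noncomputable def side (T T' : Finset (Eu d)) : Finset (Eu d) := T ∩ T'

/-- The unit normal on the side of `T` with vertex set `S`, pointing towards `T`: the normalized
component, orthogonal to the side, of the vector from the barycentre of the side to that of `T`. -/
noncomputable def sideNormal (T S : Finset (Eu d)) : Eu d :=
  let n : Eu d := (vectorSpan ℝ (S : Set (Eu d)))ᗮ.starProjection
    ((T.card : ℝ)⁻¹ • (∑ a ∈ T, a) - (S.card : ℝ)⁻¹ • (∑ a ∈ S, a))
  ‖n‖⁻¹ • n

end Mesh

section Discrete

variable {d : ℕ}

/-- `f` restricted to the element `T` is a polynomial of total degree at most `k`. -/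
def IsPolyOn (k : ℕ) (T : Finset (Eu d)) (f : Eu d → ℝ) : Prop :=
  ∃ P : MvPolynomial (Fin d) ℝ, P.totalDegree ≤ k ∧
    ∀ x ∈ simplex T, f x = MvPolynomial.eval (fun i => x i) P

/-- `lam a`, `a ∈ T`, are the barycentric coordinates of the simplex `T`. -/
def IsBarycentric (T : Finset (Eu d)) (lam : Eu d → (Eu d →ᵃ[ℝ] ℝ)) : Prop :=
  ∀ a ∈ T, lam a a = 1 ∧ ∀ b ∈ T, b ≠ a → lam a b = 0

/-- `f` restricted to `T` is in `ℙ₁(T) ⊕ 𝔹(T)`, where `𝔹(T)` is spanned by the bubble function of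
`T`, the product of its barycentric coordinates. -/
def IsP1BubbleOn (T : Finset (Eu d)) (f : Eu d → ℝ) : Prop :=
  ∃ (g : Eu d → ℝ) (c : ℝ) (lam : Eu d → (Eu d →ᵃ[ℝ] ℝ)),
    IsPolyOn 1 T g ∧ IsBarycentric T lam ∧
    ∀ x ∈ simplex T, f x = g x + c * ∏ a ∈ T, lam a x

/-- The two choices of inf-sup stable finite element pairs. -/
inductive StablePair where
  | mini
  | taylorHood

/-- The local velocity space, for one component. -/
def StablePair.IsLocalVelocity (π : StablePair) (T : Finset (Eu d)) (f : Eu d → ℝ) : Prop :=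
  match π with
  | .mini => IsP1BubbleOn T f
  | .taylorHood => IsPolyOn 2 T f

/-- The discrete velocity space `V(𝒯)`; membership in the unweighted space `H¹₀(Ω)^d` is expressed
with the weight exponent `0`. -/
structure MemV (π : StablePair) {Ω : Set (Eu d)} (𝒯 : Triangulation Ω) (v : Eu d → Eu d) :
    Prop where
  cont : ContinuousOn v (closure Ω)
  loc : ∀ T ∈ 𝒯.cells, ∀ i, π.IsLocalVelocity T (fun x => v x i)
  zero : ∃ G, MemWH10 0 0 Ω v G

/-- The discrete pressure space `P(𝒯)` (the same for both pairs), in terms of representatives modulo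
constants. -/
structure MemP {Ω : Set (Eu d)} (𝒯 : Triangulation Ω) (q : Eu d → ℝ) : Prop where
  cont : ContinuousOn q (closure Ω)
  loc : ∀ T ∈ 𝒯.cells, IsPolyOn 1 T q

/-- The discrete Stokes problem. The gradients of discrete functions are the classical ones in the
interior of each element, hence defined almost everywhere in `Ω`. -/
structure IsDiscreteSolution (π : StablePair) {Ω : Set (Eu d)} (𝒯 : Triangulation Ω)
    (z F : Eu d) (uT : Eu d → Eu d) (pT : Eu d → ℝ) : Prop where
  mem_u : MemV π 𝒯 uT
  mem_p : MemP 𝒯 pT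
  momentum : ∀ v, MemV π 𝒯 v →
    aForm Ω (jac uT) (jac v) + bForm Ω (jac v) pT = inner ℝ F (v z)
  mass : ∀ q, MemP 𝒯 q → bForm Ω (jac uT) q = 0

/-- The trace from `T` of `(∇u_𝒯 - p_𝒯 I) · ν`, with `ν` the unit normal on the side with vertex set
`S` pointing towards `T`. -/
noncomputable def normalStress (uT : Eu d → Eu d) (pT : Eu d → ℝ) (T S : Finset (Eu d))
    (x : Eu d) : Eu d :=
  fderivWithin ℝ uT (simplex T) x (sideNormal T S) - pT x • sideNormal T S

/-- The jump `⟦(∇u_𝒯 - p_𝒯 I) · ν⟧` on the common side of `T` and `T'`. -/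
noncomputable def stressJump (uT : Eu d → Eu d) (pT : Eu d → ℝ) (T T' : Finset (Eu d))
    (x : Eu d) : Eu d :=
  normalStress uT pT T (side T T') x + normalStress uT pT T' (side T T') x

open Classical in
/-- The element error indicator `ℰ_α(u_𝒯, p_𝒯; T)`. The integral of the squared jump over
`∂T \ ∂Ω` is the sum over the internal sides of `T`, with respect to surface measure. -/
noncomputable def errorIndicator {Ω : Set (Eu d)} (𝒯 : Triangulation Ω) (z : Eu d) (α : ℝ)
    (F : Eu d) (uT : Eu d → Eu d) (pT : Eu d → ℝ) (T : Finset (Eu d)) : ℝ :=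
  Real.sqrt
    (hT T ^ 2 * DT z T ^ α *
        (∫ x in simplex T, ‖Laplacian.laplacian uT x - gradient pT x‖ ^ 2)
      + (∫ x in simplex T, weight z α x * (jac uT x).trace ^ 2)
      + hT T * DT z T ^ α *
        (∑ T' ∈ neighbours 𝒯 T,
          ∫ x in simplex (side T T'), ‖stressJump uT pT T T' x‖ ^ 2
            ∂(Measure.euclideanHausdorffMeasure (d - 1)))
      + hT T ^ (α + 2 - (d : ℝ)) * ‖F‖ ^ 2 * (if z ∈ simplex T then 1 else 0))

end Discrete

end StokesFEM

open StokesFEM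

/-! The four parts of the indicator are bounded one by one by the weighted error on the patch.

Element residual and jumps: this is the bubble function technique, with smooth cutoffs on balls in
place of element and side bubbles. Each element contains a ball, and each internal side is crossed
by a ball covered by its two elements, whose radius is comparable to h_T and whose points keep a
comparable distance from z (`ShapeRegular.exists_interior_ball`, `ShapeRegular.exists_side_ball`). A
test function supported there does not see the Dirac mass, and D_T ≤ K |x - z| on the ball, so D_T^α
is dominated by the weight. The exact momentum equation is tested with the cut-off residual, or with
the cut-off jump extended constantly along the normal. Integration by parts and Young's inequality,
with inverse estimates for polynomials to absorb the test function, give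
`exists_interior_residual_bound` and `exists_jump_bound`. Norm equivalence on polynomials carries
the bounds from the ball to the whole element or side.

Divergence: div u = 0 almost everywhere, so div u_T is minus the trace of the gradient error
(`IsErrorSetting.divergence_le`).

Dirac term: it is read off from the singularity of the pressure. The divergence of the momentum
equation is Δp = div(F δ_z), hence near z, up to a constant c and a remainder of size ‖F‖, the
function κ (p - c) is the dipole F·(x - z) |x - z|^(-d) (`exists_pressure_decomposition`). On an
element containing z the discrete pressure is affine. The scaling difference g(x) - 3 g(x/2) + 2
g(x/4), taken about z, annihilates affine functions but multiplies the dipole, homogeneous of degree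
1 - d, by a factor of at least 1. So the dipole stays away from all affine functions, by an amount
whose weighted square integral is of order h^(α+2-d) ‖F‖² (`exists_dipole_lower_bound`).

The remainder must be bounded uniformly over all solutions. Solutions form a linear space over the
forces F, and F determines the pressure near z up to constants; choosing solutions linearly in F
gives a linear map on a finite dimensional space, which is bounded (`exists_pressure_bound`).
Uniqueness needs an argument because trial and test spaces carry opposite weights: for F = 0 both p
and u_i - x_i p / 2 are weakly harmonic, so u is smooth near z by Weyl's lemma, is therefore
admissible as its own test field, and the energy identity gives Du = 0. -/

namespace StokesFEM

/-! ### Partial derivatives, test functions and integration by parts -/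

section Calculus

variable {d : ℕ}

/-- The `j`-th partial derivative of a scalar function. -/
noncomputable def pd (j : Fin d) (f : Eu d → ℝ) (x : Eu d) : ℝ := fderiv ℝ f x (unitVec j)

theorem norm_unitVec (j : Fin d) : ‖(unitVec j : Eu d)‖ = 1 := by
  simp [unitVec]

theorem contDiff_pd {f : Eu d → ℝ} (hf : ContDiff ℝ ∞ f) (j : Fin d) : ContDiff ℝ ∞ (pd j f) :=
  (hf.fderiv_right (m := ∞) (by simp)).clm_apply contDiff_const

theorem hasCompactSupport_pd {f : Eu d → ℝ} (hf : HasCompactSupport f) (j : Fin d) :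
    HasCompactSupport (pd j f) :=
  (hf.fderiv (𝕜 := ℝ)).comp_left (g := fun L : Eu d →L[ℝ] ℝ => L (unitVec j)) (by simp)

theorem tsupport_pd_subset (f : Eu d → ℝ) (j : Fin d) : tsupport (pd j f) ⊆ tsupport f :=
  (closure_mono (fun x hx => by
    simp only [Function.mem_support, pd] at hx ⊢
    intro h
    exact hx (by simp [h]))).trans (tsupport_fderiv_subset ℝ (f := f))

theorem IsTest.pd {Ω : Set (Eu d)} {f : Eu d → ℝ} (hf : IsTest Ω f) (j : Fin d) :
    IsTest Ω (pd j f) :=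
  ⟨contDiff_pd hf.1 j, hasCompactSupport_pd hf.2.1 j, (tsupport_pd_subset f j).trans hf.2.2⟩

theorem IsTest.mono {V : Type*} [NormedAddCommGroup V] [NormedSpace ℝ V] {Ω Ω' : Set (Eu d)}
    {f : Eu d → V} (hf : IsTest Ω f) (h : Ω ⊆ Ω') : IsTest Ω' f := ⟨hf.1, hf.2.1, hf.2.2.trans h⟩

theorem IsTest.mul_left {Ω : Set (Eu d)} {f g : Eu d → ℝ} (hf : IsTest Ω f)
    (hg : ContDiff ℝ ∞ g) : IsTest Ω (fun x => g x * f x) :=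
  ⟨hg.mul hf.1, hf.2.1.mul_left, (closure_mono (Function.support_mul_subset_right g f)).trans hf.2.2⟩

theorem IsTest.eq_zero {V : Type*} [NormedAddCommGroup V] [NormedSpace ℝ V] {Ω : Set (Eu d)}
    {f : Eu d → V} (hf : IsTest Ω f) {x : Eu d} (hx : x ∉ Ω) : f x = 0 :=
  image_eq_zero_of_notMem_tsupport fun h => hx (hf.2.2 h)

theorem IsTest.comp_apply {Ω : Set (Eu d)} {v : Eu d → Eu d} (hv : IsTest Ω v) (i : Fin d) :
    IsTest Ω (fun x => v x i) := by
  refine ⟨?_, ?_, ?_⟩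
  · exact (contDiff_piLp 2).1 hv.1 i
  · exact hv.2.1.comp_left (g := fun y : Eu d => y i) (by simp)
  · refine (closure_mono fun x hx => ?_).trans hv.2.2
    simp only [Function.mem_support] at hx ⊢
    intro h
    exact hx (by simp [h])

/-- The vector field with `i`-th component `f` and all others zero. -/
noncomputable def compField (i : Fin d) (f : Eu d → ℝ) (x : Eu d) : Eu d := f x • unitVec i

theorem compField_apply (i k : Fin d) (f : Eu d → ℝ) (x : Eu d) :
    compField i f x k = if k = i then f x else 0 := by
  simp [compField, unitVec]

theorem IsTest.compField {Ω : Set (Eu d)} {f : Eu d → ℝ} (hf : IsTest Ω f) (i : Fin d) :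
    IsTest Ω (compField i f) :=
  ⟨hf.1.smul contDiff_const, hf.2.1.smul_right,
    (closure_mono (fun x hx => by
      simp only [Function.mem_support, StokesFEM.compField] at hx ⊢
      intro h
      exact hx (by simp [h]))).trans hf.2.2⟩

theorem jac_apply {v : Eu d → Eu d} {x : Eu d} (hv : DifferentiableAt ℝ v x) (i j : Fin d) :
    jac v x i j = pd j (fun y => v y i) x := by
  simp only [jac, Matrix.of_apply, pd]
  have : HasFDerivAt (fun y => v y i) ((EuclideanSpace.proj i : Eu d →L[ℝ] ℝ) ∘L fderiv ℝ v x) x :=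
    (EuclideanSpace.proj i : Eu d →L[ℝ] ℝ).hasFDerivAt.comp x hv.hasFDerivAt
  rw [this.fderiv]
  rfl

theorem jac_apply_of_contDiff {v : Eu d → Eu d} (hv : ContDiff ℝ ∞ v) (x : Eu d) (i j : Fin d) :
    jac v x i j = pd j (fun y => v y i) x :=
  jac_apply (hv.differentiable (by simp) x) i j

theorem pd_mul {f g : Eu d → ℝ} {x : Eu d} (hf : DifferentiableAt ℝ f x)
    (hg : DifferentiableAt ℝ g x) (j : Fin d) :
    pd j (fun y => f y * g y) x = pd j f x * g x + f x * pd j g x := by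
  simp only [pd]
  rw [fderiv_fun_mul hf hg]
  simp
  ring

theorem pd_add {f g : Eu d → ℝ} {x : Eu d} (hf : DifferentiableAt ℝ f x)
    (hg : DifferentiableAt ℝ g x) (j : Fin d) :
    pd j (fun y => f y + g y) x = pd j f x + pd j g x := by
  simp only [pd]
  rw [fderiv_fun_add hf hg]
  simp

theorem pd_sub {f g : Eu d → ℝ} {x : Eu d} (hf : DifferentiableAt ℝ f x)
    (hg : DifferentiableAt ℝ g x) (j : Fin d) :
    pd j (fun y => f y - g y) x = pd j f x - pd j g x := by
  simp only [pd]
  rw [fderiv_fun_sub hf hg]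
  simp

theorem pd_const_mul {f : Eu d → ℝ} {x : Eu d} (hf : DifferentiableAt ℝ f x) (c : ℝ) (j : Fin d) :
    pd j (fun y => c * f y) x = c * pd j f x := by
  simp only [pd]
  rw [fderiv_const_mul hf]
  simp

theorem pd_const (c : ℝ) (j : Fin d) (x : Eu d) : pd j (fun _ => c) x = 0 := by
  simp [pd]

theorem pd_coord (i j : Fin d) (x : Eu d) :
    pd j (fun y : Eu d => y i) x = if i = j then 1 else 0 := by
  simp only [pd]
  rw [show (fun y : Eu d => y i) = (EuclideanSpace.proj i : Eu d →L[ℝ] ℝ) from rfl,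
    ContinuousLinearMap.fderiv]
  simp [unitVec]

theorem contDiff_coord (i : Fin d) : ContDiff ℝ ∞ (fun y : Eu d => y i) :=
  (EuclideanSpace.proj i : Eu d →L[ℝ] ℝ).contDiff

theorem pd_congr_nhds {f g : Eu d → ℝ} {x : Eu d} (h : f =ᶠ[𝓝 x] g) (j : Fin d) :
    pd j f x = pd j g x := by
  simp only [pd, h.fderiv_eq]

theorem abs_pd_le (j : Fin d) (f : Eu d → ℝ) (x : Eu d) : |pd j f x| ≤ ‖fderiv ℝ f x‖ := by
  have := (fderiv ℝ f x).le_opNorm (unitVec j)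
  rwa [norm_unitVec, mul_one] at this

theorem pd_comm {f : Eu d → ℝ} (hf : ContDiff ℝ ∞ f) (i j : Fin d) (x : Eu d) :
    pd i (pd j f) x = pd j (pd i f) x := by
  have key : ∀ a b : Fin d, pd a (pd b f) x = fderiv ℝ (fderiv ℝ f) x (unitVec a) (unitVec b) := by
    intro a b
    have h1 : DifferentiableAt ℝ (fderiv ℝ f) x :=
      (hf.fderiv_right (m := ∞) (by simp)).differentiable (by simp) x
    have : HasFDerivAt (pd b f)
        ((ContinuousLinearMap.apply ℝ ℝ (unitVec b)) ∘L fderiv ℝ (fderiv ℝ f) x) x :=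
      (ContinuousLinearMap.apply ℝ ℝ (unitVec b)).hasFDerivAt.comp x h1.hasFDerivAt
    simp only [pd] at this ⊢
    rw [this.fderiv]
    rfl
  rw [key, key]
  have : IsSymmSndFDerivAt ℝ f x :=
    (hf.contDiffAt (x := x)).isSymmSndFDerivAt (by
      rw [minSmoothness_of_isRCLikeNormedField]
      exact WithTop.coe_le_coe.2 le_top)
  exact this _ _

/-- The Laplacian of a scalar function, in coordinates. -/
noncomputable def lap (f : Eu d → ℝ) (x : Eu d) : ℝ := ∑ j, pd j (pd j f) x

theorem IsTest.sum {Ω : Set (Eu d)} {ι : Type*} (s : Finset ι) {f : ι → Eu d → ℝ}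
    (hf : ∀ i, IsTest Ω (f i)) : IsTest Ω (fun x => ∑ i ∈ s, f i x) := by
  classical
  induction s using Finset.induction_on with
  | empty =>
    refine ⟨by simpa using contDiff_const, ?_, ?_⟩
    · simpa using! (HasCompactSupport.zero : HasCompactSupport (0 : Eu d → ℝ))
    · simp [tsupport]
  | insert a s ha ih =>
    simp only [Finset.sum_insert ha]
    refine ⟨(hf a).1.add ih.1, (hf a).2.1.add ih.2.1, ?_⟩
    exact (tsupport_add _ _).trans (Set.union_subset (hf a).2.2 ih.2.2)

theorem IsTest.lap {Ω : Set (Eu d)} {f : Eu d → ℝ} (hf : IsTest Ω f) : IsTest Ω (lap f) :=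
  IsTest.sum _ fun j => (hf.pd j).pd j

theorem integral_mul_pd {f g : Eu d → ℝ} (hf : ContDiff ℝ ∞ f) (hg : ContDiff ℝ ∞ g)
    (hgc : HasCompactSupport g) (j : Fin d) :
    ∫ x, f x * pd j g x = - ∫ x, pd j f x * g x := by
  refine integral_mul_fderiv_eq_neg_fderiv_mul_of_integrable ?_ ?_ ?_ ?_ ?_
  · exact ((contDiff_pd hf j).mul hg).continuous.integrable_of_hasCompactSupport hgc.mul_left
  · exact (hf.mul (contDiff_pd hg j)).continuous.integrable_of_hasCompactSupport
      (hasCompactSupport_pd hgc j).mul_left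
  · exact (hf.mul hg).continuous.integrable_of_hasCompactSupport hgc.mul_left
  · exact fun x _ => hf.differentiable (by simp) x
  · exact fun x _ => hg.differentiable (by simp) x

theorem setIntegral_mul_test {Ω : Set (Eu d)} (f : Eu d → ℝ) {g : Eu d → ℝ} (hg : IsTest Ω g) :
    ∫ x in Ω, f x * g x = ∫ x, f x * g x :=
  setIntegral_eq_integral_of_forall_compl_eq_zero fun x hx => by simp [hg.eq_zero hx]

theorem integrable_mul_test {Ω : Set (Eu d)} {f g : Eu d → ℝ} (hf : LocallyIntegrableOn f Ω)
    (hg : IsTest Ω g) : Integrable (fun x => f x * g x) := by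
  have h1 : IntegrableOn f (tsupport g) := hf.integrableOn_compact_subset hg.2.2 hg.2.1
  have h2 : IntegrableOn (fun x => f x * g x) (tsupport g) :=
    h1.mul_continuousOn hg.1.continuous.continuousOn hg.2.1
  rwa [integrableOn_iff_integrable_of_support_subset] at h2
  intro x hx
  refine subset_tsupport g ?_
  simp only [Function.mem_support] at hx ⊢
  intro h
  exact hx (by simp [h])

theorem hasWeakJac_of_test {Ω : Set (Eu d)} {v : Eu d → Eu d} (hv : ContDiff ℝ ∞ v) :
    HasWeakJac Ω v (jac v) := by
  intro φ hφ i j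
  have h1 := setIntegral_mul_test (fun x => v x i) (hφ.pd j)
  have h2 := setIntegral_mul_test (fun x => jac v x i j) hφ
  rw [show (∫ x in Ω, v x i * fderiv ℝ φ x (unitVec j)) = ∫ x in Ω, v x i * pd j φ x from rfl,
    h1, h2]
  have hvi : ContDiff ℝ ∞ (fun x => v x i) := (contDiff_piLp 2).1 hv i
  rw [integral_mul_pd hvi hφ.1 hφ.2.1 j]
  simp only [jac_apply_of_contDiff hv]

end Calculus

/-! ### Integrability of the weight -/

section Weight

variable {d : ℕ}

theorem weight_nonneg (z : Eu d) (β : ℝ) (x : Eu d) : 0 ≤ weight z β x :=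
  Real.rpow_nonneg (norm_nonneg _) _

theorem measurable_weight (z : Eu d) (β : ℝ) : Measurable (weight z β) := by
  unfold weight
  fun_prop

/-- In polar coordinates the integrand becomes r^(d-1+β), which is integrable at 0 exactly when β >
-d. -/
theorem integrableOn_weight_ball [NeZero d] (z : Eu d) {β : ℝ} (hβ : -(d : ℝ) < β) (r : ℝ) :
    IntegrableOn (weight z β) (Metric.ball z r) := by
  rcases le_or_gt r 0 with hr | hr
  · simp [Metric.ball_eq_empty.2 hr]
  have h0 : IntegrableOn (fun x : Eu d => ‖x‖ ^ β) (Metric.ball 0 r) := by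
    rw [integrableOn_fun_norm_addHaar volume (f := fun y => y ^ β)]
    have : IntegrableOn (fun x : ℝ => x ^ (((d : ℝ) - 1) + β)) (Set.Ioo 0 r) :=
      (intervalIntegral.integrableOn_Ioo_rpow_iff hr).2 (by linarith)
    refine this.congr_fun (fun x hx => ?_) measurableSet_Ioo
    have hx0 : 0 < x := hx.1
    have hd : 1 ≤ d := Nat.one_le_iff_ne_zero.2 (NeZero.ne d)
    simp only [smul_eq_mul, finrank_euclideanSpace, Fintype.card_fin]
    rw [Real.rpow_add hx0, ← Real.rpow_natCast, Nat.cast_sub hd]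
    simp
  have := (measurePreserving_sub_right (volume : Measure (Eu d)) z).integrableOn_comp_preimage
    (MeasurableEquiv.subRight z).measurableEmbedding (f := fun x : Eu d => ‖x‖ ^ β)
    (s := Metric.ball 0 r)
  have h2 := this.2 h0
  have h3 : (fun x => x - z) ⁻¹' Metric.ball (0 : Eu d) r = Metric.ball z r := by
    ext x
    simp [dist_eq_norm]
  rw [h3] at h2
  exact h2

theorem integrableOn_weight [NeZero d] (z : Eu d) {β : ℝ} (hβ : -(d : ℝ) < β) {s : Set (Eu d)}
    (hs : Bornology.IsBounded s) : IntegrableOn (weight z β) s := by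
  obtain ⟨r, hr⟩ := hs.subset_ball z
  exact (integrableOn_weight_ball z hβ r).mono_set hr

theorem memWL2_of_bounded [NeZero d] (z : Eu d) {β : ℝ} (hβ : -(d : ℝ) < β) {Ω : Set (Eu d)}
    (hΩ : Bornology.IsBounded Ω) {f : Eu d → ℝ} (hf : Continuous f) (hfc : HasCompactSupport f) :
    MemWL2 z β Ω f := by
  refine ⟨hf.locallyIntegrable.locallyIntegrableOn _, ?_⟩
  obtain ⟨C, hC⟩ := hfc.exists_bound_of_continuous hf
  refine Integrable.mono' ((integrableOn_weight z hβ hΩ).mul_const (C ^ 2)) ?_ ?_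
  · exact ((measurable_weight z β).mul (hf.measurable.pow_const 2)).aestronglyMeasurable
  · refine Eventually.of_forall fun x => ?_
    rw [Real.norm_eq_abs, abs_mul, abs_of_nonneg (weight_nonneg z β x)]
    refine mul_le_mul_of_nonneg_left ?_ (weight_nonneg z β x)
    rw [abs_of_nonneg (sq_nonneg _)]
    have := hC x
    rw [Real.norm_eq_abs] at this
    exact sq_le_sq' (by linarith [neg_abs_le (f x)]) ((le_abs_self _).trans this)

end Weight

/-! ### The exact equations tested with smooth functions -/

section Momentum

variable {d : ℕ} {Ω : Set (Eu d)} {z F : Eu d} {α : ℝ} {u : Eu d → Eu d}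
  {Du : Eu d → Matrix (Fin d) (Fin d) ℝ} {p : Eu d → ℝ}

theorem memWH1_of_test [NeZero d] {β : ℝ} (hβ : -(d : ℝ) < β) (hΩ : Bornology.IsBounded Ω)
    {v : Eu d → Eu d} (hv : IsTest Ω v) : MemWH1 z β Ω v (jac v) := by
  refine ⟨fun i => ?_, fun i j => ?_, hasWeakJac_of_test hv.1⟩
  · exact memWL2_of_bounded z hβ hΩ (hv.comp_apply i).1.continuous (hv.comp_apply i).2.1
  · simp only [jac_apply_of_contDiff hv.1]
    exact memWL2_of_bounded z hβ hΩ ((hv.comp_apply i).pd j).1.continuous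
      ((hv.comp_apply i).pd j).2.1

theorem testApprox_const {β : ℝ} {v : Eu d → Eu d} (hv : IsTest Ω v) :
    TestApprox z β Ω (fun _ => v) v (jac v) := by
  refine ⟨fun _ => hv, ?_⟩
  simp [distSqWH1, frob]

/-- A smooth test field is approximated by the constant sequence, so the extended Dirac functional
takes its classical value there. -/
theorem IsStokesSolution.momentum_test [NeZero d] (h : IsStokesSolution Ω z α F u Du p)
    (hα : α < d) (hΩ : Bornology.IsBounded Ω) {v : Eu d → Eu d} (hv : IsTest Ω v) :
    aForm Ω Du (jac v) + bForm Ω (jac v) p = inner ℝ F (v z) := by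
  have h1 := h.momentum v (jac v)
    ⟨memWH1_of_test (by linarith) hΩ hv, fun _ => v, testApprox_const hv⟩ (fun _ => v)
    (testApprox_const hv)
  exact tendsto_nhds_unique h1 tendsto_const_nhds

/-- Smooth compactly supported functions belong to the pressure test space, since α < d makes |x -
z|^(-α) integrable on bounded sets. The mass equation therefore says that the divergence vanishes as
a distribution. -/
theorem IsStokesSolution.trace_ae [NeZero d] (h : IsStokesSolution Ω z α F u Du p)
    (hα : α < d) (hΩ : Bornology.IsBounded Ω) (hΩo : IsOpen Ω) :
    ∀ᵐ x, x ∈ Ω → (Du x).trace = 0 := by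
  refine hΩo.ae_eq_zero_of_integral_contDiff_smul_eq_zero ?_ fun g hg hgc hgs => ?_
  · have : (fun x => (Du x).trace) = fun x => ∑ i, Du x i i := rfl
    rw [this]
    have key : ∀ s : Finset (Fin d), LocallyIntegrableOn (fun x => ∑ i ∈ s, Du x i i) Ω := by
      intro s
      classical
      induction s using Finset.induction_on with
      | empty => simpa using (locallyIntegrable_zero).locallyIntegrableOn Ω
      | insert a s ha ih =>
        simp only [Finset.sum_insert ha]
        exact (h.mem_u.1.grad a a).1.add ih
    exact key _
  · have := h.mass g (memWL2_of_bounded z (by linarith) hΩ hg.continuous hgc)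
    simp only [bForm, neg_eq_zero] at this
    rw [← this]
    exact (setIntegral_eq_integral_of_forall_compl_eq_zero fun x hx => by
      have : g x = 0 := image_eq_zero_of_notMem_tsupport fun h => hx (hgs h)
      simp [this]).symm

end Momentum

/-! ### Poisson problems satisfied by the pressure and the velocity -/

section Pressure

variable {d : ℕ} {Ω : Set (Eu d)} {z F : Eu d} {α : ℝ} {u : Eu d → Eu d}
  {Du : Eu d → Matrix (Fin d) (Fin d) ℝ} {p : Eu d → ℝ}

theorem HasWeakJac.integral_eq (h : HasWeakJac Ω u Du) {φ : Eu d → ℝ} (hφ : IsTest Ω φ)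
    (i j : Fin d) : ∫ x, Du x i j * φ x = - ∫ x, u x i * pd j φ x := by
  have h1 := h φ hφ i j
  have h2 := setIntegral_mul_test (fun x => u x i) (hφ.pd j)
  have h3 := setIntegral_mul_test (fun x => Du x i j) hφ
  rw [← h3, ← h2]
  rw [eq_neg_iff_add_eq_zero, add_comm, ← eq_neg_iff_add_eq_zero]
  exact h1

theorem jac_compField {ψ : Eu d → ℝ} (hψ : ContDiff ℝ ∞ ψ) (i k j : Fin d) (x : Eu d) :
    jac (compField i ψ) x k j = if k = i then pd j ψ x else 0 := by
  have hc : ContDiff ℝ ∞ (compField i ψ) := hψ.smul contDiff_const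
  rw [jac_apply_of_contDiff hc]
  simp only [compField_apply]
  split_ifs with h
  · rfl
  · exact pd_const 0 j x

theorem IsStokesSolution.momentum_comp [NeZero d] (h : IsStokesSolution Ω z α F u Du p)
    (hα : α < d) (hΩ : Bornology.IsBounded Ω) {ψ : Eu d → ℝ} (hψ : IsTest Ω ψ) (i : Fin d) :
    ∑ j, ∫ x, Du x i j * pd j ψ x = (∫ x, p x * pd i ψ x) + F i * ψ z := by
  have h1 := h.momentum_test hα hΩ (hψ.compField i)
  have e1 : aForm Ω Du (jac (compField i ψ)) = ∑ j, ∫ x, Du x i j * pd j ψ x := by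
    rw [aForm]
    have : ∀ x, frob (Du x) (jac (compField i ψ) x) = ∑ j, Du x i j * pd j ψ x := by
      intro x
      simp only [frob, jac_compField hψ.1]
      rw [Finset.sum_eq_single i]
      · simp
      · intro b _ hb
        simp [hb]
      · simp
    simp only [this]
    rw [integral_finsetSum _ fun j _ =>
      (integrable_mul_test (h.mem_u.1.grad i j).1 (hψ.pd j)).integrableOn]
    exact Finset.sum_congr rfl fun j _ => setIntegral_mul_test _ (hψ.pd j)
  have e2 : bForm Ω (jac (compField i ψ)) p = - ∫ x, p x * pd i ψ x := by
    rw [bForm]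
    have : ∀ x, (jac (compField i ψ) x).trace = pd i ψ x := by
      intro x
      simp only [Matrix.trace, Matrix.diag, jac_compField hψ.1]
      simp
    simp only [this]
    rw [setIntegral_mul_test _ (hψ.pd i)]
  have e3 : inner ℝ F (compField i ψ z) = F i * ψ z := by
    simp [compField, unitVec, inner_smul_right, EuclideanSpace.inner_single_right]
    ring
  rw [e1, e2, e3] at h1
  linarith

theorem pd_lap_comm {ψ : Eu d → ℝ} (hψ : ContDiff ℝ ∞ ψ) (i : Fin d) (x : Eu d) :
    pd i (lap ψ) x = lap (pd i ψ) x := by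
  have : pd i (lap ψ) x = ∑ j, pd i (pd j (pd j ψ)) x := by
    change fderiv ℝ (fun y => ∑ j, pd j (pd j ψ) y) x (unitVec i) = _
    rw [fderiv_fun_sum fun j _ =>
      (contDiff_pd (contDiff_pd hψ j) j).differentiable (by simp) x]
    simp [pd]
  rw [this, lap]
  refine Finset.sum_congr rfl fun j _ => ?_
  rw [pd_comm (contDiff_pd hψ j)]
  congr 1
  funext y
  exact pd_comm hψ i j y

/-- Integrating by parts onto ψ and back, and using that Δ commutes with ∂_i, turns the double sum
into the integral of (div u) Δψ. This is how the velocity disappears when the momentum equation is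
tested with a gradient. -/
theorem IsStokesSolution.sum_integral_hess [NeZero d] (h : IsStokesSolution Ω z α F u Du p)
    (hα : α < d) (hΩ : Bornology.IsBounded Ω) (hΩo : IsOpen Ω) {ψ : Eu d → ℝ} (hψ : IsTest Ω ψ) :
    ∑ i, ∑ j, ∫ x, Du x i j * pd j (pd i ψ) x = 0 := by
  have hu : ∀ i, LocallyIntegrableOn (fun x => u x i) Ω := fun i => (h.mem_u.1.val i).1
  have h1 : ∀ i, ∑ j, ∫ x, Du x i j * pd j (pd i ψ) x = ∫ x, Du x i i * lap ψ x := by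
    intro i
    have : ∀ j, ∫ x, Du x i j * pd j (pd i ψ) x = - ∫ x, u x i * pd j (pd j (pd i ψ)) x :=
      fun j => h.mem_u.1.weak.integral_eq ((hψ.pd i).pd j) i j
    simp only [this]
    rw [Finset.sum_neg_distrib, ← integral_finsetSum _ fun j _ =>
      integrable_mul_test (hu i) (((hψ.pd i).pd j).pd j)]
    rw [h.mem_u.1.weak.integral_eq hψ.lap i i]
    congr 2
    funext x
    rw [pd_lap_comm hψ.1, lap, Finset.mul_sum]
  simp only [h1]
  rw [← integral_finsetSum _ fun i _ => integrable_mul_test (h.mem_u.1.grad i i).1 hψ.lap]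
  rw [integral_eq_zero_of_ae]
  filter_upwards [h.trace_ae hα hΩ hΩo] with x hx
  rw [← Finset.sum_mul]
  by_cases hxΩ : x ∈ Ω
  · have : ∑ i, Du x i i = 0 := hx hxΩ
    simp [this]
  · simp [hψ.lap.eq_zero hxΩ]

/-- The pressure solves a Poisson problem with dipole right-hand side. -/
theorem IsStokesSolution.integral_p_lap [NeZero d] (h : IsStokesSolution Ω z α F u Du p)
    (hα : α < d) (hΩ : Bornology.IsBounded Ω) (hΩo : IsOpen Ω) {ψ : Eu d → ℝ} (hψ : IsTest Ω ψ) :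
    ∫ x, p x * lap ψ x = - ∑ i, F i * pd i ψ z := by
  have h1 := h.sum_integral_hess hα hΩ hΩo hψ
  -- With ∂_i ψ as the i-th test component, the sum over i tests the momentum equation with the
  -- gradient of ψ.
  have h2 : ∀ i, ∑ j, ∫ x, Du x i j * pd j (pd i ψ) x
      = (∫ x, p x * pd i (pd i ψ) x) + F i * pd i ψ z :=
    fun i => h.momentum_comp hα hΩ (hψ.pd i) i
  simp only [h2, Finset.sum_add_distrib] at h1
  have h3 : ∫ x, p x * lap ψ x = ∑ i, ∫ x, p x * pd i (pd i ψ) x := by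
    rw [← integral_finsetSum _ fun i _ => integrable_mul_test h.mem_p.1 ((hψ.pd i).pd i)]
    congr 1
    funext x
    rw [lap, Finset.mul_sum]
  rw [h3]
  linarith

theorem lap_coord_mul {ψ : Eu d → ℝ} (hψ : ContDiff ℝ ∞ ψ) (i : Fin d) (x : Eu d) :
    lap (fun y => y i * ψ y) x = x i * lap ψ x + 2 * pd i ψ x := by
  have hd1 : ∀ y, DifferentiableAt ℝ ψ y := fun y => hψ.differentiable (by simp) y
  have hc : ∀ y, DifferentiableAt ℝ (fun y : Eu d => y i) y :=
    fun y => (contDiff_coord i).differentiable (by simp) y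
  have h1 : ∀ j, pd j (fun y => y i * ψ y) = fun y => (if i = j then ψ y else 0) + y i * pd j ψ y := by
    intro j
    funext y
    rw [pd_mul (hc y) (hd1 y), pd_coord]
    split_ifs <;> simp
  have h2 : ∀ j, pd j (pd j (fun y => y i * ψ y)) x
      = 2 * (if i = j then pd j ψ x else 0) + x i * pd j (pd j ψ) x := by
    intro j
    have hdj : DifferentiableAt ℝ (pd j ψ) x := (contDiff_pd hψ j).differentiable (by simp) x
    rw [h1]
    by_cases hij : i = j
    · simp only [hij, if_true]
      rw [pd_add (hd1 x) ((hij ▸ hc x).mul hdj), pd_mul (hij ▸ hc x) hdj, pd_coord]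
      simp
      ring
    · simp only [hij, if_false]
      simp only [zero_add]
      rw [pd_mul (hc x) hdj, pd_coord]
      simp [hij]
  simp only [lap, h2, Finset.sum_add_distrib, ← Finset.mul_sum]
  simp
  ring

/-- For the homogeneous problem, `u_i - x_i p / 2` is weakly harmonic. -/
theorem IsStokesSolution.integral_velocity_lap [NeZero d] (h : IsStokesSolution Ω z α 0 u Du p)
    (hα : α < d) (hΩ : Bornology.IsBounded Ω) (hΩo : IsOpen Ω) {ψ : Eu d → ℝ} (hψ : IsTest Ω ψ)
    (i : Fin d) : ∫ x, (u x i - 2⁻¹ * (x i * p x)) * lap ψ x = 0 := by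
  have h1 := h.momentum_comp hα hΩ hψ i
  have h2 : ∀ j, ∫ x, Du x i j * pd j ψ x = - ∫ x, u x i * pd j (pd j ψ) x :=
    fun j => h.mem_u.1.weak.integral_eq (hψ.pd j) i j
  have h3 : ∫ x, u x i * lap ψ x = - ∫ x, p x * pd i ψ x := by
    simp only [h2, Finset.sum_neg_distrib] at h1
    rw [← integral_finsetSum _ fun j _ => integrable_mul_test (h.mem_u.1.val i).1
      ((hψ.pd j).pd j)] at h1
    simp only [PiLp.zero_apply, zero_mul, add_zero] at h1
    rw [← h1, neg_neg]
    congr 1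
    funext x
    rw [lap, Finset.mul_sum]
  -- Harmonicity of p tested with `y i * ψ y` is the weak form of Δ(x_i p) = 2 ∂_i p. Since Δu_i =
  -- ∂_i p, the factor 1/2 produces the cancellation.
  have hxψ : IsTest Ω (fun y => y i * ψ y) := hψ.mul_left (contDiff_coord i)
  have h4 := h.integral_p_lap hα hΩ hΩo hxψ
  have i1 : Integrable (fun x => u x i * lap ψ x) := integrable_mul_test (h.mem_u.1.val i).1 hψ.lap
  have i2 : Integrable (fun x => p x * lap (fun y => y i * ψ y) x) :=
    integrable_mul_test h.mem_p.1 hxψ.lap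
  have i3 : Integrable (fun x => p x * pd i ψ x) := integrable_mul_test h.mem_p.1 (hψ.pd i)
  have e : ∀ x, (u x i - 2⁻¹ * (x i * p x)) * lap ψ x
      = u x i * lap ψ x - (2⁻¹ * (p x * lap (fun y => y i * ψ y) x) - p x * pd i ψ x) := by
    intro x
    rw [lap_coord_mul hψ.1]
    ring
  simp only [e]
  have i4 : Integrable (fun x => 2⁻¹ * (p x * lap (fun y => y i * ψ y) x) - p x * pd i ψ x) :=
    (i2.const_mul _).sub i3
  rw [integral_sub i1 i4, integral_sub (i2.const_mul _) i3,
    integral_const_mul, h4, h3]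
  simp

end Pressure

/-! ### A smooth truncation of x / |x|^d -/

section Profile

variable (d : ℕ)

theorem measureReal_unitBall_pos : 0 < (volume : Measure (Eu d)).real (Metric.ball 0 1) :=
  ENNReal.toReal_pos (Metric.measure_ball_pos _ _ one_pos).ne' measure_ball_lt_top.ne

/-- A smooth profile equal to `s ^ (-d / 2)` for `s ≥ 1` and vanishing for `s ≤ 1 / 2`. -/
noncomputable def profile (s : ℝ) : ℝ := Real.smoothTransition (2 * s - 1) * s ^ (-(d : ℝ) / 2)

theorem profile_of_one_le {s : ℝ} (hs : 1 ≤ s) : profile d s = s ^ (-(d : ℝ) / 2) := by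
  rw [profile, Real.smoothTransition.one_of_one_le (by linarith), one_mul]

theorem profile_of_le_half {s : ℝ} (hs : s ≤ 1 / 2) : profile d s = 0 := by
  rw [profile, Real.smoothTransition.zero_of_nonpos (by linarith), zero_mul]

theorem contDiff_profile : ContDiff ℝ ∞ (profile d) := by
  rw [contDiff_iff_contDiffAt]
  intro s
  rcases lt_or_ge s (1 / 2) with hs | hs
  · refine (contDiffAt_const (c := (0 : ℝ))).congr_of_eventuallyEq ?_
    filter_upwards [Iio_mem_nhds hs] with t ht
    exact profile_of_le_half d ht.le
  · refine ContDiffAt.mul ?_ ?_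
    · exact Real.smoothTransition.contDiff.contDiffAt.comp s (by fun_prop)
    · exact contDiffAt_id.rpow_const_of_ne (by simp; linarith)

/-- The divergence of `x ↦ profile d (‖x‖ ^ 2) • x` as a function of `‖x‖ ^ 2`. -/
noncomputable def profileDiv (s : ℝ) : ℝ := d * profile d s + 2 * s * deriv (profile d) s

theorem contDiff_deriv_profile : ContDiff ℝ ∞ (deriv (profile d)) :=
  (contDiff_infty_iff_deriv.1 (contDiff_profile d)).2

theorem contDiff_profileDiv : ContDiff ℝ ∞ (profileDiv d) :=
  (contDiff_const.mul (contDiff_profile d)).add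
    ((contDiff_const.mul contDiff_id).mul (contDiff_deriv_profile d))

theorem hasDerivAt_profile (s : ℝ) : HasDerivAt (profile d) (deriv (profile d) s) s :=
  ((contDiff_profile d).differentiable (by simp) s).hasDerivAt

theorem profileDiv_of_lt_half {s : ℝ} (hs : s < 1 / 2) : profileDiv d s = 0 := by
  have : profile d =ᶠ[𝓝 s] fun _ => 0 := by
    filter_upwards [Iio_mem_nhds hs] with t ht
    exact profile_of_le_half d ht.le
  rw [profileDiv, this.deriv_eq, profile_of_le_half d hs.le]
  simp

/-- There the profile is the pure power s^(-d/2), and x / |x|^d is divergence free away from the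
origin. -/
theorem profileDiv_of_one_lt {s : ℝ} (hs : 1 < s) : profileDiv d s = 0 := by
  have : profile d =ᶠ[𝓝 s] fun t => t ^ (-(d : ℝ) / 2) := by
    filter_upwards [Ioi_mem_nhds hs] with t ht
    exact profile_of_one_le d (le_of_lt ht)
  have hs0 : 0 < s := by linarith
  rw [profileDiv, this.deriv_eq, profile_of_one_le d hs.le,
    Real.deriv_rpow_const, Real.rpow_sub_one hs0.ne']
  field_simp
  ring

theorem exists_bound_profileDiv : ∃ M : ℝ, 0 < M ∧ ∀ s, |profileDiv d s| ≤ M := by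
  have hc : HasCompactSupport (profileDiv d) := by
    refine HasCompactSupport.intro (isCompact_Icc (a := (1 / 2 : ℝ)) (b := 1)) fun s hs => ?_
    simp only [Set.mem_Icc, not_and_or, not_le] at hs
    rcases hs with hs | hs
    · exact profileDiv_of_lt_half d hs
    · exact profileDiv_of_one_lt d hs
  obtain ⟨M, hM⟩ := hc.exists_bound_of_continuous (contDiff_profileDiv d).continuous
  exact ⟨max M 1, by positivity, fun s => (hM s).trans (le_max_left _ _)⟩

/-- In polar coordinates the radial integrand is the derivative of y^d · profile(y²), which vanishes
at 0 and equals 1 for y ≥ 1. The integral is therefore d times the volume of the unit ball; it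
serves as the normalising constant κ of the mollifiers. -/
theorem integral_profileDiv [NeZero d] :
    0 < ∫ x : Eu d, profileDiv d (‖x‖ ^ 2) := by
  have hd : 1 ≤ d := Nat.one_le_iff_ne_zero.2 (NeZero.ne d)
  have h1 := integral_fun_norm_addHaar (volume : Measure (Eu d)) (fun y => profileDiv d (y ^ 2))
  rw [h1]
  have hder : ∀ y : ℝ, HasDerivAt (fun y => y ^ d * profile d (y ^ 2))
      (y ^ (d - 1) * profileDiv d (y ^ 2)) y := by
    intro y
    have ha := (hasDerivAt_pow d y)
    have hb : HasDerivAt (fun y : ℝ => profile d (y ^ 2)) (deriv (profile d) (y ^ 2) * (2 * y)) y := by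
      have h2 : HasDerivAt (fun y : ℝ => y ^ 2) (2 * y) y := by simpa using hasDerivAt_pow 2 y
      exact (hasDerivAt_profile d (y ^ 2)).comp y h2
    have e : y ^ (d - 1) * profileDiv d (y ^ 2) = d * y ^ (d - 1) * profile d (y ^ 2)
        + y ^ d * (deriv (profile d) (y ^ 2) * (2 * y)) := by
      have : y ^ d = y ^ (d - 1) * y := by rw [← pow_succ, Nat.sub_add_cancel hd]
      rw [this]
      unfold profileDiv
      ring
    rw [e]
    exact ha.mul hb
  have hint : IntegrableOn (fun y : ℝ => y ^ (d - 1) * profileDiv d (y ^ 2)) (Set.Ioi 0) := by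
    refine (Continuous.integrable_of_hasCompactSupport ?_ ?_).integrableOn
    · exact (continuous_pow _).mul ((contDiff_profileDiv d).continuous.comp (continuous_pow 2))
    · refine HasCompactSupport.intro (isCompact_Icc (a := (-1 : ℝ)) (b := 1)) fun y hy => ?_
      have : 1 < y ^ 2 := by
        rw [one_lt_sq_iff_one_lt_abs]
        by_contra hcon
        exact hy (abs_le.1 (not_lt.1 hcon))
      rw [profileDiv_of_one_lt d this, mul_zero]
  have hlim : Tendsto (fun y : ℝ => y ^ d * profile d (y ^ 2)) atTop (𝓝 1) := by
    refine tendsto_const_nhds.congr' ?_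
    filter_upwards [eventually_ge_atTop 1] with y hy
    have hy0 : 0 < y := by linarith
    rw [profile_of_one_le d (by nlinarith), ← Real.rpow_natCast, ← Real.rpow_natCast,
      ← Real.rpow_mul hy0.le, ← Real.rpow_add hy0]
    have : (d : ℝ) + ((2 : ℕ) : ℝ) * (-(d : ℝ) / 2) = 0 := by push_cast; ring
    rw [this, Real.rpow_zero]
  have hI := integral_Ioi_of_hasDerivAt_of_tendsto (a := 0)
    (hder 0).continuousAt.continuousWithinAt (fun y _ => hder y) hint hlim
  simp only [finrank_euclideanSpace, Fintype.card_fin, smul_eq_mul, nsmul_eq_mul]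
  rw [hI]
  have h0 : profile d 0 = 0 := profile_of_le_half d (by norm_num)
  have hv := measureReal_unitBall_pos d
  have hd0 : (0 : ℝ) < d := by exact_mod_cast hd
  simp only [ne_eq, OfNat.ofNat_ne_zero, not_false_eq_true, zero_pow, h0, mul_zero, sub_zero, mul_one]
  positivity

end Profile

/-! ### Mollifiers, their potentials and a local representation formula -/

section Kernel

variable {d : ℕ}

/-- The rescaled profile. -/
noncomputable def scaledProfile (d : ℕ) (ε s : ℝ) : ℝ := (ε ^ d)⁻¹ * profile d (s / ε ^ 2)

/-- A smooth radial kernel supported in the ball of radius `ε`. -/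
noncomputable def mollifier (ε : ℝ) (x : Eu d) : ℝ := (ε ^ d)⁻¹ * profileDiv d (‖x‖ ^ 2 / ε ^ 2)

theorem contDiff_scaledProfile (ε : ℝ) : ContDiff ℝ ∞ (scaledProfile d ε) :=
  contDiff_const.mul ((contDiff_profile d).comp (contDiff_id.div_const _))

theorem contDiff_mollifier (ε : ℝ) : ContDiff ℝ ∞ (mollifier ε : Eu d → ℝ) :=
  contDiff_const.mul ((contDiff_profileDiv d).comp ((contDiff_norm_sq ℝ).div_const _))

theorem mollifier_neg (ε : ℝ) (x : Eu d) : mollifier ε (-x) = mollifier ε x := by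
  simp [mollifier]

theorem mollifier_eq_zero {ε : ℝ} (hε : 0 < ε) {x : Eu d} (hx : ε < ‖x‖) : mollifier ε x = 0 := by
  rw [mollifier, profileDiv_of_one_lt, mul_zero]
  rw [lt_div_iff₀ (by positivity), one_mul]
  exact pow_lt_pow_left₀ hx hε.le (by norm_num)

theorem support_mollifier_subset {ε : ℝ} (hε : 0 < ε) :
    Function.support (mollifier ε : Eu d → ℝ) ⊆ Metric.closedBall 0 ε := fun x hx => by
  simp only [Metric.mem_closedBall, dist_zero_right]
  by_contra hcon
  exact hx (mollifier_eq_zero hε (not_le.1 hcon))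

theorem hasCompactSupport_mollifier {ε : ℝ} (hε : 0 < ε) :
    HasCompactSupport (mollifier ε : Eu d → ℝ) :=
  HasCompactSupport.intro (isCompact_closedBall 0 ε) fun x hx => by
    by_contra h
    exact hx (support_mollifier_subset hε h)

/-- The prefactor ε^(-d) makes all rescalings agree outside their own balls. Hence differences of
two of them have compact support. -/
theorem scaledProfile_of_le {ε s : ℝ} (hε : 0 < ε) (hs : ε ^ 2 ≤ s) :
    scaledProfile d ε s = s ^ (-(d : ℝ) / 2) := by
  have hs0 : 0 ≤ s := (sq_nonneg ε).trans hs
  rw [scaledProfile, profile_of_one_le d ((one_le_div (by positivity)).2 hs),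
    Real.div_rpow hs0 (by positivity)]
  have : (ε ^ 2) ^ (-(d : ℝ) / 2) = (ε ^ d)⁻¹ := by
    rw [← Real.rpow_natCast, ← Real.rpow_natCast, ← Real.rpow_mul hε.le, ← Real.rpow_neg hε.le]
    congr 1
    push_cast
    ring
  rw [this]
  field_simp

theorem integral_mollifier {ε : ℝ} (hε : 0 < ε) :
    ∫ x : Eu d, mollifier ε x = ∫ x : Eu d, profileDiv d (‖x‖ ^ 2) := by
  have h := Measure.integral_comp_smul (volume : Measure (Eu d))
    (fun x => profileDiv d (‖x‖ ^ 2)) ε⁻¹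
  have e : ∀ x : Eu d, mollifier ε x = (ε ^ d)⁻¹ * profileDiv d (‖ε⁻¹ • x‖ ^ 2) := by
    intro x
    rw [mollifier, norm_smul, mul_pow, norm_inv, Real.norm_of_nonneg hε.le]
    congr 2
    field_simp
  simp only [e]
  rw [integral_const_mul, h]
  simp only [finrank_euclideanSpace, Fintype.card_fin, inv_pow, inv_inv, smul_eq_mul]
  rw [abs_of_pos (by positivity)]
  field_simp

theorem hasFDerivAt_radial {G g : ℝ → ℝ} (hG : ∀ s, HasDerivAt G (g s) s) (x : Eu d) :
    HasFDerivAt (fun x : Eu d => G (‖x‖ ^ 2)) (g (‖x‖ ^ 2) • (2 • innerSL ℝ x)) x := by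
  have h1 : HasFDerivAt (fun x : Eu d => ‖x‖ ^ 2) (2 • innerSL ℝ x) x := by
    simpa using (hasStrictFDerivAt_norm_sq x).hasFDerivAt
  exact (hG _).comp_hasFDerivAt x h1

theorem inner_unitVec (x : Eu d) (j : Fin d) : inner ℝ x (unitVec j) = x j := by
  simp [unitVec, EuclideanSpace.inner_single_right]

theorem pd_radial {G g : ℝ → ℝ} (hG : ∀ s, HasDerivAt G (g s) s) (j : Fin d) (x : Eu d) :
    pd j (fun x : Eu d => G (‖x‖ ^ 2)) x = 2 * g (‖x‖ ^ 2) * x j := by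
  rw [pd, (hasFDerivAt_radial hG x).fderiv]
  simp [inner_unitVec]
  ring

/-- A smooth compactly supported radial function whose Laplacian is a difference of mollifiers. -/
noncomputable def kernel (R ε : ℝ) (x : Eu d) : ℝ :=
  ∫ s in (R ^ 2)..(‖x‖ ^ 2), 2⁻¹ * (scaledProfile d R s - scaledProfile d ε s)

theorem hasDerivAt_kernel_profile (R ε s : ℝ) :
    HasDerivAt (fun t => ∫ s in (R ^ 2)..t, 2⁻¹ * (scaledProfile d R s - scaledProfile d ε s))
      (2⁻¹ * (scaledProfile d R s - scaledProfile d ε s)) s := by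
  have hc : Continuous fun s => 2⁻¹ * (scaledProfile d R s - scaledProfile d ε s) :=
    continuous_const.mul ((contDiff_scaledProfile R).continuous.sub
      (contDiff_scaledProfile ε).continuous)
  exact hc.integral_hasStrictDerivAt _ _ |>.hasDerivAt

theorem pd_kernel (R ε : ℝ) (j : Fin d) :
    pd j (kernel R ε : Eu d → ℝ)
      = fun x => (scaledProfile d R (‖x‖ ^ 2) - scaledProfile d ε (‖x‖ ^ 2)) * x j := by
  funext x
  have := pd_radial (hasDerivAt_kernel_profile (d := d) R ε) j x
  unfold kernel
  rw [this]
  ring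

theorem contDiff_kernel (R ε : ℝ) : ContDiff ℝ ∞ (kernel R ε : Eu d → ℝ) := by
  have h : ContDiff ℝ ∞
      (fun t => ∫ s in (R ^ 2)..t, 2⁻¹ * (scaledProfile d R s - scaledProfile d ε s)) := by
    rw [contDiff_infty_iff_deriv]
    refine ⟨fun s => (hasDerivAt_kernel_profile R ε s).differentiableAt, ?_⟩
    have : deriv (fun t => ∫ s in (R ^ 2)..t, 2⁻¹ * (scaledProfile d R s - scaledProfile d ε s))
        = fun s => 2⁻¹ * (scaledProfile d R s - scaledProfile d ε s) :=
      funext fun s => (hasDerivAt_kernel_profile R ε s).deriv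
    rw [this]
    exact contDiff_const.mul ((contDiff_scaledProfile R).sub (contDiff_scaledProfile ε))
  exact h.comp (contDiff_norm_sq ℝ)

theorem pd_scaledProfile (ε : ℝ) (j : Fin d) (x : Eu d) :
    pd j (fun x : Eu d => scaledProfile d ε (‖x‖ ^ 2) * x j) x
      = scaledProfile d ε (‖x‖ ^ 2)
        + 2 * ((ε ^ d)⁻¹ * (deriv (profile d) (‖x‖ ^ 2 / ε ^ 2) / ε ^ 2)) * (x j) ^ 2 := by
  have hder : ∀ s, HasDerivAt (scaledProfile d ε)
      ((ε ^ d)⁻¹ * (deriv (profile d) (s / ε ^ 2) / ε ^ 2)) s := by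
    intro s
    have h1 : HasDerivAt (fun s : ℝ => s / ε ^ 2) (1 / ε ^ 2) s := (hasDerivAt_id s).div_const _
    have h2 := ((hasDerivAt_profile d (s / ε ^ 2)).comp s h1).const_mul (ε ^ d)⁻¹
    have e : (ε ^ d)⁻¹ * (deriv (profile d) (s / ε ^ 2) / ε ^ 2)
        = (ε ^ d)⁻¹ * (deriv (profile d) (s / ε ^ 2) * (1 / ε ^ 2)) := by ring
    rw [e]
    exact h2
  have hs : DifferentiableAt ℝ (fun x : Eu d => scaledProfile d ε (‖x‖ ^ 2)) x :=
    (hasFDerivAt_radial hder x).differentiableAt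
  rw [pd_mul hs ((contDiff_coord j).differentiable (by simp) x), pd_radial hder, pd_coord]
  simp
  ring

/-- The gradient of the kernel is x times a difference of scaled profiles, and the divergence of
each part is a mollifier. Only the gradient x |x|^(-d) of the fundamental solution is written down,
so the logarithm in dimension two needs no separate treatment. -/
theorem lap_kernel {R ε : ℝ} (hR : 0 < R) (hε : 0 < ε) (x : Eu d) :
    lap (kernel R ε) x = mollifier R x - mollifier ε x := by
  have key : ∀ δ : ℝ, 0 < δ →
      ∑ j, pd j (fun x : Eu d => scaledProfile d δ (‖x‖ ^ 2) * x j) x = mollifier δ x := by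
    intro δ hδ
    simp only [pd_scaledProfile, Finset.sum_add_distrib, ← Finset.mul_sum]
    rw [← EuclideanSpace.real_norm_sq_eq]
    simp only [Finset.sum_const, Finset.card_univ, Fintype.card_fin, nsmul_eq_mul, scaledProfile,
      mollifier, profileDiv]
    field_simp
  have hdiff : ∀ (δ : ℝ) (j : Fin d),
      DifferentiableAt ℝ (fun x : Eu d => scaledProfile d δ (‖x‖ ^ 2) * x j) x := by
    intro δ j
    exact (((contDiff_scaledProfile δ).comp (contDiff_norm_sq ℝ)).mul
      (contDiff_coord j)).differentiable (by simp) x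
  rw [lap, ← key R hR, ← key ε hε, ← Finset.sum_sub_distrib]
  refine Finset.sum_congr rfl fun j _ => ?_
  rw [pd_kernel, ← pd_sub (hdiff R j) (hdiff ε j)]
  simp only [sub_mul]

/-- The radial integral starts at R², and beyond this value both scaled profiles equal s^(-d/2), so
the integrand vanishes. -/
theorem kernel_eq_zero {R ε : ℝ} (hε : 0 < ε) (hεR : ε ≤ R) {x : Eu d} (hx : R ≤ ‖x‖) :
    kernel R ε x = 0 := by
  have hR : 0 < R := hε.trans_le hεR
  have hle : R ^ 2 ≤ ‖x‖ ^ 2 := pow_le_pow_left₀ hR.le hx 2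
  unfold kernel
  refine intervalIntegral.integral_zero_ae (Eventually.of_forall fun s hs => ?_)
  rw [Set.uIoc_of_le hle] at hs
  rw [scaledProfile_of_le hR hs.1.le,
    scaledProfile_of_le hε ((pow_le_pow_left₀ hε.le hεR 2).trans hs.1.le)]
  simp

theorem pd_comp_sub (f : Eu d → ℝ) (a : Eu d) (j : Fin d) (y : Eu d) :
    pd j (fun y => f (y - a)) y = pd j f (y - a) := by
  simp only [pd]
  rw [fderiv_comp_sub]

theorem lap_comp_sub (f : Eu d → ℝ) (a : Eu d) (y : Eu d) :
    lap (fun y => f (y - a)) y = lap f (y - a) := by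
  simp only [lap]
  refine Finset.sum_congr rfl fun j _ => ?_
  rw [← pd_comp_sub (pd j f)]
  congr 1
  funext y
  exact pd_comp_sub f a j y

theorem isTest_kernel_sub {R ε : ℝ} (hε : 0 < ε) (hεR : ε ≤ R) {U : Set (Eu d)} {x : Eu d}
    (hx : Metric.closedBall x R ⊆ U) : IsTest U (fun y => kernel R ε (y - x)) := by
  have h0 : ∀ y ∉ Metric.closedBall x R, kernel R ε (y - x) = 0 := by
    intro y hy
    rw [Metric.mem_closedBall, dist_eq_norm, not_le] at hy
    exact kernel_eq_zero hε hεR hy.le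
  refine ⟨(contDiff_kernel R ε).comp (contDiff_id.sub contDiff_const),
    HasCompactSupport.intro (isCompact_closedBall x R) h0, ?_⟩
  refine (closure_minimal (fun y hy => ?_) Metric.isClosed_closedBall).trans hx
  by_contra hcon
  exact hy (h0 y hcon)

/-- A local representation of the solutions of a Poisson problem with dipole right-hand side. -/
theorem ae_representation [NeZero d] {f : Eu d → ℝ} (hf : LocallyIntegrable f) {U B : Set (Eu d)}
    {F z : Eu d} (hw : ∀ ψ, IsTest U ψ → ∫ x, f x * lap ψ x = - ∑ i, F i * pd i ψ z)
    {R : ℝ} (hR : 0 < R) (hB : ∀ x ∈ B, Metric.closedBall x R ⊆ U) :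
    ∀ᵐ x, x ∈ B → x ≠ z → (∫ y : Eu d, profileDiv d (‖y‖ ^ 2)) * f x
      = (∫ y, f y * mollifier R (y - x))
        + ∑ i, F i * (((‖x - z‖ ^ 2) ^ (-(d : ℝ) / 2) - scaledProfile d R (‖x - z‖ ^ 2))
            * (x - z) i) := by
  set κ := ∫ y : Eu d, profileDiv d (‖y‖ ^ 2) with hκ
  have hκ0 : 0 < κ := integral_profileDiv d
  obtain ⟨M, hM0, hM⟩ := exists_bound_profileDiv d
  filter_upwards [(Besicovitch.vitaliFamily volume).ae_tendsto_average_norm_sub hf] with x hx hxB hxz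
  have hlim : Tendsto (fun ε : ℝ => ⨍ y in Metric.closedBall x ε, ‖f y - f x‖) (𝓝[>] 0) (𝓝 0) :=
    hx.comp (Besicovitch.tendsto_filterAt volume x)
  have hpos : ∀ᶠ ε : ℝ in 𝓝[>] 0, 0 < ε := eventually_mem_nhdsWithin
  -- At a Lebesgue point x the normalised mollifiers are an approximate identity. The three
  -- remaining goals are that their integrals tend to 1, that their supports lie in the balls, and
  -- that their size is at most a constant over the volume of the ball.
  have hmain := tendsto_integral_smul_of_tendsto_average_norm_sub
    (g := fun (ε : ℝ) y => κ⁻¹ * mollifier ε (y - x)) 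
    (κ⁻¹ * (M * (volume : Measure (Eu d)).real (Metric.ball 0 1))) hlim
    (Eventually.of_forall fun ε => hf.integrableOn_isCompact (isCompact_closedBall x ε)) ?_ ?_ ?_
  · have hev : ∀ᶠ ε : ℝ in 𝓝[>] 0, ∫ y, (κ⁻¹ * mollifier ε (y - x)) • f y
        = κ⁻¹ * ((∫ y, f y * mollifier R (y - x))
        + ∑ i, F i * (((‖x - z‖ ^ 2) ^ (-(d : ℝ) / 2) - scaledProfile d R (‖x - z‖ ^ 2))
            * (x - z) i)) := by
      have h1 : ∀ᶠ ε : ℝ in 𝓝[>] 0, ε < min R ‖x - z‖ :=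
        (gt_mem_nhds (lt_min hR (norm_pos_iff.2 (sub_ne_zero.2 hxz)))).filter_mono
          nhdsWithin_le_nhds
      filter_upwards [hpos, h1] with ε hε hεm
      have hεR : ε ≤ R := (hεm.trans_le (min_le_left _ _)).le
      have hεz : ε ≤ ‖x - z‖ := (hεm.trans_le (min_le_right _ _)).le
      -- Testing with the kernel centred at x trades the mollifier at scale ε for the one at scale
      -- R, at the price of a source term evaluated at z. Once ε ≤ |x - z| that term no longer
      -- depends on ε.
      have h2 := hw _ (isTest_kernel_sub hε hεR (hB x hxB))
      simp only [lap_comp_sub, lap_kernel hR hε, pd_comp_sub, pd_kernel] at h2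
      have hint : ∀ δ : ℝ, 0 < δ → Integrable fun y => f y * mollifier δ (y - x) := by
        intro δ hδ
        have := hf.integrable_smul_left_of_hasCompactSupport
          (g := fun y => mollifier δ (y - x))
          ((contDiff_mollifier δ).continuous.comp (continuous_id.sub continuous_const))
          (HasCompactSupport.intro (isCompact_closedBall x δ) fun y hy => by
            rw [Metric.mem_closedBall, dist_eq_norm, not_le] at hy
            exact mollifier_eq_zero hδ hy)
        simpa [mul_comm] using this
      have h3 : ∫ y, f y * mollifier ε (y - x) = (∫ y, f y * mollifier R (y - x))
          - ∫ y, f y * (mollifier R (y - x) - mollifier ε (y - x)) := by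
        rw [← integral_sub (hint R hR)]
        · congr 1
          funext y
          ring
        · simp only [mul_sub]
          exact (hint R hR).sub (hint ε hε)
      have h4 : ∫ y, (κ⁻¹ * mollifier ε (y - x)) • f y = κ⁻¹ * ∫ y, f y * mollifier ε (y - x) := by
        rw [← integral_const_mul]
        congr 1
        funext y
        rw [smul_eq_mul]
        ring
      rw [h4, h3, h2, norm_sub_rev z x]
      congr 1
      rw [sub_neg_eq_add, add_left_cancel_iff]
      refine Finset.sum_congr rfl fun i _ => ?_
      rw [scaledProfile_of_le hε (pow_le_pow_left₀ hε.le hεz 2)]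
      simp only [PiLp.sub_apply]
      ring
    have h5 := tendsto_nhds_unique hmain (tendsto_const_nhds.congr' (EventuallyEq.symm hev))
    rw [h5, mul_inv_cancel_left₀ hκ0.ne']
  · refine tendsto_const_nhds.congr' ?_
    filter_upwards [hpos] with ε hε
    rw [integral_const_mul, integral_sub_right_eq_self (fun y => mollifier ε y),
      integral_mollifier hε, inv_mul_cancel₀ hκ0.ne']
  · filter_upwards [hpos] with ε hε y hy
    rw [Metric.mem_closedBall, dist_eq_norm]
    by_contra hcon
    exact hy (by simp [mollifier_eq_zero hε (not_le.1 hcon)])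
  · filter_upwards [hpos] with ε hε y
    rw [measureReal_def (s := Metric.closedBall x ε), Measure.addHaar_closedBall _ _ hε.le, ENNReal.toReal_mul,
      ENNReal.toReal_ofReal (by positivity), ← measureReal_def, finrank_euclideanSpace,
      Fintype.card_fin, abs_mul, abs_of_pos (inv_pos.2 hκ0), mollifier, abs_mul,
      abs_of_pos (by positivity : 0 < (ε ^ d)⁻¹)]
    have hv := measureReal_unitBall_pos d
    have := hM (‖y - x‖ ^ 2 / ε ^ 2)
    have e : κ⁻¹ * (M * (volume : Measure (Eu d)).real (Metric.ball 0 1))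
        / (ε ^ d * (volume : Measure (Eu d)).real (Metric.ball 0 1)) = κ⁻¹ * ((ε ^ d)⁻¹ * M) := by
      field_simp
    rw [e]
    gcongr

end Kernel

/-! ### Linear operations in the weighted spaces -/

section WeightedAlgebra

variable {d : ℕ} {z : Eu d} {β : ℝ} {Ω : Set (Eu d)} {f g : Eu d → ℝ}

theorem MemWL2.aestronglyMeasurable (hf : MemWL2 z β Ω f) :
    AEStronglyMeasurable f (volume.restrict Ω) := hf.1.aestronglyMeasurable

theorem MemWL2.add (hf : MemWL2 z β Ω f) (hg : MemWL2 z β Ω g) :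
    MemWL2 z β Ω (fun x => f x + g x) := by
  refine ⟨hf.1.add hg.1, ?_⟩
  refine Integrable.mono' ((hf.2.const_mul 2).add (hg.2.const_mul 2)) ?_ ?_
  · exact (measurable_weight z β).aestronglyMeasurable.mul
      ((hf.aestronglyMeasurable.add hg.aestronglyMeasurable).pow 2)
  · refine Eventually.of_forall fun x => ?_
    have hw := weight_nonneg z β x
    rw [Real.norm_of_nonneg (by positivity)]
    simp only [Pi.add_apply]
    nlinarith [mul_nonneg hw (sq_nonneg (f x - g x))]

theorem MemWL2.const_mul (hf : MemWL2 z β Ω f) (c : ℝ) : MemWL2 z β Ω (fun x => c * f x) := by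
  refine ⟨?_, ?_⟩
  · have := hf.1.smul c
    simpa [Pi.smul_def] using! this
  · have := hf.2.const_mul (c ^ 2)
    refine this.congr (Eventually.of_forall fun x => ?_)
    simp only
    ring

theorem MemWL2.sub (hf : MemWL2 z β Ω f) (hg : MemWL2 z β Ω g) :
    MemWL2 z β Ω (fun x => f x - g x) := by
  have := hf.add (hg.const_mul (-1))
  simpa [sub_eq_add_neg] using this

theorem frob_self (A : Matrix (Fin d) (Fin d) ℝ) : frob A A = ∑ i, ∑ j, A i j ^ 2 := by
  simp [frob, sq]

theorem frob_self_nonneg (A : Matrix (Fin d) (Fin d) ℝ) : 0 ≤ frob A A := by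
  rw [frob_self]
  positivity

theorem integrableOn_distSq {v w : Eu d → Eu d} {G H : Eu d → Matrix (Fin d) (Fin d) ℝ}
    (hv : ∀ i, MemWL2 z β Ω (fun x => v x i)) (hw : ∀ i, MemWL2 z β Ω (fun x => w x i))
    (hG : ∀ i j, MemWL2 z β Ω (fun x => G x i j)) (hH : ∀ i j, MemWL2 z β Ω (fun x => H x i j)) :
    IntegrableOn (fun x => weight z β x * (‖v x - w x‖ ^ 2 + frob (G x - H x) (G x - H x))) Ω := by
  have h1 : IntegrableOn (fun x => ∑ i, weight z β x * (v x i - w x i) ^ 2) Ω :=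
    integrable_finsetSum _ fun i _ => ((hv i).sub (hw i)).2
  have h2 : IntegrableOn (fun x => ∑ i, ∑ j, weight z β x * (G x i j - H x i j) ^ 2) Ω :=
    integrable_finsetSum _ fun i _ => integrable_finsetSum _ fun j _ => ((hG i j).sub (hH i j)).2
  refine (h1.add h2).congr (Eventually.of_forall fun x => ?_)
  simp only [Pi.add_apply, frob_self, EuclideanSpace.real_norm_sq_eq, Matrix.sub_apply,
    PiLp.sub_apply, mul_add, Finset.mul_sum]

theorem distSqWH1_nonneg (φ v : Eu d → Eu d) (G : Eu d → Matrix (Fin d) (Fin d) ℝ) :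
    0 ≤ distSqWH1 z β Ω φ v G :=
  integral_nonneg fun x => mul_nonneg (weight_nonneg z β x)
    (add_nonneg (sq_nonneg _) (frob_self_nonneg _))

end WeightedAlgebra

/-! ### Local representation on an open set and Weyl's lemma -/

section Weyl

variable {d : ℕ}

theorem convolution_mollifier (f : Eu d → ℝ) (R : ℝ) (x : Eu d) :
    (convolution f (mollifier R) (ContinuousLinearMap.lsmul ℝ ℝ) volume) x
      = ∫ y, f y * mollifier R (y - x) := by
  rw [convolution]
  congr 1
  funext y
  rw [← mollifier_neg, neg_sub]
  rfl

theorem contDiff_integral_mollifier {f : Eu d → ℝ} (hf : LocallyIntegrable f) {R : ℝ}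
    (hR : 0 < R) : ContDiff ℝ ∞ (fun x => ∫ y, f y * mollifier R (y - x)) := by
  have := (hasCompactSupport_mollifier hR).contDiff_convolution_right
    (ContinuousLinearMap.lsmul ℝ ℝ) hf (contDiff_mollifier (d := d) R)
  rwa [funext (convolution_mollifier f R)] at this

theorem integrable_indicator_ball {f : Eu d → ℝ} {Ω : Set (Eu d)} (hf : LocallyIntegrableOn f Ω)
    {z : Eu d} {r : ℝ} (hr : Metric.closedBall z r ⊆ Ω) :
    Integrable ((Metric.ball z r).indicator f) := by
  rw [integrable_indicator_iff measurableSet_ball]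
  exact (hf.integrableOn_compact_subset hr (isCompact_closedBall z r)).mono_set
    Metric.ball_subset_closedBall

theorem indicator_mul_test {f ψ : Eu d → ℝ} {U : Set (Eu d)} (hψ : IsTest U ψ) (x : Eu d) :
    U.indicator f x * ψ x = f x * ψ x := by
  by_cases hx : x ∈ U
  · rw [Set.indicator_of_mem hx]
  · rw [hψ.eq_zero hx]
    simp

theorem closedBall_subset_ball_add {z x : Eu d} {r R : ℝ} (hx : x ∈ Metric.ball z r) :
    Metric.closedBall x R ⊆ Metric.ball z (r + R) := by
  intro y hy
  rw [Metric.mem_ball] at hx ⊢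
  rw [Metric.mem_closedBall] at hy
  linarith [dist_triangle y x z]

/-- The local representation of `ae_representation` for functions on an open set. -/
theorem ae_representation_on [NeZero d] {f : Eu d → ℝ} {Ω : Set (Eu d)}
    (hf : LocallyIntegrableOn f Ω) {F z : Eu d} {R : ℝ} (hR : 0 < R)
    (hz : Metric.closedBall z (3 * R) ⊆ Ω)
    (hw : ∀ ψ, IsTest Ω ψ → ∫ x, f x * lap ψ x = - ∑ i, F i * pd i ψ z) :
    ∀ᵐ x, x ∈ Metric.ball z (2 * R) → (∫ y : Eu d, profileDiv d (‖y‖ ^ 2)) * f x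
      = (∫ y, (Metric.ball z (3 * R)).indicator f y * mollifier R (y - x))
        + ∑ i, F i * (((‖x - z‖ ^ 2) ^ (-(d : ℝ) / 2) - scaledProfile d R (‖x - z‖ ^ 2))
            * (x - z) i) := by
  have h := ae_representation (integrable_indicator_ball hf hz).locallyIntegrable
    (U := Metric.ball z (3 * R)) (B := Metric.ball z (2 * R)) (F := F) (z := z) (fun ψ hψ => by
      simp only [indicator_mul_test hψ.lap]
      exact hw ψ (hψ.mono (Metric.ball_subset_closedBall.trans hz))) hR (fun x hx => by
      have := closedBall_subset_ball_add (R := R) hx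
      convert this using 2
      ring)
  have hz0 : ∀ᵐ x : Eu d, x ≠ z := by
    exact Measure.ae_ne volume z
  filter_upwards [h, hz0] with x hx hxz hxB
  have := hx hxB hxz
  rwa [Set.indicator_of_mem (Metric.ball_subset_ball (by linarith) hxB)] at this

/-- Weyl's lemma. -/
theorem exists_contDiff_of_weakly_harmonic [NeZero d] {f : Eu d → ℝ} {Ω : Set (Eu d)}
    (hf : LocallyIntegrableOn f Ω) {z : Eu d} {R : ℝ} (hR : 0 < R)
    (hz : Metric.closedBall z (3 * R) ⊆ Ω)
    (hw : ∀ ψ, IsTest Ω ψ → ∫ x, f x * lap ψ x = 0) :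
    ∃ g : Eu d → ℝ, ContDiff ℝ ∞ g ∧ ∀ᵐ x, x ∈ Metric.ball z (2 * R) → f x = g x := by
  have hκ0 := integral_profileDiv d
  refine ⟨fun x => (∫ y : Eu d, profileDiv d (‖y‖ ^ 2))⁻¹ *
    ∫ y, (Metric.ball z (3 * R)).indicator f y * mollifier R (y - x),
    contDiff_const.mul (contDiff_integral_mollifier
      (integrable_indicator_ball hf hz).locallyIntegrable hR), ?_⟩
  -- Without a source the representation leaves only the convolution with a smooth compactly
  -- supported kernel.
  filter_upwards [ae_representation_on hf hR hz (F := 0) (by simpa using hw)] with x hx hxB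
  have := hx hxB
  simp only [PiLp.zero_apply, zero_mul, Finset.sum_const_zero, add_zero] at this
  rw [← this, inv_mul_cancel_left₀ hκ0.ne']

end Weyl

/-! ### Regularity of source-free solutions and transfer to the dual weight -/

section Uniqueness

variable {d : ℕ} {Ω : Set (Eu d)} {z : Eu d} {α R : ℝ}

theorem weight_neg_le_mul {x : Eu d} (hR : 0 < R) (hα : 0 < α) (hx : R ≤ ‖x - z‖) :
    weight z (-α) x ≤ (R ^ (2 * α))⁻¹ * weight z α x := by
  have hx0 : 0 < ‖x - z‖ := hR.trans_le hx
  simp only [weight]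
  have h1 : R ^ (2 * α) ≤ ‖x - z‖ ^ (2 * α) := Real.rpow_le_rpow hR.le hx (by positivity)
  have h2 : ‖x - z‖ ^ α = ‖x - z‖ ^ (2 * α) * ‖x - z‖ ^ (-α) := by
    rw [← Real.rpow_add hx0]
    congr 1
    ring
  have h3 : 0 < ‖x - z‖ ^ (-α) := Real.rpow_pos_of_pos hx0 _
  have h4 : 0 < R ^ (2 * α) := Real.rpow_pos_of_pos hR _
  rw [h2, ← mul_assoc]
  refine le_mul_of_one_le_left h3.le ?_
  rw [inv_mul_eq_div, one_le_div h4]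
  exact h1

/-- A function in the space with the weaker weight that agrees near `z` with a continuous function
is in the space with the stronger weight. -/
theorem MemWL2.neg_of_ae_eq_continuous [NeZero d] {f g : Eu d → ℝ} (hf : MemWL2 z α Ω f)
    (hg : Continuous g) (hR : 0 < R) (hα : 0 < α) (hαd : α < d)
    (hfg : ∀ᵐ x, x ∈ Metric.ball z R → f x = g x) : MemWL2 z (-α) Ω f := by
  refine ⟨hf.1, ?_⟩
  obtain ⟨C, hC⟩ := (isCompact_closedBall z R).exists_bound_of_continuousOn hg.continuousOn
  have hb : IntegrableOn (fun x => (Metric.ball z R).indicator (weight z (-α)) x * C ^ 2) Ω := by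
    refine Integrable.mul_const ?_ _
    refine Integrable.integrableOn ?_
    rw [integrable_indicator_iff measurableSet_ball]
    exact integrableOn_weight_ball z (by linarith) R
  refine Integrable.mono' (hb.add (hf.2.const_mul (R ^ (2 * α))⁻¹)) ?_ ?_
  · exact (measurable_weight z (-α)).aestronglyMeasurable.mul (hf.aestronglyMeasurable.pow 2)
  · filter_upwards [ae_restrict_of_ae hfg] with x hx
    have hw := weight_nonneg z (-α) x
    have hw' := weight_nonneg z α x
    rw [Real.norm_of_nonneg (by positivity)]
    simp only [Pi.add_apply]
    by_cases hxB : x ∈ Metric.ball z R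
    · rw [Set.indicator_of_mem hxB, hx hxB]
      have h1 := hC x (Metric.ball_subset_closedBall hxB)
      rw [Real.norm_eq_abs] at h1
      have h2 : g x ^ 2 ≤ C ^ 2 := by
        rw [← sq_abs]
        exact pow_le_pow_left₀ (abs_nonneg _) h1 2
      have h3 : 0 ≤ (R ^ (2 * α))⁻¹ * (weight z α x * g x ^ 2) := by positivity
      nlinarith [mul_le_mul_of_nonneg_left h2 hw]
    · rw [Set.indicator_of_notMem hxB]
      rw [Metric.mem_ball, dist_eq_norm, not_lt] at hxB
      have := mul_le_mul_of_nonneg_right (weight_neg_le_mul hR hα hxB) (sq_nonneg (f x))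
      linarith

theorem locallyIntegrableOn_coord_mul {f : Eu d → ℝ} (hΩ : IsOpen Ω)
    (hf : LocallyIntegrableOn f Ω) (i : Fin d) :
    LocallyIntegrableOn (fun x => x i * f x) Ω := by
  rw [locallyIntegrableOn_iff hΩ.isLocallyClosed] at hf ⊢
  intro k hk hkc
  exact (hf k hk hkc).continuousOn_mul (contDiff_coord i).continuous.continuousOn hkc

variable {F : Eu d} {u : Eu d → Eu d} {Du : Eu d → Matrix (Fin d) (Fin d) ℝ} {p : Eu d → ℝ}

/-- Interior regularity of the homogeneous problem. -/
theorem IsStokesSolution.exists_contDiff [NeZero d] (h : IsStokesSolution Ω z α 0 u Du p)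
    (hα : α < d) (hΩ : Bornology.IsBounded Ω) (hΩo : IsOpen Ω) (hR : 0 < R)
    (hz : Metric.closedBall z (3 * R) ⊆ Ω) :
    ∃ (g : Eu d → ℝ) (w : Eu d → Eu d), ContDiff ℝ ∞ g ∧ ContDiff ℝ ∞ w ∧
      (∀ᵐ x, x ∈ Metric.ball z (2 * R) → p x = g x) ∧
      (∀ᵐ x, x ∈ Metric.ball z (2 * R) → u x = w x) ∧
      ∀ᵐ x, x ∈ Metric.ball z (2 * R) → Du x = jac w x := by
  obtain ⟨g, hg, hpg⟩ := exists_contDiff_of_weakly_harmonic h.mem_p.1 hR hz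
    (fun ψ hψ => by simpa using h.integral_p_lap hα hΩ hΩo hψ)
  have hu : ∀ i, ∃ g' : Eu d → ℝ, ContDiff ℝ ∞ g' ∧
      ∀ᵐ x, x ∈ Metric.ball z (2 * R) → u x i - 2⁻¹ * (x i * p x) = g' x := by
    intro i
    refine exists_contDiff_of_weakly_harmonic ?_ hR hz
      (fun ψ hψ => h.integral_velocity_lap hα hΩ hΩo hψ i)
    refine (h.mem_u.1.val i).1.sub ?_
    have := (locallyIntegrableOn_coord_mul hΩo h.mem_p.1 i).smul (2⁻¹ : ℝ)
    simpa [Pi.smul_def] using! this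
  choose g' hg' hug using hu
  -- The smooth versions of p and of u_i - x_i p / 2 are reassembled into a smooth version of u.
  set w : Eu d → Eu d := fun x => WithLp.toLp 2 fun i => g' i x + 2⁻¹ * (x i * g x) with hwdef
  have hw : ContDiff ℝ ∞ w := by
    rw [contDiff_piLp]
    intro i
    exact (hg' i).add (contDiff_const.mul ((contDiff_coord i).mul hg))
  have huw : ∀ᵐ x, x ∈ Metric.ball z (2 * R) → u x = w x := by
    filter_upwards [ae_all_iff.2 hug, hpg] with x hx hpx hxB
    ext i
    have h1 := hx i hxB
    rw [hpx hxB] at h1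
    simp only [hwdef]
    linarith
  refine ⟨g, w, hg, hw, hpg, huw, ?_⟩
  have hBΩ : Metric.ball z (2 * R) ⊆ Ω :=
    (Metric.ball_subset_closedBall.trans (Metric.closedBall_subset_closedBall (by linarith))).trans hz
  -- The weak Jacobian of u and the classical one of w are compared by integrating against test
  -- functions of the ball on which u = w.
  have key : ∀ i j, ∀ᵐ x, x ∈ Metric.ball z (2 * R) → Du x i j - jac w x i j = 0 := by
    intro i j
    have hwi : ContDiff ℝ ∞ (fun x => w x i) := (contDiff_piLp 2).1 hw i
    have hjac : (fun x => jac w x i j) = pd j (fun x => w x i) :=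
      funext fun x => jac_apply_of_contDiff hw x i j
    have hli : LocallyIntegrableOn (fun x => Du x i j) (Metric.ball z (2 * R)) :=
      (h.mem_u.1.grad i j).1.mono_set hBΩ
    have hlj : LocallyIntegrable (fun x => jac w x i j) := by
      rw [hjac]
      exact (contDiff_pd hwi j).continuous.locallyIntegrable
    refine Metric.isOpen_ball.ae_eq_zero_of_integral_contDiff_smul_eq_zero
      (hli.sub (hlj.locallyIntegrableOn _)) fun φ hφ hφc hφs => ?_
    have hφt : IsTest (Metric.ball z (2 * R)) φ := ⟨hφ, hφc, hφs⟩
    have h1 := h.mem_u.1.weak.integral_eq (hφt.mono hBΩ) i j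
    have h2 := integral_mul_pd hwi hφ hφc j
    have h3 : ∫ x, u x i * pd j φ x = ∫ x, w x i * pd j φ x := by
      refine integral_congr_ae ?_
      filter_upwards [huw] with x hx
      by_cases hxB : x ∈ Metric.ball z (2 * R)
      · rw [hx hxB]
      · rw [(hφt.pd j).eq_zero hxB]
        simp
    have e : ∀ x, φ x • ((fun x => Du x i j) x - (fun x => jac w x i j) x)
        = Du x i j * φ x - pd j (fun x => w x i) x * φ x := by
      intro x
      rw [hjac, smul_eq_mul]
      ring
    have i2 : Integrable (fun x => pd j (fun x => w x i) x * φ x) :=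
      integrable_mul_test ((contDiff_pd hwi j).continuous.locallyIntegrable.locallyIntegrableOn _)
        hφt
    change ∫ x, φ x • ((fun x => Du x i j) x - (fun x => jac w x i j) x) = 0
    simp only [e]
    rw [integral_sub (integrable_mul_test hli hφt) i2, h1, h3, h2]
    ring
  filter_upwards [ae_all_iff.2 fun i => ae_all_iff.2 (key i)] with x hx hxB
  ext i j
  linarith [hx i j hxB]

theorem frob_sub_le {A B : Matrix (Fin d) (Fin d) ℝ} :
    frob (A + B) (A + B) ≤ 2 * frob A A + 2 * frob B B := by
  simp only [frob_self, Finset.mul_sum, ← Finset.sum_add_distrib, Matrix.add_apply]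
  gcongr with i _ j _
  nlinarith [sq_nonneg (A i j - B i j)]

/-- A field in `H¹₀` with the weaker weight that agrees near `z` with a smooth field is in `H¹₀`
with the stronger weight. -/
theorem MemWH10.neg_of_ae_eq_contDiff [NeZero d] {w : Eu d → Eu d} (h : MemWH10 z α Ω u Du)
    (hα : 0 < α) (hαd : α < d) (hΩ : Bornology.IsBounded Ω) (hR : 0 < R)
    (hz : Metric.closedBall z (2 * R) ⊆ Ω) (hw : ContDiff ℝ ∞ w)
    (huw : ∀ᵐ x, x ∈ Metric.ball z (2 * R) → u x = w x)
    (hDw : ∀ᵐ x, x ∈ Metric.ball z (2 * R) → Du x = jac w x) : MemWH10 z (-α) Ω u Du := by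
  have hwi : ∀ i, ContDiff ℝ ∞ (fun x => w x i) := (contDiff_piLp 2).1 hw
  obtain ⟨⟨hval, hgrad, hweak⟩, φ, hφ, hlim⟩ := h
  refine ⟨⟨fun i => ?_, fun i j => ?_, hweak⟩, ?_⟩
  · refine (hval i).neg_of_ae_eq_continuous (hwi i).continuous (by positivity : 0 < 2 * R) hα hαd ?_
    filter_upwards [huw] with x hx hxB
    rw [hx hxB]
  · refine (hgrad i j).neg_of_ae_eq_continuous (contDiff_pd (hwi i) j).continuous
      (by positivity : 0 < 2 * R) hα hαd ?_
    filter_upwards [hDw] with x hx hxB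
    rw [hx hxB, jac_apply_of_contDiff hw]
  let χ : ContDiffBump z := ⟨R, 3 / 2 * R, hR, by linarith⟩
  have hχ : ContDiff ℝ ∞ χ := χ.contDiff
  have hχs : tsupport χ ⊆ Metric.ball z (2 * R) := by
    rw [χ.tsupport_eq]
    exact Metric.closedBall_subset_ball (by change 3 / 2 * R < _; linarith)
  have hχ1 : ∀ x ∈ Metric.ball z R, χ x = 1 := fun x hx =>
    χ.one_of_mem_closedBall (Metric.ball_subset_closedBall hx)
  have hχd : ∀ x ∈ Metric.ball z R, ∀ j, pd j χ x = 0 := by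
    intro x hx j
    have : (χ : Eu d → ℝ) =ᶠ[𝓝 x] fun _ => 1 := by
      filter_upwards [Metric.isOpen_ball.mem_nhds hx] with y hy using hχ1 y hy
    rw [pd_congr_nhds this, pd_const]
  obtain ⟨M, hM⟩ : ∃ M : ℝ, ∀ x, ‖fderiv ℝ χ x‖ ≤ M :=
    (χ.hasCompactSupport.fderiv (𝕜 := ℝ)).exists_bound_of_continuous
      (hχ.continuous_fderiv (by simp))
  have hpdM : ∀ x j, pd j χ x ^ 2 ≤ M ^ 2 := by
    intro x j
    rw [← sq_abs]
    exact pow_le_pow_left₀ (abs_nonneg _) ((abs_pd_le j _ x).trans (hM x)) 2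
  -- The approximants are replaced near z by the smooth limit w itself. Then ψ - u = (1 - χ)(φ - u)
  -- almost everywhere, so the error vanishes on the ball of radius R, where the stronger weight
  -- cannot be compared with the weaker one.
  let ψ : ℕ → Eu d → Eu d := fun n x => φ n x + χ x • (w x - φ n x)
  have hψ : ∀ n, IsTest Ω (ψ n) := by
    intro n
    have h1 : IsTest Ω (fun x => χ x • (w x - φ n x)) := by
      refine ⟨hχ.smul (hw.sub (hφ n).1), χ.hasCompactSupport.smul_right, ?_⟩
      refine ((closure_mono (Function.support_smul_subset_left _ _)).trans hχs).trans ?_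
      exact Metric.ball_subset_closedBall.trans hz
    exact ⟨(hφ n).1.add h1.1, (hφ n).2.1.add h1.2.1,
      (tsupport_add _ _).trans (Set.union_subset (hφ n).2.2 h1.2.2)⟩
  refine ⟨ψ, hψ, ?_⟩
  -- The first factor compares the two weights outside the ball of radius R; the second comes from
  -- the product rule, where each partial derivative of χ contributes at most M.
  set C : ℝ := (R ^ (2 * α))⁻¹ * (2 + 2 * d * M ^ 2) with hC
  have hRα : 0 < (R ^ (2 * α))⁻¹ := inv_pos.2 (Real.rpow_pos_of_pos hR _)
  have hint : ∀ n, IntegrableOn (fun x => weight z α x *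
      (‖φ n x - u x‖ ^ 2 + frob (jac (φ n) x - Du x) (jac (φ n) x - Du x))) Ω := by
    intro n
    have := memWH1_of_test (z := z) (β := α) (by linarith) hΩ (hφ n)
    exact integrableOn_distSq this.val hval this.grad hgrad
  have hle : ∀ n, distSqWH1 z (-α) Ω (ψ n) u Du ≤ C * distSqWH1 z α Ω (φ n) u Du := by
    intro n
    rw [distSqWH1, distSqWH1, ← integral_const_mul]
    refine integral_mono_of_nonneg ?_ ((hint n).const_mul C) ?_
    · exact Eventually.of_forall fun x => mul_nonneg (weight_nonneg z _ x)
        (add_nonneg (sq_nonneg _) (frob_self_nonneg _))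
    · filter_upwards [ae_restrict_of_ae huw, ae_restrict_of_ae hDw] with x hx hDx
      have hφi : ∀ i, ContDiff ℝ ∞ (fun x => φ n x i) := (contDiff_piLp 2).1 (hφ n).1
      have e1 : ψ n x - u x = (1 - χ x) • (φ n x - u x) := by
        by_cases hxB : x ∈ Metric.ball z (2 * R)
        · rw [hx hxB]
          simp only [ψ]
          module
        · have : χ x = 0 := image_eq_zero_of_notMem_tsupport fun h => hxB (hχs h)
          simp [ψ, this]
      have e2 : jac (ψ n) x - Du x = (1 - χ x) • (jac (φ n) x - Du x)
          + Matrix.of (fun i j => -(pd j χ x * (φ n x - u x) i)) := by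
        ext i j
        have : jac (ψ n) x i j = pd j (fun x => φ n x i) x
            + (pd j χ x * (w x i - φ n x i)
              + χ x * (pd j (fun x => w x i) x - pd j (fun x => φ n x i) x)) := by
          rw [jac_apply_of_contDiff (hψ n).1]
          have d1 := (hφi i).differentiable (by simp) x
          have d2 := (hwi i).differentiable (by simp) x
          have d3 := hχ.differentiable (by simp) x
          have : (fun y => ψ n y i) = fun y => φ n y i + χ y * (w y i - φ n y i) := by
            funext y
            simp [ψ]
          have d4 : DifferentiableAt ℝ (fun y => w y i - φ n y i) x := d2.sub d1
          have d5 : DifferentiableAt ℝ (fun y => χ y * (w y i - φ n y i)) x := d3.mul d4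
          rw [this, pd_add d1 d5, pd_mul d3 d4, pd_sub d2 d1]
        simp only [Matrix.sub_apply, Matrix.add_apply, Matrix.smul_apply, Matrix.of_apply,
          PiLp.sub_apply, smul_eq_mul]
        rw [this, jac_apply_of_contDiff (hφ n).1]
        by_cases hxB : x ∈ Metric.ball z (2 * R)
        · rw [hx hxB, hDx hxB, jac_apply_of_contDiff hw]
          ring
        · have h0 : χ x = 0 := image_eq_zero_of_notMem_tsupport fun h => hxB (hχs h)
          have h1 : pd j χ x = 0 := image_eq_zero_of_notMem_tsupport fun h =>
            hxB (hχs (tsupport_pd_subset _ j h))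
          rw [h0, h1]
          ring
      have hχ0 : 0 ≤ 1 - χ x := by linarith [χ.le_one (x := x)]
      have hχ1' : (1 - χ x) ^ 2 ≤ 1 := by
        have := χ.nonneg (x := x)
        nlinarith
      set a := φ n x - u x with ha
      set A := jac (φ n) x - Du x with hA
      by_cases hxB : x ∈ Metric.ball z R
      · rw [e1, e2, hχ1 x hxB]
        have : Matrix.of (fun i j => -(pd j χ x * a i)) = 0 := by
          ext i j
          simp [hχd x hxB j]
        rw [this]
        simp only [sub_self, zero_smul, add_zero, norm_zero]
        have h0 : frob (0 : Matrix (Fin d) (Fin d) ℝ) 0 = 0 := by simp [frob]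
        rw [h0]
        have hw0 := weight_nonneg z α x
        have := frob_self_nonneg A
        simp only [ne_eq, OfNat.ofNat_ne_zero, not_false_eq_true, zero_pow, add_zero, mul_zero]
        positivity
      · rw [Metric.mem_ball, dist_eq_norm, not_lt] at hxB
        have hwle := weight_neg_le_mul hR hα hxB
        have hn : ‖ψ n x - u x‖ ^ 2 ≤ ‖a‖ ^ 2 := by
          rw [e1, norm_smul, mul_pow, Real.norm_eq_abs, sq_abs]
          exact mul_le_of_le_one_left (sq_nonneg _) hχ1'
        have hf1 : frob ((1 - χ x) • A) ((1 - χ x) • A) ≤ frob A A := by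
          simp only [frob_self, Matrix.smul_apply, smul_eq_mul, mul_pow]
          gcongr with i _ j _
          exact mul_le_of_le_one_left (sq_nonneg _) hχ1'
        have hf2 : frob (Matrix.of fun i j => -(pd j χ x * a i))
            (Matrix.of fun i j => -(pd j χ x * a i)) ≤ d * M ^ 2 * ‖a‖ ^ 2 := by
          simp only [frob_self, Matrix.of_apply, EuclideanSpace.real_norm_sq_eq, Finset.mul_sum]
          gcongr with i _
          calc ∑ j, (-(pd j χ x * a i)) ^ 2 ≤ ∑ _j : Fin d, M ^ 2 * a i ^ 2 := by
                gcongr with j _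
                rw [neg_sq, mul_pow]
                exact mul_le_mul_of_nonneg_right (hpdM x j) (sq_nonneg _)
            _ = d * M ^ 2 * a i ^ 2 := by simp; ring
        have hf : frob (jac (ψ n) x - Du x) (jac (ψ n) x - Du x)
            ≤ 2 * frob A A + 2 * (d * M ^ 2 * ‖a‖ ^ 2) := by
          rw [e2]
          refine frob_sub_le.trans ?_
          linarith
        have hA0 := frob_self_nonneg A
        have hd0 : (0 : ℝ) ≤ d := Nat.cast_nonneg d
        calc weight z (-α) x * (‖ψ n x - u x‖ ^ 2 + frob (jac (ψ n) x - Du x) (jac (ψ n) x - Du x))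
            ≤ ((R ^ (2 * α))⁻¹ * weight z α x) * ((2 + 2 * d * M ^ 2) * (‖a‖ ^ 2 + frob A A)) := by
              refine mul_le_mul hwle ?_ (add_nonneg (sq_nonneg _) (frob_self_nonneg _))
                (mul_nonneg hRα.le (weight_nonneg z α x))
              have h3 : 0 ≤ 2 * (d : ℝ) * M ^ 2 * frob A A := by positivity
              nlinarith [sq_nonneg ‖a‖]
          _ = C * (weight z α x * (‖a‖ ^ 2 + frob A A)) := by
              rw [hC]
              ring
  refine squeeze_zero (fun n => distSqWH1_nonneg _ _ _) hle ?_
  simpa using hlim.const_mul C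

end Uniqueness

/-! ### Uniqueness of the solution near z -/

section Uniqueness

variable {d : ℕ} {Ω : Set (Eu d)} {z : Eu d} {α R : ℝ} {u : Eu d → Eu d}
  {Du : Eu d → Matrix (Fin d) (Fin d) ℝ} {p : Eu d → ℝ}

theorem one_le_weight_add {x : Eu d} (hx : x ≠ z) : 1 ≤ weight z α x + weight z (-α) x := by
  have hx0 : 0 < ‖x - z‖ := norm_pos_iff.2 (sub_ne_zero.2 hx)
  have h : 0 < ‖x - z‖ ^ α := Real.rpow_pos_of_pos hx0 _
  simp only [weight, Real.rpow_neg hx0.le]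
  rcases le_total 1 (‖x - z‖ ^ α) with h1 | h1
  · linarith [inv_pos.2 h]
  · linarith [one_le_inv_iff₀.2 ⟨h, h1⟩]

/-- Away from z one of the two mutually inverse weights is at least 1, so the two weighted bounds
together give an unweighted one. -/
theorem MemWL2.integrableOn_sq [NeZero d] {f : Eu d → ℝ} (h1 : MemWL2 z α Ω f)
    (h2 : MemWL2 z (-α) Ω f) : IntegrableOn (fun x => f x ^ 2) Ω := by
  refine Integrable.mono' (h1.2.add h2.2) (h1.aestronglyMeasurable.pow 2) ?_
  filter_upwards [ae_restrict_of_ae (Measure.ae_ne volume z)] with x hx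
  rw [Real.norm_of_nonneg (sq_nonneg _)]
  simp only [Pi.add_apply]
  have := mul_le_mul_of_nonneg_right (one_le_weight_add (α := α) hx) (sq_nonneg (f x))
  linarith

/-- Being smooth near z, the velocity lies in the test space with the dual weight and can be
inserted as its own test field. The pressure term drops out because the divergence vanishes, which
leaves ∫ |Du|² = 0. -/
theorem IsStokesSolution.jacobian_eq_zero [NeZero d] (h : IsStokesSolution Ω z α 0 u Du p)
    (hα : 0 < α) (hαd : α < d) (hΩ : Bornology.IsBounded Ω) (hΩo : IsOpen Ω) (hR : 0 < R)
    (hz : Metric.closedBall z (3 * R) ⊆ Ω) : ∀ᵐ x, x ∈ Ω → Du x = 0 := by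
  obtain ⟨g, w, -, hw, -, huw, hDw⟩ := h.exists_contDiff hαd hΩ hΩo hR hz
  have hz2 : Metric.closedBall z (2 * R) ⊆ Ω :=
    (Metric.closedBall_subset_closedBall (by linarith)).trans hz
  have hmem : MemWH10 z (-α) Ω u Du :=
    h.mem_u.neg_of_ae_eq_contDiff hα hαd hΩ hR hz2 hw huw hDw
  obtain ⟨φ, hφ⟩ := hmem.2
  have h1 := h.momentum u Du hmem φ hφ
  simp only [inner_zero_left] at h1
  have h2 : aForm Ω Du Du + bForm Ω Du p = 0 := tendsto_nhds_unique h1 tendsto_const_nhds |>.symm ▸ rfl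
  have htr := h.trace_ae hαd hΩ hΩo
  have h3 : bForm Ω Du p = 0 := by
    rw [bForm, neg_eq_zero]
    refine integral_eq_zero_of_ae ?_
    filter_upwards [ae_restrict_of_ae htr, ae_restrict_mem hΩo.measurableSet] with x hx hxΩ
    simp [hx hxΩ]
  rw [h3, add_zero, aForm] at h2
  have hint : IntegrableOn (fun x => frob (Du x) (Du x)) Ω := by
    simp only [frob_self]
    exact integrable_finsetSum _ fun i _ => integrable_finsetSum _ fun j _ =>
      (h.mem_u.1.grad i j).integrableOn_sq (hmem.1.grad i j)
  rw [integral_eq_zero_iff_of_nonneg (fun x => frob_self_nonneg _) hint] at h2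
  have h4 := (ae_restrict_iff' hΩo.measurableSet).1 h2
  filter_upwards [h4] with x hx hxΩ
  have h5 := hx hxΩ
  simp only [Pi.zero_apply, frob_self] at h5
  ext i j
  rw [Finset.sum_eq_zero_iff_of_nonneg fun i _ => by positivity] at h5
  have h6 := h5 i (Finset.mem_univ _)
  rw [Finset.sum_eq_zero_iff_of_nonneg fun i _ => by positivity] at h6
  simpa using h6 j (Finset.mem_univ _)

theorem eq_const_of_pd_eq_zero {g : Eu d → ℝ} (hg : ContDiff ℝ ∞ g) {r : ℝ}
    (h : ∀ i, ∀ x ∈ Metric.ball z r, pd i g x = 0) : ∀ x ∈ Metric.ball z r, g x = g z := by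
  intro x hx
  have hr : 0 < r := Metric.pos_of_mem_ball hx
  have hd : ∀ y ∈ Metric.ball z r, fderiv ℝ g y = 0 := by
    intro y hy
    ext v
    have hv : v = ∑ i, v i • unitVec i := by
      have := (EuclideanSpace.basisFun (Fin d) ℝ).sum_repr v
      simpa [unitVec] using! this.symm
    rw [hv, map_sum]
    simp only [map_smul]
    refine Finset.sum_eq_zero fun i _ => ?_
    have := h i y hy
    rw [pd] at this
    rw [this, smul_zero]
  exact (convex_ball z r).is_const_of_fderivWithin_eq_zero (𝕜 := ℝ)
    (hg.differentiable (by simp)).differentiableOn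
    (fun y hy => by rw [fderivWithin_of_isOpen Metric.isOpen_ball hy, hd y hy]) hx
    (Metric.mem_ball_self hr)

/-- Uniqueness of the pressure near `z`, up to constants. -/
theorem IsStokesSolution.pressure_eq_const [NeZero d] (h : IsStokesSolution Ω z α 0 u Du p)
    (hα : 0 < α) (hαd : α < d) (hΩ : Bornology.IsBounded Ω) (hΩo : IsOpen Ω) (hR : 0 < R)
    (hz : Metric.closedBall z (3 * R) ⊆ Ω) : ∃ c, ∀ᵐ x, x ∈ Metric.ball z (2 * R) → p x = c := by
  obtain ⟨g, -, hg, -, hpg, -, -⟩ := h.exists_contDiff hαd hΩ hΩo hR hz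
  have hD := h.jacobian_eq_zero hα hαd hΩ hΩo hR hz
  have hBΩ : Metric.ball z (2 * R) ⊆ Ω :=
    (Metric.ball_subset_closedBall.trans (Metric.closedBall_subset_closedBall (by linarith))).trans hz
  -- With Du = 0 and no force the momentum equation says that the distributional gradient of p
  -- vanishes.
  have h1 : ∀ ψ, IsTest Ω ψ → ∀ i, ∫ x, p x * pd i ψ x = 0 := by
    intro ψ hψ i
    have h2 := h.momentum_comp hαd hΩ hψ i
    have h3 : ∀ j, ∫ x, Du x i j * pd j ψ x = 0 := by
      intro j
      refine integral_eq_zero_of_ae ?_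
      filter_upwards [hD] with x hx
      by_cases hxΩ : x ∈ Ω
      · simp [hx hxΩ]
      · simp [(hψ.pd j).eq_zero hxΩ]
    simpa [h3] using h2.symm
  have h4 : ∀ i, ∀ᵐ x, x ∈ Metric.ball z (2 * R) → pd i g x = 0 := by
    intro i
    refine Metric.isOpen_ball.ae_eq_zero_of_integral_contDiff_smul_eq_zero
      ((contDiff_pd hg i).continuous.locallyIntegrable.locallyIntegrableOn _)
      fun φ hφ hφc hφs => ?_
    have hφt : IsTest (Metric.ball z (2 * R)) φ := ⟨hφ, hφc, hφs⟩
    have h5 := integral_mul_pd hg hφ hφc i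
    have h6 : ∫ x, g x * pd i φ x = ∫ x, p x * pd i φ x := by
      refine integral_congr_ae ?_
      filter_upwards [hpg] with x hx
      by_cases hxB : x ∈ Metric.ball z (2 * R)
      · rw [hx hxB]
      · rw [(hφt.pd i).eq_zero hxB]
        simp
    rw [h6, h1 φ (hφt.mono hBΩ) i] at h5
    simp only [smul_eq_mul]
    simp only [mul_comm (φ _)]
    linarith
  refine ⟨g z, ?_⟩
  have h7 : ∀ i, ∀ x ∈ Metric.ball z (2 * R), pd i g x = 0 := by
    intro i
    have := Measure.eqOn_open_of_ae_eq (μ := volume) (f := pd i g) (g := fun _ => 0)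
      (U := Metric.ball z (2 * R)) ((ae_restrict_iff' measurableSet_ball).2 (h4 i))
      Metric.isOpen_ball (contDiff_pd hg i).continuous.continuousOn continuousOn_const
    exact fun x hx => this hx
  filter_upwards [hpg] with x hx hxB
  rw [hx hxB, eq_const_of_pd_eq_zero hg h7 x hxB]

end Uniqueness

/-! ### Linear combinations in the weighted Sobolev spaces -/

section Linearity

variable {d : ℕ} {Ω : Set (Eu d)} {z : Eu d} {α : ℝ}

theorem MemWL2.zero (z : Eu d) (β : ℝ) (Ω : Set (Eu d)) : MemWL2 z β Ω (fun _ => 0) :=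
  ⟨locallyIntegrable_zero.locallyIntegrableOn Ω, by simp⟩

theorem HasWeakJac.add_smul {v w : Eu d → Eu d} {G H : Eu d → Matrix (Fin d) (Fin d) ℝ} {β : ℝ}
    (hv : MemWH1 z β Ω v G) (hw : MemWH1 z β Ω w H) (c : ℝ) :
    HasWeakJac Ω (v + c • w) (G + c • H) := by
  intro φ hφ i j
  have e1 : ∀ x, (v + c • w) x i * fderiv ℝ φ x (unitVec j)
      = v x i * pd j φ x + c * (w x i * pd j φ x) := by
    intro x
    simp [pd]
    ring
  have e2 : ∀ x, (G + c • H) x i j * φ x = G x i j * φ x + c * (H x i j * φ x) := by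
    intro x
    simp
    ring
  simp only [e1, e2]
  have h1 := hv.weak φ hφ i j
  have h2 := hw.weak φ hφ i j
  rw [integral_add (integrable_mul_test (hv.val i).1 (hφ.pd j)).integrableOn
      ((integrable_mul_test (hw.val i).1 (hφ.pd j)).integrableOn.const_mul c),
    integral_add (integrable_mul_test (hv.grad i j).1 hφ).integrableOn
      ((integrable_mul_test (hw.grad i j).1 hφ).integrableOn.const_mul c),
    integral_const_mul, integral_const_mul]
  simp only [pd]
  rw [h1, h2]
  ring

theorem MemWH10.add_smul [NeZero d] {v w : Eu d → Eu d} {G H : Eu d → Matrix (Fin d) (Fin d) ℝ}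
    {β : ℝ} (hβ : -(d : ℝ) < β) (hΩ : Bornology.IsBounded Ω) (hv : MemWH10 z β Ω v G)
    (hw : MemWH10 z β Ω w H) (c : ℝ) : MemWH10 z β Ω (v + c • w) (G + c • H) := by
  obtain ⟨hv1, φ, hφ, hφl⟩ := hv
  obtain ⟨hw1, ψ, hψ, hψl⟩ := hw
  refine ⟨⟨fun i => ?_, fun i j => ?_, HasWeakJac.add_smul hv1 hw1 c⟩, ?_⟩
  · simpa using! (hv1.val i).add ((hw1.val i).const_mul c)
  · simpa using! (hv1.grad i j).add ((hw1.grad i j).const_mul c)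
  have htest : ∀ n, IsTest Ω (φ n + c • ψ n) := by
    intro n
    refine ⟨(hφ n).1.add (contDiff_const.smul (hψ n).1), (hφ n).2.1.add (hψ n).2.1.smul_left, ?_⟩
    refine (tsupport_add _ _).trans (Set.union_subset (hφ n).2.2 ?_)
    exact (closure_mono (Function.support_const_smul_subset c (ψ n))).trans (hψ n).2.2
  refine ⟨fun n => φ n + c • ψ n, htest, ?_⟩
  have hle : ∀ n, distSqWH1 z β Ω (φ n + c • ψ n) (v + c • w) (G + c • H)
      ≤ 2 * distSqWH1 z β Ω (φ n) v G + 2 * c ^ 2 * distSqWH1 z β Ω (ψ n) w H := by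
    intro n
    have m1 := memWH1_of_test (z := z) hβ hΩ (hφ n)
    have m2 := memWH1_of_test (z := z) hβ hΩ (hψ n)
    have i1 := integrableOn_distSq m1.val hv1.val m1.grad hv1.grad
    have i2 := integrableOn_distSq m2.val hw1.val m2.grad hw1.grad
    simp only [distSqWH1]
    rw [← integral_const_mul, ← integral_const_mul, ← integral_add (i1.const_mul _) (i2.const_mul _)]
    refine integral_mono_of_nonneg ?_ ((i1.const_mul _).add (i2.const_mul _)) ?_
    · exact Eventually.of_forall fun x => mul_nonneg (weight_nonneg z _ x)
        (add_nonneg (sq_nonneg _) (frob_self_nonneg _))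
    · refine Eventually.of_forall fun x => ?_
      have hj : jac (φ n + c • ψ n) x = jac (φ n) x + c • jac (ψ n) x := by
        ext i j
        have d1 := (hφ n).1.differentiable (by simp) x
        have d2 := (hψ n).1.differentiable (by simp) x
        simp only [jac, Matrix.of_apply, Matrix.add_apply, Matrix.smul_apply]
        rw [fderiv_add d1 (d2.const_smul c), fderiv_const_smul d2]
        simp
      have e1 : (φ n + c • ψ n) x - (v + c • w) x = (φ n x - v x) + c • (ψ n x - w x) := by
        simp only [Pi.add_apply, Pi.smul_apply]
        module
      have e2 : jac (φ n + c • ψ n) x - (G + c • H) x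
          = (jac (φ n) x - G x) + c • (jac (ψ n) x - H x) := by
        rw [hj]
        simp only [Pi.add_apply, Pi.smul_apply]
        module
      have f1 : frob (c • (jac (ψ n) x - H x)) (c • (jac (ψ n) x - H x))
          = c ^ 2 * frob (jac (ψ n) x - H x) (jac (ψ n) x - H x) := by
        simp only [frob_self, Matrix.smul_apply, smul_eq_mul, mul_pow, Finset.mul_sum]
      have f2 : ‖(φ n x - v x) + c • (ψ n x - w x)‖ ^ 2
          ≤ 2 * ‖φ n x - v x‖ ^ 2 + 2 * (c ^ 2 * ‖ψ n x - w x‖ ^ 2) := by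
        have h1 := norm_add_le (φ n x - v x) (c • (ψ n x - w x))
        have h2 : ‖c • (ψ n x - w x)‖ ^ 2 = c ^ 2 * ‖ψ n x - w x‖ ^ 2 := by
          rw [norm_smul, mul_pow, Real.norm_eq_abs, sq_abs]
        rw [← h2]
        have h3 := pow_le_pow_left₀ (norm_nonneg _) h1 2
        nlinarith [sq_nonneg (‖φ n x - v x‖ - ‖c • (ψ n x - w x)‖)]
      simp only
      rw [e1, e2]
      have f3 := frob_sub_le (A := jac (φ n) x - G x) (B := c • (jac (ψ n) x - H x))
      rw [f1] at f3
      have hwt := weight_nonneg z β x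
      nlinarith [mul_le_mul_of_nonneg_left (add_le_add f2 f3) hwt]
  refine squeeze_zero (fun n => distSqWH1_nonneg _ _ _) hle ?_
  simpa using (hφl.const_mul 2).add (hψl.const_mul (2 * c ^ 2))

theorem MemWH10.zero (z : Eu d) (β : ℝ) (Ω : Set (Eu d)) : MemWH10 z β Ω 0 0 := by
  refine ⟨⟨fun i => by simpa using! MemWL2.zero z β Ω, fun i j => by simpa using! MemWL2.zero z β Ω,
    fun φ _ i j => by simp⟩, fun _ => 0, fun _ => ⟨contDiff_const, HasCompactSupport.zero, by
      simp [tsupport]⟩, ?_⟩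
  have : jac (0 : Eu d → Eu d) = 0 := by
    ext x i j
    simp [jac]
  simp [distSqWH1, this, frob]

end Linearity

/-! ### The linear space of solutions and uniform dependence on the force -/

section SolutionSpace

variable {d : ℕ} {Ω : Set (Eu d)} {z : Eu d} {α : ℝ}

/-- The spaces with opposite weights are in duality: the product is bounded by Young's inequality
with the weight on one factor and its inverse on the other. -/
theorem MemWL2.integrableOn_mul [NeZero d] {f g : Eu d → ℝ} (hf : MemWL2 z α Ω f)
    (hg : MemWL2 z (-α) Ω g) : IntegrableOn (fun x => f x * g x) Ω := by
  refine Integrable.mono' (hf.2.add hg.2) (hf.aestronglyMeasurable.mul hg.aestronglyMeasurable) ?_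
  filter_upwards [ae_restrict_of_ae (Measure.ae_ne volume z)] with x hx
  have hx0 : 0 < ‖x - z‖ := norm_pos_iff.2 (sub_ne_zero.2 hx)
  have hw : 0 < weight z α x := Real.rpow_pos_of_pos hx0 _
  have hw' : weight z (-α) x = (weight z α x)⁻¹ := Real.rpow_neg hx0.le α
  simp only [Pi.add_apply]
  rw [Real.norm_eq_abs, hw', abs_mul, ← sq_abs (f x), ← sq_abs (g x)]
  have h1 : weight z α x * |f x| ^ 2 + (weight z α x)⁻¹ * |g x| ^ 2 - 2 * (|f x| * |g x|)
      = (weight z α x)⁻¹ * (weight z α x * |f x| - |g x|) ^ 2 := by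
    field_simp
    ring
  have h2 : 0 ≤ (weight z α x)⁻¹ * (weight z α x * |f x| - |g x|) ^ 2 := by positivity
  have h3 : 0 ≤ |f x| * |g x| := by positivity
  linarith

theorem integrableOn_frob [NeZero d] {G H : Eu d → Matrix (Fin d) (Fin d) ℝ}
    (hG : ∀ i j, MemWL2 z α Ω (fun x => G x i j)) (hH : ∀ i j, MemWL2 z (-α) Ω (fun x => H x i j)) :
    IntegrableOn (fun x => frob (G x) (H x)) Ω :=
  integrable_finsetSum _ fun i _ => integrable_finsetSum _ fun j _ =>
    (hG i j).integrableOn_mul (hH i j)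

theorem integrableOn_mul_trace [NeZero d] {p : Eu d → ℝ} {H : Eu d → Matrix (Fin d) (Fin d) ℝ}
    (hp : MemWL2 z α Ω p) (hH : ∀ i j, MemWL2 z (-α) Ω (fun x => H x i j)) :
    IntegrableOn (fun x => p x * (H x).trace) Ω := by
  simp only [Matrix.trace, Matrix.diag, Finset.mul_sum]
  exact integrable_finsetSum _ fun i _ => hp.integrableOn_mul (hH i i)

theorem integrableOn_trace_mul [NeZero d] {q : Eu d → ℝ} {H : Eu d → Matrix (Fin d) (Fin d) ℝ}
    (hH : ∀ i j, MemWL2 z α Ω (fun x => H x i j)) (hq : MemWL2 z (-α) Ω q) :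
    IntegrableOn (fun x => q x * (H x).trace) Ω := by
  simp only [Matrix.trace, Matrix.diag, Finset.mul_sum]
  refine integrable_finsetSum _ fun i _ => ?_
  simp only [mul_comm (q _)]
  exact (hH i i).integrableOn_mul hq

theorem IsStokesSolution.add_smul [NeZero d] {F F' : Eu d} {u u' : Eu d → Eu d}
    {Du Du' : Eu d → Matrix (Fin d) (Fin d) ℝ} {p p' : Eu d → ℝ}
    (h : IsStokesSolution Ω z α F u Du p) (h' : IsStokesSolution Ω z α F' u' Du' p')
    (hα : -(d : ℝ) < α) (hΩ : Bornology.IsBounded Ω) (c : ℝ) :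
    IsStokesSolution Ω z α (F + c • F') (u + c • u') (Du + c • Du') (p + c • p') := by
  refine ⟨h.mem_u.add_smul hα hΩ h'.mem_u c, ?_, ?_, ?_⟩
  · simpa using! h.mem_p.add (h'.mem_p.const_mul c)
  · intro v Dv hv φ hφ
    have h1 := h.momentum v Dv hv φ hφ
    have h2 := h'.momentum v Dv hv φ hφ
    have e1 : aForm Ω (Du + c • Du') Dv = aForm Ω Du Dv + c * aForm Ω Du' Dv := by
      simp only [aForm]
      rw [← integral_const_mul, ← integral_add (integrableOn_frob h.mem_u.1.grad hv.1.grad)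
        ((integrableOn_frob h'.mem_u.1.grad hv.1.grad).const_mul c)]
      congr 1
      funext x
      simp only [frob, Pi.add_apply, Pi.smul_apply, Matrix.add_apply, Matrix.smul_apply,
        smul_eq_mul, Finset.mul_sum, ← Finset.sum_add_distrib]
      refine Finset.sum_congr rfl fun i _ => Finset.sum_congr rfl fun j _ => ?_
      ring
    have e2 : bForm Ω Dv (p + c • p') = bForm Ω Dv p + c * bForm Ω Dv p' := by
      simp only [bForm]
      rw [mul_neg, ← neg_add, ← integral_const_mul,
        ← integral_add (integrableOn_mul_trace h.mem_p hv.1.grad)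
        ((integrableOn_mul_trace h'.mem_p hv.1.grad).const_mul c)]
      congr 2
      funext x
      simp only [Pi.add_apply, Pi.smul_apply, smul_eq_mul]
      ring
    have e3 : aForm Ω (Du + c • Du') Dv + bForm Ω Dv (p + c • p')
        = (aForm Ω Du Dv + bForm Ω Dv p) + c * (aForm Ω Du' Dv + bForm Ω Dv p') := by
      rw [e1, e2]
      ring
    rw [e3]
    simp only [inner_add_left, inner_smul_left, RCLike.conj_to_real]
    exact h1.add (h2.const_mul c)
  · intro q hq
    have h1 := h.mass q hq
    have h2 := h'.mass q hq
    simp only [bForm, neg_eq_zero] at h1 h2 ⊢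
    have e : ∀ x, q x * ((Du + c • Du') x).trace
        = q x * (Du x).trace + c * (q x * (Du' x).trace) := by
      intro x
      simp only [Pi.add_apply, Pi.smul_apply, Matrix.trace_add, Matrix.trace_smul, smul_eq_mul]
      ring
    simp only [e]
    rw [integral_add (integrableOn_trace_mul h.mem_u.1.grad hq)
      ((integrableOn_trace_mul h'.mem_u.1.grad hq).const_mul c), integral_const_mul, h1, h2]
    simp

theorem IsStokesSolution.zero : IsStokesSolution Ω z α 0 0 0 0 := by
  refine ⟨MemWH10.zero z α Ω, MemWL2.zero z α Ω, ?_, ?_⟩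
  · intro v Dv _ φ _
    simp [aForm, bForm, frob]
  · intro q _
    simp [bForm]

/-- The space of all solutions, for all point forces. -/
def solutionSpace [NeZero d] (Ω : Set (Eu d)) (z : Eu d) (α : ℝ) (hα : -(d : ℝ) < α)
    (hΩ : Bornology.IsBounded Ω) :
    Submodule ℝ (Eu d × (Eu d → Eu d) × (Eu d → Matrix (Fin d) (Fin d) ℝ) × (Eu d → ℝ)) where
  carrier := {s | IsStokesSolution Ω z α s.1 s.2.1 s.2.2.1 s.2.2.2}
  zero_mem' := IsStokesSolution.zero
  add_mem' := by
    intro a b ha hb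
    simpa using ha.add_smul hb hα hΩ 1
  smul_mem' := by
    intro c a ha
    simpa using IsStokesSolution.zero.add_smul ha hα hΩ c

/-- The pressure depends continuously on the point force, near `z` and up to constants. -/
theorem exists_pressure_bound [NeZero d] (hα : 0 < α) (hαd : α < d) (hΩ : Bornology.IsBounded Ω)
    (hΩo : IsOpen Ω) {R : ℝ} (hR : 0 < R) (hz : Metric.closedBall z (3 * R) ⊆ Ω) :
    ∃ C : ℝ, 0 ≤ C ∧ ∀ (F : Eu d) (u : Eu d → Eu d) (Du : Eu d → Matrix (Fin d) (Fin d) ℝ)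
      (p : Eu d → ℝ), IsStokesSolution Ω z α F u Du p →
      ∃ c : ℝ, ∫ x in Metric.ball z (2 * R), |p x - c| ≤ C * ‖F‖ := by
  have hα' : -(d : ℝ) < α := by linarith [(Nat.cast_nonneg d : (0 : ℝ) ≤ d)]
  set X := solutionSpace Ω z α hα' hΩ with hX
  -- The map `f` reads off the force. A linear section of it over its range picks one solution per
  -- admissible force, linearly, without any claim that every force is admissible.
  let f : X →ₗ[ℝ] Eu d := (LinearMap.fst ℝ _ _) ∘ₗ X.subtype
  have : Module.Free ℝ (LinearMap.range f) := Module.Free.of_divisionRing ℝ _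
  have : Module.Projective ℝ (LinearMap.range f) := Module.Projective.of_free
  obtain ⟨s, hs⟩ := f.rangeRestrict.exists_rightInverse_of_surjective
    (LinearMap.range_rangeRestrict f)
  have hsol : ∀ x : X, IsStokesSolution Ω z α x.1.1 x.1.2.1 x.1.2.2.1 x.1.2.2.2 := fun x => x.2
  have hint : ∀ x : X, Integrable x.1.2.2.2 (volume.restrict (Metric.ball z (2 * R))) := by
    intro x
    have h2 : Metric.closedBall z (2 * R) ⊆ Ω :=
      (Metric.closedBall_subset_closedBall (by linarith)).trans hz
    exact ((hsol x).mem_p.1.integrableOn_compact_subset h2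
      (isCompact_closedBall _ _)).mono_set Metric.ball_subset_closedBall
  let P : X →ₗ[ℝ] (Eu d →₁[volume.restrict (Metric.ball z (2 * R))] ℝ) :=
    { toFun := fun x => (hint x).toL1 _
      map_add' := fun x y => by
        rw [← Integrable.toL1_add]
        rfl
      map_smul' := fun c x => by
        rw [RingHom.id_apply, ← Integrable.toL1_smul]
        rfl }
  -- The domain is a subspace of ℝ^d, so the linear map from the force to the selected pressure in
  -- L¹ is automatically continuous. Its norm is the constant sought.
  let L := (P ∘ₗ s).toContinuousLinearMap
  refine ⟨‖L‖, L.opNorm_nonneg, fun F u Du p h => ?_⟩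
  let x : X := ⟨(F, u, Du, p), h⟩
  let y : LinearMap.range f := f.rangeRestrict x
  have hy : f.rangeRestrict (s y) = y := LinearMap.congr_fun hs y
  -- The given solution and the selected one have the same force; their difference solves the
  -- homogeneous problem, so their pressures differ by a constant near z.
  have hker : (x - s y).1.1 = 0 := by
    have h1 : f (s y) = f x := congrArg Subtype.val hy
    have h2 : (x - s y).1.1 = f x - f (s y) := rfl
    rw [h2, h1, sub_self]
  have hsub := hsol (x - s y)
  rw [hker] at hsub
  obtain ⟨c, hc⟩ := hsub.pressure_eq_const hα hαd hΩ hΩo hR hz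
  refine ⟨c, ?_⟩
  have h1 : ∫ x in Metric.ball z (2 * R), |p x - c|
      = ∫ x in Metric.ball z (2 * R), |(s y).1.2.2.2 x| := by
    refine integral_congr_ae ?_
    filter_upwards [ae_restrict_of_ae hc, ae_restrict_mem measurableSet_ball] with w hw hwB
    have : p w - (s y).1.2.2.2 w = c := hw hwB
    have : p w - c = (s y).1.2.2.2 w := by linarith
    rw [this]
  have h2 : ‖L y‖ = ∫ x in Metric.ball z (2 * R), |(s y).1.2.2.2 x| := by
    change ‖(hint (s y)).toL1 _‖ = _
    rw [L1.norm_eq_integral_norm]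
    refine integral_congr_ae ?_
    filter_upwards [(hint (s y)).coeFn_toL1] with w hw
    rw [hw, Real.norm_eq_abs]
  rw [h1, ← h2]
  exact L.le_opNorm y

end SolutionSpace

/-! ### The pressure near z as a dipole potential plus a bounded remainder -/

section PressureDecomposition

variable {d : ℕ} {Ω : Set (Eu d)} {z : Eu d} {α : ℝ}

theorem exists_bound_mollifier {R : ℝ} (hR : 0 < R) :
    ∃ M : ℝ, 0 ≤ M ∧ ∀ x : Eu d, |mollifier R x| ≤ M := by
  obtain ⟨M, hM⟩ := (hasCompactSupport_mollifier (d := d) hR).exists_bound_of_continuous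
    (contDiff_mollifier R).continuous
  exact ⟨M, (norm_nonneg _).trans (hM 0), hM⟩

/-- In the representation formula the mollifier reproduces constants up to the factor κ, so
subtracting κ c from the convolution leaves an integral of p - c, at most M K. The truncated part of
the dipole is bounded, and the untruncated part is the singular term being subtracted. -/
theorem ae_abs_sub_dipole_le [NeZero d] {p : Eu d → ℝ} (hp : LocallyIntegrableOn p Ω) {F : Eu d}
    {R : ℝ} (hR : 0 < R) (hz3 : Metric.closedBall z (3 * R) ⊆ Ω)
    (hw : ∀ ψ, IsTest Ω ψ → ∫ x, p x * lap ψ x = - ∑ i, F i * pd i ψ z) {c K M N : ℝ}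
    (hc : ∫ x in Metric.ball z (3 * R), |p x - c| ≤ K) (hM0 : 0 ≤ M)
    (hM : ∀ x : Eu d, |mollifier R x| ≤ M) (hN0 : 0 ≤ N)
    (hN : ∀ x ∈ Metric.closedBall z (2 * R), |scaledProfile d R (‖x - z‖ ^ 2)| ≤ N) :
    ∀ᵐ x, x ∈ Metric.ball z (2 * R) →
      |(∫ y : Eu d, profileDiv d (‖y‖ ^ 2)) * (p x - c)
        - inner ℝ F (x - z) * ‖x - z‖ ^ (-(d : ℝ))| ≤ M * K + N * (2 * R) * ‖F‖ := by
  filter_upwards [ae_representation_on hp hR hz3 hw] with x hx hxB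
  have hx := hx hxB
  set κ := ∫ y : Eu d, profileDiv d (‖y‖ ^ 2) with hκ
  have hpint : Integrable ((Metric.ball z (3 * R)).indicator p) :=
    integrable_indicator_ball hp hz3
  have hcint : Integrable ((Metric.ball z (3 * R)).indicator fun _ : Eu d => c) := by
    rw [integrable_indicator_iff measurableSet_ball]
    exact integrableOn_const measure_ball_lt_top.ne
  have hmc : Continuous fun y : Eu d => mollifier R (y - x) :=
    (contDiff_mollifier R).continuous.comp (continuous_id.sub continuous_const)
  have hcκ : κ * c = ∫ y, (Metric.ball z (3 * R)).indicator (fun _ => c) y * mollifier R (y - x) := by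
    have h1 : ∀ y, (Metric.ball z (3 * R)).indicator (fun _ => c) y * mollifier R (y - x)
        = c * mollifier R (y - x) := by
      intro y
      by_cases hy : y ∈ Metric.ball z (3 * R)
      · rw [Set.indicator_of_mem hy]
      · have : R < ‖y - x‖ := by
          by_contra hcon
          rw [not_lt, ← dist_eq_norm] at hcon
          have h2 := closedBall_subset_ball_add (R := R) hxB (Metric.mem_closedBall.2 hcon)
          exact hy (by convert h2 using 2; ring)
        rw [mollifier_eq_zero hR this]
        simp
    simp only [h1]
    rw [integral_const_mul, integral_sub_right_eq_self (fun y => mollifier R y),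
      integral_mollifier hR, mul_comm]
  have hdiff : |(∫ y, (Metric.ball z (3 * R)).indicator p y * mollifier R (y - x)) - κ * c|
      ≤ M * (K) := by
    have i1 := hpint.mul_bdd (c := M) hmc.aestronglyMeasurable (Eventually.of_forall fun y => hM _)
    have i2 := hcint.mul_bdd (c := M) hmc.aestronglyMeasurable (Eventually.of_forall fun y => hM _)
    have i3 : IntegrableOn (fun y => |p y - c|) (Metric.ball z (3 * R)) := by
      have h1 : IntegrableOn p (Metric.ball z (3 * R)) := by
        rwa [integrable_indicator_iff measurableSet_ball] at hpint
      exact (h1.sub (integrableOn_const measure_ball_lt_top.ne)).norm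
    rw [hcκ, ← integral_sub i1 i2]
    refine (abs_integral_le_integral_abs).trans ?_
    have h2 : ∫ y, M * (Metric.ball z (3 * R)).indicator (fun y => |p y - c|) y
        ≤ M * (K) := by
      rw [integral_const_mul, integral_indicator measurableSet_ball]
      refine mul_le_mul_of_nonneg_left ?_ hM0
      exact hc
    refine le_trans (integral_mono_of_nonneg (Eventually.of_forall fun y => abs_nonneg _)
      (((integrable_indicator_iff measurableSet_ball).2 i3).const_mul M) ?_) h2
    refine Eventually.of_forall fun y => ?_
    simp only
    by_cases hy : y ∈ Metric.ball z (3 * R)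
    · rw [Set.indicator_of_mem hy, Set.indicator_of_mem hy, Set.indicator_of_mem hy, ← sub_mul,
        abs_mul, mul_comm]
      exact mul_le_mul_of_nonneg_right (hM _) (abs_nonneg _)
    · simp [Set.indicator_of_notMem hy]
  have hsum : ∑ i, F i * (((‖x - z‖ ^ 2) ^ (-(d : ℝ) / 2) - scaledProfile d R (‖x - z‖ ^ 2))
      * (x - z) i) = inner ℝ F (x - z) * ‖x - z‖ ^ (-(d : ℝ))
        - scaledProfile d R (‖x - z‖ ^ 2) * inner ℝ F (x - z) := by
    have h1 : (‖x - z‖ ^ 2) ^ (-(d : ℝ) / 2) = ‖x - z‖ ^ (-(d : ℝ)) := by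
      rw [← Real.rpow_natCast, ← Real.rpow_mul (norm_nonneg _)]
      congr 1
      push_cast
      ring
    have h2 : inner ℝ F (x - z) = ∑ i, F i * (x - z) i := by
      simp [PiLp.inner_apply, mul_comm]
    rw [h1, h2, Finset.sum_mul, Finset.mul_sum, ← Finset.sum_sub_distrib]
    refine Finset.sum_congr rfl fun i _ => ?_
    ring
  rw [hsum] at hx
  have hlast : |scaledProfile d R (‖x - z‖ ^ 2) * inner ℝ F (x - z)| ≤ N * (2 * R) * ‖F‖ := by
    rw [abs_mul]
    have h1 := hN x (Metric.ball_subset_closedBall hxB)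
    have h2 := abs_real_inner_le_norm F (x - z)
    have h3 : ‖x - z‖ ≤ 2 * R := by
      rw [← dist_eq_norm]
      exact (Metric.mem_ball.1 hxB).le
    calc _ ≤ N * (‖F‖ * (2 * R)) := by
          refine mul_le_mul h1 (h2.trans ?_) (abs_nonneg _) hN0
          gcongr
      _ = _ := by ring
  have e : κ * (p x - c) - inner ℝ F (x - z) * ‖x - z‖ ^ (-(d : ℝ))
      = ((∫ y, (Metric.ball z (3 * R)).indicator p y * mollifier R (y - x)) - κ * c)
        - scaledProfile d R (‖x - z‖ ^ 2) * inner ℝ F (x - z) := by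
    rw [mul_sub, hx]
    ring
  rw [e]
  refine (abs_sub _ _).trans ?_
  linarith

theorem exists_bound_scaledProfile (z : Eu d) (R r : ℝ) :
    ∃ N : ℝ, ∀ x ∈ Metric.closedBall z r, |scaledProfile d R (‖x - z‖ ^ 2)| ≤ N := by
  have h1 : Continuous fun x : Eu d => ‖x - z‖ ^ 2 := by fun_prop
  have h2 : Continuous fun x : Eu d => scaledProfile d R (‖x - z‖ ^ 2) :=
    (contDiff_scaledProfile R).continuous.comp h1
  exact (isCompact_closedBall z r).exists_bound_of_continuousOn h2.continuousOn

/-- Near `z`, the pressure is a dipole potential up to a constant and a bounded remainder. -/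
theorem exists_pressure_decomposition [NeZero d] (hα : 0 < α) (hαd : α < d)
    (hΩ : Bornology.IsBounded Ω) (hΩo : IsOpen Ω) (hz : z ∈ Ω) :
    ∃ κ r C : ℝ, 0 < κ ∧ 0 < r ∧ 0 ≤ C ∧ ∀ (F : Eu d) (u : Eu d → Eu d)
      (Du : Eu d → Matrix (Fin d) (Fin d) ℝ) (p : Eu d → ℝ), IsStokesSolution Ω z α F u Du p →
      ∃ c : ℝ, ∀ᵐ x, x ∈ Metric.ball z r →
        |κ * (p x - c) - inner ℝ F (x - z) * ‖x - z‖ ^ (-(d : ℝ))| ≤ C * ‖F‖ := by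
  obtain ⟨r₀, hr₀, hzΩ⟩ := Metric.isOpen_iff.1 hΩo z hz
  -- The L¹ bound for p - c is needed on the ball of radius 3R that enters the convolution. It is
  -- obtained with 3R/2 in place of R, which requires a ball of radius 9R/2 = 3 r₀ / 4 inside Ω.
  set R : ℝ := r₀ / 6 with hRdef
  have hR : 0 < R := by positivity
  have hz3 : Metric.closedBall z (3 * R) ⊆ Ω :=
    (Metric.closedBall_subset_ball (by rw [hRdef]; linarith)).trans hzΩ
  have hz4 : Metric.closedBall z (3 * (3 / 2 * R)) ⊆ Ω :=
    (Metric.closedBall_subset_ball (by rw [hRdef]; linarith)).trans hzΩ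
  obtain ⟨C₁, hC₁, hbound⟩ := exists_pressure_bound hα hαd hΩ hΩo (R := 3 / 2 * R)
    (mul_pos (by norm_num) hR) hz4
  obtain ⟨M, hM0, hM⟩ := exists_bound_mollifier (d := d) hR
  obtain ⟨N, hN⟩ := exists_bound_scaledProfile (d := d) z R (2 * R)
  have hN0 : 0 ≤ N :=
    (abs_nonneg _).trans (hN z (Metric.mem_closedBall_self (mul_nonneg zero_le_two hR.le)))
  have hMC : 0 ≤ M * C₁ + N * (2 * R) :=
    add_nonneg (mul_nonneg hM0 hC₁) (mul_nonneg hN0 (mul_nonneg zero_le_two hR.le))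
  refine ⟨_, 2 * R, _, integral_profileDiv d, mul_pos zero_lt_two hR, hMC,
    fun F u Du p h => ?_⟩
  obtain ⟨c, hc⟩ := hbound F u Du p h
  have e : 2 * (3 / 2 * R) = 3 * R := by ring
  rw [e] at hc
  refine ⟨c, ?_⟩
  have := ae_abs_sub_dipole_le h.mem_p.1 hR hz3 (fun ψ hψ => h.integral_p_lap hαd hΩ hΩo hψ) hc
    hM0 hM hN0 hN
  filter_upwards [this] with x hx hxB
  refine (hx hxB).trans (le_of_eq ?_)
  ring

end PressureDecomposition

/-! ### Scaling differences in the weighted norm -/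

section SourceTerm

variable {d : ℕ} {α : ℝ}

/-- Under x ↦ s x the weight is homogeneous of degree α and Lebesgue measure of degree d, whence the
two factors. -/
theorem setIntegral_comp_smul_le {T B : Set (Eu d)} {g : Eu d → ℝ} (hT : MeasurableSet T)
    (hB : MeasurableSet B) {s : ℝ} (hs : 0 < s) (hBT : ∀ x ∈ B, s • x ∈ T)
    (hint : IntegrableOn (fun x => ‖x‖ ^ α * g x ^ 2) T) :
    IntegrableOn (fun x => ‖x‖ ^ α * g (s • x) ^ 2) B ∧
      ∫ x in B, ‖x‖ ^ α * g (s • x) ^ 2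
        ≤ (s ^ α)⁻¹ * (s ^ d)⁻¹ * ∫ x in T, ‖x‖ ^ α * g x ^ 2 := by
  set φ : Eu d → ℝ := T.indicator (fun x => ‖x‖ ^ α * g x ^ 2) with hφ
  have hφi : Integrable φ := (integrable_indicator_iff hT).2 hint
  have hφ0 : ∀ x, 0 ≤ φ x := fun x => Set.indicator_nonneg (fun x _ => by positivity) x
  have hφs : Integrable fun x => φ (s • x) := hφi.comp_smul hs.ne'
  have hsα : 0 < s ^ α := Real.rpow_pos_of_pos hs _
  have e : ∀ x ∈ B, (s ^ α)⁻¹ * φ (s • x) = ‖x‖ ^ α * g (s • x) ^ 2 := by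
    intro x hx
    rw [hφ, Set.indicator_of_mem (hBT x hx), norm_smul, Real.norm_of_nonneg hs.le,
      Real.mul_rpow hs.le (norm_nonneg _)]
    field_simp
  refine ⟨((hφs.const_mul (s ^ α)⁻¹).integrableOn (s := B)).congr_fun e hB, ?_⟩
  rw [← setIntegral_congr_fun hB e, integral_const_mul, mul_assoc]
  refine mul_le_mul_of_nonneg_left ?_ (inv_nonneg.2 hsα.le)
  refine (setIntegral_le_integral hφs (Eventually.of_forall fun x => hφ0 _)).trans ?_
  rw [Measure.integral_comp_smul, finrank_euclideanSpace, Fintype.card_fin, smul_eq_mul,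
    abs_of_pos (by positivity), hφ, integral_indicator hT]

/-- A scaling difference that annihilates affine functions is controlled by the weighted norm on a
star-shaped set. -/
theorem sq_mul_measure_le_of_scaling_difference (d : ℕ) (α : ℝ) :
    ∃ K : ℝ, 0 < K ∧ ∀ {T B : Set (Eu d)} {g : Eu d → ℝ}, MeasurableSet T → MeasurableSet B →
      B ⊆ T → (∀ x ∈ T, ∀ s : ℝ, 0 < s → s ≤ 1 → s • x ∈ T) →
      IntegrableOn (fun x => ‖x‖ ^ α * g x ^ 2) T → volume B ≠ ⊤ → ∀ {m w : ℝ}, 0 ≤ m → 0 ≤ w →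
      (∀ x ∈ B, w ≤ ‖x‖ ^ α) →
      (∀ᵐ x, x ∈ B → m ≤ |g x - 3 * g ((1 / 2 : ℝ) • x) + 2 * g ((1 / 4 : ℝ) • x)|) →
      m ^ 2 * w * volume.real B ≤ K * ∫ x in T, ‖x‖ ^ α * g x ^ 2 := by
  refine ⟨3 + 27 * (((1 / 2 : ℝ) ^ α)⁻¹ * ((1 / 2 : ℝ) ^ d)⁻¹)
    + 12 * (((1 / 4 : ℝ) ^ α)⁻¹ * ((1 / 4 : ℝ) ^ d)⁻¹), by positivity, ?_⟩
  intro T B g hT hB hBT hstar hint hfin m w hm hw hwB hmB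
  obtain ⟨i1, h1⟩ := setIntegral_comp_smul_le hT hB one_pos (g := g)
    (fun x hx => hstar x (hBT hx) 1 one_pos le_rfl) hint
  obtain ⟨i2, h2⟩ := setIntegral_comp_smul_le hT hB (by norm_num : (0 : ℝ) < 1 / 2) (g := g)
    (fun x hx => hstar x (hBT hx) (1 / 2) (by norm_num) (by norm_num)) hint
  obtain ⟨i4, h4⟩ := setIntegral_comp_smul_le hT hB (by norm_num : (0 : ℝ) < 1 / 4) (g := g)
    (fun x hx => hstar x (hBT hx) (1 / 4) (by norm_num) (by norm_num)) hint
  simp only [one_smul, Real.one_rpow, one_pow, inv_one, one_mul] at i1 h1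
  have hsum : IntegrableOn (fun x => 3 * (‖x‖ ^ α * g x ^ 2)
      + 27 * (‖x‖ ^ α * g ((1 / 2 : ℝ) • x) ^ 2) + 12 * (‖x‖ ^ α * g ((1 / 4 : ℝ) • x) ^ 2)) B :=
    ((i1.const_mul 3).add (i2.const_mul 27)).add (i4.const_mul 12)
  have hle : ∫ _ in B, m ^ 2 * w ≤ ∫ x in B, (3 * (‖x‖ ^ α * g x ^ 2)
      + 27 * (‖x‖ ^ α * g ((1 / 2 : ℝ) • x) ^ 2)
      + 12 * (‖x‖ ^ α * g ((1 / 4 : ℝ) • x) ^ 2)) := by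
    refine integral_mono_of_nonneg (Eventually.of_forall fun x => by positivity) hsum ?_
    filter_upwards [ae_restrict_of_ae hmB, ae_restrict_mem hB] with x hx hxB
    have h5 := hx hxB
    have h6 := hwB x hxB
    have h7 : m ^ 2 ≤ (g x - 3 * g ((1 / 2 : ℝ) • x) + 2 * g ((1 / 4 : ℝ) • x)) ^ 2 := by
      rw [← sq_abs (g x - _ + _)]
      exact pow_le_pow_left₀ hm h5 2
    -- Cauchy–Schwarz for three summands: the coefficients are 3 times 1, 9 and 4.
    have h8 : (g x - 3 * g ((1 / 2 : ℝ) • x) + 2 * g ((1 / 4 : ℝ) • x)) ^ 2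
        ≤ 3 * g x ^ 2 + 27 * g ((1 / 2 : ℝ) • x) ^ 2 + 12 * g ((1 / 4 : ℝ) • x) ^ 2 := by
      nlinarith [sq_nonneg (g x + 3 * g ((1 / 2 : ℝ) • x)),
        sq_nonneg (g x - 2 * g ((1 / 4 : ℝ) • x)),
        sq_nonneg (3 * g ((1 / 2 : ℝ) • x) + 2 * g ((1 / 4 : ℝ) • x))]
    calc m ^ 2 * w ≤ (3 * g x ^ 2 + 27 * g ((1 / 2 : ℝ) • x) ^ 2
          + 12 * g ((1 / 4 : ℝ) • x) ^ 2) * ‖x‖ ^ α :=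
          mul_le_mul (h7.trans h8) h6 hw (by positivity)
      _ = _ := by ring
  rw [setIntegral_const, smul_eq_mul] at hle
  have hsplit : ∫ x in B, (3 * (‖x‖ ^ α * g x ^ 2)
      + 27 * (‖x‖ ^ α * g ((1 / 2 : ℝ) • x) ^ 2)
      + 12 * (‖x‖ ^ α * g ((1 / 4 : ℝ) • x) ^ 2))
      = 3 * (∫ x in B, ‖x‖ ^ α * g x ^ 2) + 27 * (∫ x in B, ‖x‖ ^ α * g ((1 / 2 : ℝ) • x) ^ 2)
        + 12 * (∫ x in B, ‖x‖ ^ α * g ((1 / 4 : ℝ) • x) ^ 2) := by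
    have i12 : IntegrableOn (fun x => 3 * (‖x‖ ^ α * g x ^ 2)
      + 27 * (‖x‖ ^ α * g ((1 / 2 : ℝ) • x) ^ 2)) B := (i1.const_mul 3).add (i2.const_mul 27)
    rw [integral_add i12 (i4.const_mul 12), integral_add (i1.const_mul 3) (i2.const_mul 27),
      integral_const_mul, integral_const_mul, integral_const_mul]
  rw [hsplit] at hle
  linarith

/-- The dipole potential is homogeneous of degree 1 - d. -/
theorem dipole_smul {s : ℝ} (hs : 0 < s) (F x : Eu d) :
    inner ℝ F (s • x) * ‖s • x‖ ^ (-(d : ℝ)) = s * (s ^ d)⁻¹ * (inner ℝ F x * ‖x‖ ^ (-(d : ℝ))) := by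
  rw [inner_smul_right, norm_smul, Real.norm_of_nonneg hs.le, Real.mul_rpow hs.le (norm_nonneg _),
    Real.rpow_neg hs.le, Real.rpow_natCast]
  ring

/-- The weights 1, -3, 2 are chosen to kill constants, 1 - 3 + 2 = 0, and linear functions, 1 - 3/2
+ 2/4 = 0. -/
theorem affine_scaling_difference (A : Eu d →ᵃ[ℝ] ℝ) (z x : Eu d) :
    A (z + x) - 3 * A (z + (1 / 2 : ℝ) • x) + 2 * A (z + (1 / 4 : ℝ) • x) = 0 := by
  have h : ∀ v, A (z + v) = A.linear v + A z := by
    intro v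
    have := A.map_vadd z v
    rw [vadd_eq_add, vadd_eq_add] at this
    rw [add_comm z v, this]
  rw [h, h, h, map_smul, map_smul, smul_eq_mul, smul_eq_mul]
  ring

end SourceTerm

/-! ### Distance of the dipole from affine functions -/

section SourceBound

variable {d : ℕ} {α : ℝ}

/-- Inside any ball there is a smaller one on which a linear functional is not small. -/
theorem exists_ball_inner_large {F : Eu d} (b : Eu d) {ρ : ℝ} (hρ : 0 < ρ) :
    ∃ b₁, Metric.ball b₁ (ρ / 8) ⊆ Metric.closedBall b ρ ∧
      ∀ x ∈ Metric.ball b₁ (ρ / 8), 3 / 8 * ρ * ‖F‖ ≤ |inner ℝ F x| := by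
  rcases eq_or_ne F 0 with rfl | hF
  · exact ⟨b, (Metric.ball_subset_ball (by linarith)).trans Metric.ball_subset_closedBall, by simp⟩
  have hF0 : 0 < ‖F‖ := norm_pos_iff.2 hF
  -- The centre is moved by ρ/2 along F or -F, with the sign that increases |F·b|. The gain is
  -- ρ‖F‖/2, of which the smaller ball costs at most ρ‖F‖/8.
  have key : ∀ ε : ℝ, |ε| = 1 → 0 ≤ ε * inner ℝ F b →
      Metric.ball (b + (ε * (ρ / 2) * ‖F‖⁻¹) • F) (ρ / 8) ⊆ Metric.closedBall b ρ ∧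
      ∀ x ∈ Metric.ball (b + (ε * (ρ / 2) * ‖F‖⁻¹) • F) (ρ / 8),
        3 / 8 * ρ * ‖F‖ ≤ |inner ℝ F x| := by
    intro ε hε hb
    have hε2 : ε * ε = 1 := by rw [← abs_mul_abs_self, hε, one_mul]
    set v := (ε * (ρ / 2) * ‖F‖⁻¹) • F with hv
    have hvn : ‖v‖ = ρ / 2 := by
      rw [hv, norm_smul, Real.norm_eq_abs, abs_mul, abs_mul, hε, abs_of_pos (by positivity : 0 < ρ / 2),
        abs_of_pos (inv_pos.2 hF0)]
      field_simp
    refine ⟨fun x hx => ?_, fun x hx => ?_⟩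
    · rw [Metric.mem_ball, dist_eq_norm] at hx
      rw [Metric.mem_closedBall, dist_eq_norm]
      have : x - b = (x - (b + v)) + v := by module
      rw [this]
      refine (norm_add_le _ _).trans ?_
      linarith
    · rw [Metric.mem_ball, dist_eq_norm] at hx
      have h1 : inner ℝ F x = inner ℝ F b + ε * (ρ / 2) * ‖F‖ + inner ℝ F (x - (b + v)) := by
        rw [inner_sub_right, inner_add_right, hv, inner_smul_right, real_inner_self_eq_norm_sq]
        field_simp
        ring
      have h2 : |inner ℝ F (x - (b + v))| ≤ ‖F‖ * (ρ / 8) :=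
        (abs_real_inner_le_norm _ _).trans (by gcongr)
      have h3 : ε * inner ℝ F x = ε * inner ℝ F b + ρ / 2 * ‖F‖ + ε * inner ℝ F (x - (b + v)) := by
        rw [h1]
        linear_combination (ρ / 2 * ‖F‖) * hε2
      have h4 : |ε * inner ℝ F (x - (b + v))| ≤ ‖F‖ * (ρ / 8) := by rwa [abs_mul, hε, one_mul]
      have h5 : ε * inner ℝ F x ≤ |inner ℝ F x| := by
        refine (le_abs_self _).trans ?_
        rw [abs_mul, hε, one_mul]
      have := neg_abs_le (ε * inner ℝ F (x - (b + v)))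
      linarith
  rcases le_total 0 (inner ℝ F b) with hb | hb
  · exact ⟨_, key 1 (by simp) (by simpa using hb)⟩
  · exact ⟨_, key (-1) (by simp) (by simpa using hb)⟩

/-- Halving the argument multiplies the dipole f by a = 2^(d-1) ≥ 2, so its scaling difference is (1
- 3a + 2a²) f with a coefficient of at least 1. The three remainders contribute at most (1 + 3 + 2)
C ‖F‖. For small h this is absorbed by half of the lower bound for |f|, because h^(1-d) ≥ h^(-1)
when d ≥ 2 and h ≤ 1. -/
theorem scaling_difference_lower_bound (hd : 2 ≤ d) {κ C σ h : ℝ}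
    (hσ : 0 < σ) (hh : 0 < h) (hh1 : h ≤ 1) (hhC : 6 * C * h ≤ 3 / 16 * σ) (hκ : 0 < κ)
    {F x : Eu d} {P : Eu d → ℝ} (hx : ‖x‖ ≤ h) (hFx : 3 / 8 * (σ * h) * ‖F‖ ≤ |inner ℝ F x|)
    (hx0 : x ≠ 0)
    (hP : ∀ s : ℝ, s = 1 ∨ s = 1 / 2 ∨ s = 1 / 4 →
      |κ * P (s • x) - inner ℝ F (s • x) * ‖s • x‖ ^ (-(d : ℝ))| ≤ C * ‖F‖) :
    κ⁻¹ * (3 / 16 * σ * ‖F‖ * (h * h ^ (-(d : ℝ))))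
      ≤ |P x - 3 * P ((1 / 2 : ℝ) • x) + 2 * P ((1 / 4 : ℝ) • x)| := by
  set f := inner ℝ F x * ‖x‖ ^ (-(d : ℝ)) with hf
  have p1 := hP 1 (Or.inl rfl)
  have p2 := hP (1 / 2) (Or.inr (Or.inl rfl))
  have p4 := hP (1 / 4) (Or.inr (Or.inr rfl))
  rw [dipole_smul (by norm_num)] at p2 p4
  rw [one_smul] at p1
  rw [← hf] at p1 p2 p4
  set a : ℝ := 1 / 2 * ((1 / 2 : ℝ) ^ d)⁻¹ with ha
  have ha2 : 2 ≤ a := by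
    have h1 : ((1 / 2 : ℝ) ^ d)⁻¹ = 2 ^ d := by simp
    rw [ha, h1]
    have : (2 : ℝ) ^ 2 ≤ 2 ^ d := pow_le_pow_right₀ (by norm_num) hd
    linarith
  have ha4 : 1 / 4 * ((1 / 4 : ℝ) ^ d)⁻¹ = a ^ 2 := by
    have : (1 / 4 : ℝ) ^ d = (1 / 2 : ℝ) ^ d * (1 / 2 : ℝ) ^ d := by
      rw [← mul_pow]
      norm_num
    rw [this, ha, mul_inv]
    ring
  rw [ha4] at p4
  have hnx : 0 < ‖x‖ := norm_pos_iff.2 hx0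
  have hpow : h ^ (-(d : ℝ)) ≤ ‖x‖ ^ (-(d : ℝ)) :=
    Real.rpow_le_rpow_of_nonpos hnx hx (by simp)
  have hhpos : 0 < h ^ (-(d : ℝ)) := Real.rpow_pos_of_pos hh _
  have hflow : 3 / 8 * (σ * h) * ‖F‖ * h ^ (-(d : ℝ)) ≤ |f| := by
    rw [hf, abs_mul, abs_of_pos (Real.rpow_pos_of_pos hnx _)]
    exact mul_le_mul hFx hpow hhpos.le (abs_nonneg _)
  have hcoef : 1 ≤ 1 - 3 * a + 2 * a ^ 2 := by nlinarith
  have hfa : |f| ≤ |(1 - 3 * a + 2 * a ^ 2) * f| := by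
    rw [abs_mul (1 - 3 * a + 2 * a ^ 2), abs_of_pos (by linarith : 0 < 1 - 3 * a + 2 * a ^ 2)]
    exact le_mul_of_one_le_left (abs_nonneg _) hcoef
  have herr : |(1 - 3 * a + 2 * a ^ 2) * f|
      ≤ κ * |P x - 3 * P ((1 / 2 : ℝ) • x) + 2 * P ((1 / 4 : ℝ) • x)| + 6 * (C * ‖F‖) := by
    have e : (1 - 3 * a + 2 * a ^ 2) * f
        = κ * (P x - 3 * P ((1 / 2 : ℝ) • x) + 2 * P ((1 / 4 : ℝ) • x))
          - ((κ * P x - f) - 3 * (κ * P ((1 / 2 : ℝ) • x) - a * f)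
            + 2 * (κ * P ((1 / 4 : ℝ) • x) - a ^ 2 * f)) := by ring
    rw [e]
    refine (abs_sub _ _).trans ?_
    rw [abs_mul κ, abs_of_pos hκ]
    gcongr
    rw [abs_le] at p1 p2 p4 ⊢
    constructor <;> linarith
  have hsmall : 6 * C * ‖F‖ ≤ 3 / 16 * σ * ‖F‖ * (h * h ^ (-(d : ℝ))) := by
    have h4 : h⁻¹ ≤ h * h ^ (-(d : ℝ)) := by
      have : h * h ^ (-(d : ℝ)) = h ^ (1 - (d : ℝ)) := by
        rw [sub_eq_add_neg, Real.rpow_add hh, Real.rpow_one]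
      rw [this, ← Real.rpow_neg_one]
      refine Real.rpow_le_rpow_of_exponent_ge hh hh1 ?_
      have : (2 : ℝ) ≤ d := by exact_mod_cast hd
      linarith
    calc 6 * C * ‖F‖ = (6 * C * h) * ‖F‖ * h⁻¹ := by field_simp
      _ ≤ (3 / 16 * σ) * ‖F‖ * (h * h ^ (-(d : ℝ))) := by gcongr
  rw [inv_mul_le_iff₀ hκ]
  have : 3 / 8 * (σ * h) * ‖F‖ * h ^ (-(d : ℝ))
      = 2 * (3 / 16 * σ * ‖F‖ * (h * h ^ (-(d : ℝ)))) := by ring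
  linarith

/-- A function that is close to a dipole potential near `z` is far from all affine functions on every
convex set that contains `z` and a large ball. -/
theorem exists_dipole_lower_bound [NeZero d] (hd : 2 ≤ d) (hα : (d : ℝ) - 2 < α) {κ r C σ L : ℝ}
    (hκ : 0 < κ) (hr : 0 < r) (hC : 0 ≤ C) (hσ : 0 < σ) :
    ∃ K : ℝ, 0 < K ∧ ∀ {F z y : Eu d} {p : Eu d → ℝ} {c h : ℝ} {T : Set (Eu d)}
      (A : Eu d →ᵃ[ℝ] ℝ),
      (∀ᵐ x, x ∈ Metric.ball z r →
        |κ * (p x - c) - inner ℝ F (x - z) * ‖x - z‖ ^ (-(d : ℝ))| ≤ C * ‖F‖) →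
      Convex ℝ T → IsClosed T → z ∈ T → 0 < h → h ≤ L → T ⊆ Metric.closedBall z h →
      Metric.closedBall y (σ * h) ⊆ T →
      IntegrableOn (fun x => weight z α x * (p x - A x) ^ 2) T →
      h ^ (α + 2 - d) * ‖F‖ ^ 2 ≤ K * ∫ x in T, weight z α x * (p x - A x) ^ 2 := by
  have hα0 : 0 < α := by
    have : (2 : ℝ) ≤ d := by exact_mod_cast hd
    linarith
  have hγ : 0 < α + 2 - d := by linarith
  obtain ⟨K₀, hK₀, hdiff⟩ := sq_mul_measure_le_of_scaling_difference d α
  -- The size below which the decomposition of p is available and its remainder can be absorbed.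
  set ρ₀ : ℝ := min (min (r / 2) 1) (3 * σ / (96 * (C + 1))) with hρ₀
  have hρpos : 0 < ρ₀ := by positivity
  have hρr : ρ₀ ≤ r / 2 := (min_le_left _ _).trans (min_le_left _ _)
  have hρ1 : ρ₀ ≤ 1 := (min_le_left _ _).trans (min_le_right _ _)
  have hρC : 6 * C * ρ₀ ≤ 3 / 16 * σ := by
    have h1 : ρ₀ ≤ 3 * σ / (96 * (C + 1)) := min_le_right _ _
    calc 6 * C * ρ₀ ≤ 6 * (C + 1) * (3 * σ / (96 * (C + 1))) := by
          gcongr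
          linarith
      _ = 3 / 16 * σ := by
          field_simp
          norm_num
  have hvol := measureReal_unitBall_pos d
  set v := (volume : Measure (Eu d)).real (Metric.ball 0 1) with hv
  set m₀ : ℝ := κ⁻¹ * (3 / 16 * σ) with hm₀
  set c₀ : ℝ := m₀ ^ 2 * (3 / 8 * σ) ^ α * (σ / 8) ^ d * v with hc₀
  have hc₀pos : 0 < c₀ := by positivity
  set E : ℝ := max 1 (L / ρ₀) with hE
  have hEpos : 0 < E := by positivity
  refine ⟨E ^ (α + 2 - d) * (c₀⁻¹ * K₀), by positivity, ?_⟩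
  intro F z y p c h T A hp hconv hclosed hz hh hhL hTh hyT hint
  -- A set larger than ρ₀ is handled by contracting its ball towards z by the factor t; convexity
  -- keeps the contracted ball inside.
  set h' : ℝ := min h ρ₀ with hh'
  have hh'pos : 0 < h' := lt_min hh hρpos
  set t : ℝ := h' / h with ht
  have htpos : 0 < t := by positivity
  have ht1 : t ≤ 1 := (div_le_one hh).2 (min_le_left _ _)
  have hth : t * h = h' := by rw [ht]; field_simp
  set T₀ : Set (Eu d) := {x | z + x ∈ T} with hT₀
  have hT₀m : MeasurableSet T₀ :=
    (hclosed.preimage (continuous_const.add continuous_id)).measurableSet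
  have hstar : ∀ x ∈ T₀, ∀ s : ℝ, 0 < s → s ≤ 1 → s • x ∈ T₀ := by
    intro x hx s hs hs1
    have h1 := hconv hz hx (sub_nonneg.2 hs1) hs.le (by ring)
    have h2 : (1 - s) • z + s • (z + x) = z + s • x := by module
    rw [h2] at h1
    exact h1
  have hball : ∀ x ∈ Metric.closedBall (t • (y - z)) (σ * h'), x ∈ T₀ ∧ ‖x‖ ≤ h' := by
    intro x hx
    have hx1 : z + t⁻¹ • x ∈ T := by
      refine hyT ?_
      rw [Metric.mem_closedBall, dist_eq_norm] at hx ⊢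
      have : z + t⁻¹ • x - y = t⁻¹ • (x - t • (y - z)) := by
        rw [smul_sub, smul_smul, inv_mul_cancel₀ htpos.ne']
        module
      rw [this, norm_smul, norm_inv, Real.norm_of_nonneg htpos.le, inv_mul_le_iff₀ htpos]
      refine hx.trans (le_of_eq ?_)
      rw [← hth]
      ring
    have hxt : t • (t⁻¹ • x) = x := by rw [smul_smul, mul_inv_cancel₀ htpos.ne', one_smul]
    refine ⟨?_, ?_⟩
    · have := hstar (t⁻¹ • x) hx1 t htpos ht1
      rwa [hxt] at this
    · have h1 := hTh hx1
      rw [Metric.mem_closedBall, dist_eq_norm, add_sub_cancel_left] at h1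
      rw [← hxt, norm_smul, Real.norm_of_nonneg htpos.le, ← hth]
      gcongr
  obtain ⟨b₁, hb₁, hFb⟩ := exists_ball_inner_large (F := F) (t • (y - z))
    (by positivity : 0 < σ * h')
  set B := Metric.ball b₁ (σ * h' / 8) with hB
  set P : Eu d → ℝ := fun x => p (z + x) - c with hP
  set g : Eu d → ℝ := fun x => p (z + x) - A (z + x) with hg
  have htrans : ∫ x in T, weight z α x * (p x - A x) ^ 2 = ∫ x in T₀, ‖x‖ ^ α * g x ^ 2 := by
    have h1 := (measurePreserving_add_left (volume : Measure (Eu d)) z).setIntegral_preimage_emb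
      (MeasurableEquiv.addLeft z).measurableEmbedding
      (fun x => weight z α x * (p x - A x) ^ 2) T
    rw [← h1]
    simp [weight, hT₀, hg, Set.preimage]
  have hintg : IntegrableOn (fun x => ‖x‖ ^ α * g x ^ 2) T₀ := by
    have h1 := ((measurePreserving_add_left (volume : Measure (Eu d)) z).integrableOn_comp_preimage
      (MeasurableEquiv.addLeft z).measurableEmbedding).2 hint
    refine h1.congr_fun (fun x _ => ?_) hT₀m
    simp [weight, hg]
  rw [htrans]
  have hI0 : 0 ≤ ∫ x in T₀, ‖x‖ ^ α * g x ^ 2 := integral_nonneg fun x => by positivity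
  rcases eq_or_ne F 0 with rfl | hF
  · simp only [norm_zero, ne_eq, OfNat.ofNat_ne_zero, not_false_eq_true, zero_pow, mul_zero]
    positivity
  have hF0 : 0 < ‖F‖ := norm_pos_iff.2 hF
  have hp0 : ∀ᵐ x : Eu d, x ∈ Metric.ball (0 : Eu d) r →
      |κ * P x - inner ℝ F x * ‖x‖ ^ (-(d : ℝ))| ≤ C * ‖F‖ := by
    have h1 := (measurePreserving_add_left (volume : Measure (Eu d)) z).quasiMeasurePreserving.ae hp
    filter_upwards [h1] with x hx hxr
    have := hx (by simpa using hxr)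
    simpa [hP] using this
  have hps : ∀ s : ℝ, s ≠ 0 → ∀ᵐ x : Eu d, s • x ∈ Metric.ball (0 : Eu d) r →
      |κ * P (s • x) - inner ℝ F (s • x) * ‖s • x‖ ^ (-(d : ℝ))| ≤ C * ‖F‖ := fun s hs =>
    (Measure.quasiMeasurePreserving_smul (volume : Measure (Eu d)) hs).ae hp0
  have hhd : 0 < h' * h' ^ (-(d : ℝ)) := mul_pos hh'pos (Real.rpow_pos_of_pos hh'pos _)
  have hmain := hdiff (T := T₀) (B := B) (g := g) (m := m₀ * ‖F‖ * (h' * h' ^ (-(d : ℝ))))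
    (w := (3 / 8 * (σ * h')) ^ α) hT₀m measurableSet_ball (fun x hx => (hball x (hb₁ hx)).1) hstar
    hintg measure_ball_lt_top.ne (by positivity) (by positivity) ?_ ?_
  · have hBv : volume.real B = (σ * h' / 8) ^ d * v := by
      rw [hB, measureReal_def, Measure.addHaar_ball _ _ (by positivity), ENNReal.toReal_mul,
        ENNReal.toReal_ofReal (by positivity), finrank_euclideanSpace, Fintype.card_fin, hv,
        measureReal_def]
    -- The exponent is the sum of 2 - 2d from the squared dipole, α from the weight and d from the
    -- volume.
    have hcalc : (m₀ * ‖F‖ * (h' * h' ^ (-(d : ℝ)))) ^ 2 * (3 / 8 * (σ * h')) ^ α * volume.real B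
        = c₀ * (h' ^ (α + 2 - d) * ‖F‖ ^ 2) := by
      have e1 : (3 / 8 * (σ * h')) ^ α = (3 / 8 * σ) ^ α * h' ^ α := by
        rw [← mul_assoc, Real.mul_rpow (by positivity) hh'pos.le]
      have e2 : h' ^ (α + 2 - d) = (h' * h' ^ (-(d : ℝ))) ^ 2 * h' ^ α * h' ^ d := by
        have : (h' * h' ^ (-(d : ℝ))) ^ 2 = h' ^ ((2 : ℝ) - 2 * d) := by
          rw [mul_pow, ← Real.rpow_natCast (h' ^ (-(d : ℝ))), ← Real.rpow_mul hh'pos.le,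
            ← Real.rpow_natCast h', ← Real.rpow_add hh'pos]
          congr 1
          push_cast
          ring
        rw [this, ← Real.rpow_natCast h' d, ← Real.rpow_add hh'pos, ← Real.rpow_add hh'pos]
        congr 1
        ring
      rw [hBv, e1, e2, hc₀]
      have e3 : (σ * h' / 8) ^ d = (σ / 8) ^ d * h' ^ d := by
        rw [← mul_pow]
        ring
      rw [e3]
      ring
    rw [hcalc] at hmain
    -- Since h ≤ L, the contraction loses at most the factor E, and the exponent α + 2 - d is
    -- positive, so returning to h costs a fixed power of E.
    have hhE : h ≤ E * h' := by
      rcases le_total h ρ₀ with h1 | h1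
      · rw [hh', min_eq_left h1]
        exact le_mul_of_one_le_left hh.le (le_max_left _ _)
      · rw [hh', min_eq_right h1]
        calc h ≤ L := hhL
          _ = L / ρ₀ * ρ₀ := by field_simp
          _ ≤ _ := by
            gcongr
            exact le_max_right _ _
    have hhγ : h ^ (α + 2 - d) ≤ E ^ (α + 2 - d) * h' ^ (α + 2 - d) := by
      rw [← Real.mul_rpow hEpos.le hh'pos.le]
      exact Real.rpow_le_rpow hh.le hhE hγ.le
    have h2 : h' ^ (α + 2 - d) * ‖F‖ ^ 2 ≤ c₀⁻¹ * (K₀ * ∫ x in T₀, ‖x‖ ^ α * g x ^ 2) := by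
      rw [le_inv_mul_iff₀ hc₀pos]
      exact hmain
    calc h ^ (α + 2 - d) * ‖F‖ ^ 2 ≤ E ^ (α + 2 - d) * h' ^ (α + 2 - d) * ‖F‖ ^ 2 := by gcongr
      _ = E ^ (α + 2 - d) * (h' ^ (α + 2 - d) * ‖F‖ ^ 2) := by ring
      _ ≤ E ^ (α + 2 - d) * (c₀⁻¹ * (K₀ * ∫ x in T₀, ‖x‖ ^ α * g x ^ 2)) := by gcongr
      _ = _ := by ring
  · intro x hx
    refine Real.rpow_le_rpow (by positivity) ?_ hα0.le
    -- By Cauchy–Schwarz the lower bound for |F·x| also keeps x away from the origin, which bounds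
    -- the weight from below.
    have h1 := hFb x hx
    have h2 := abs_real_inner_le_norm F x
    refine le_of_mul_le_mul_right ?_ hF0
    linarith [mul_comm ‖F‖ ‖x‖]
  · filter_upwards [hps 1 one_ne_zero, hps (1 / 2) (by norm_num), hps (1 / 4) (by norm_num),
      Measure.ae_ne volume (0 : Eu d)] with x h1 h2 h4 hx0 hxB
    have hxh := (hball x (hb₁ hxB)).2
    have hxr : ∀ s : ℝ, 0 < s → s ≤ 1 → s • x ∈ Metric.ball (0 : Eu d) r := by
      intro s hs hs1
      rw [mem_ball_zero_iff, norm_smul, Real.norm_of_nonneg hs.le]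
      have h5 : h' ≤ r / 2 := (min_le_right _ _).trans hρr
      nlinarith [norm_nonneg x]
    have hlow := scaling_difference_lower_bound hd hσ hh'pos ((min_le_right _ _).trans hρ1)
      (by
        refine le_trans ?_ hρC
        gcongr
        exact min_le_right _ _) hκ (P := P) hxh (hFb x hxB) hx0 (by
        rintro s (rfl | rfl | rfl)
        · exact h1 (hxr 1 one_pos le_rfl)
        · exact h2 (hxr _ (by norm_num) (by norm_num))
        · exact h4 (hxr _ (by norm_num) (by norm_num)))
    -- The scaling difference sees neither the affine function nor the constant c, so it is the same
    -- for p - A as for p - c.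
    have e : g x - 3 * g ((1 / 2 : ℝ) • x) + 2 * g ((1 / 4 : ℝ) • x)
        = P x - 3 * P ((1 / 2 : ℝ) • x) + 2 * P ((1 / 4 : ℝ) • x) := by
      have := affine_scaling_difference A z x
      simp only [hg, hP]
      linarith
    rw [e]
    refine le_trans (le_of_eq ?_) hlow
    rw [hm₀]
    ring

end SourceBound

/-! ### Polynomial functions as powers of the space of affine functions -/

section Polynomials

variable {m : ℕ}

/-- The affine functions on `Eu m`. -/
noncomputable def affSpace (m : ℕ) : Submodule ℝ (Eu m → ℝ) :=
  Submodule.span ℝ (insert 1 (Set.range fun (i : Fin m) (x : Eu m) => x i))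

/-- The polynomial functions of degree at most `k` on `Eu m`. -/
noncomputable def polySpace (m k : ℕ) : Submodule ℝ (Eu m → ℝ) := affSpace m ^ k

theorem one_mem_affSpace : (1 : Eu m → ℝ) ∈ affSpace m :=
  Submodule.subset_span (Set.mem_insert _ _)

theorem coord_mem_affSpace (i : Fin m) : (fun x : Eu m => x i) ∈ affSpace m :=
  Submodule.subset_span (Set.mem_insert_of_mem _ ⟨i, rfl⟩)

theorem affineMap_mem_affSpace (A : Eu m →ᵃ[ℝ] ℝ) : (A : Eu m → ℝ) ∈ affSpace m := by
  have : (A : Eu m → ℝ) = A 0 • (1 : Eu m → ℝ)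
      + ∑ i, A.linear (unitVec i) • (fun x : Eu m => x i) := by
    funext x
    have hx : x = ∑ i, x i • unitVec i := by
      have := (EuclideanSpace.basisFun (Fin m) ℝ).sum_repr x
      simpa [unitVec] using! this.symm
    have h1 : A x = A.linear x + A 0 := by
      have := A.map_vadd 0 x
      simpa using this
    rw [h1]
    conv_lhs => rw [hx, map_sum]
    simp [mul_comm, add_comm]
  rw [this]
  exact Submodule.add_mem _ (Submodule.smul_mem _ _ one_mem_affSpace)
    (Submodule.sum_mem _ fun i _ => Submodule.smul_mem _ _ (coord_mem_affSpace i))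

theorem polySpace_one : polySpace m 1 = affSpace m := pow_one _

theorem affineMap_mem_polySpace (A : Eu m →ᵃ[ℝ] ℝ) : (A : Eu m → ℝ) ∈ polySpace m 1 := by
  rw [polySpace_one]
  exact affineMap_mem_affSpace A

theorem mul_mem_polySpace {k l : ℕ} {f g : Eu m → ℝ} (hf : f ∈ polySpace m k)
    (hg : g ∈ polySpace m l) : f * g ∈ polySpace m (k + l) := by
  rw [polySpace, pow_add]
  exact Submodule.mul_mem_mul hf hg

theorem one_mem_polySpace (k : ℕ) : (1 : Eu m → ℝ) ∈ polySpace m k := by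
  induction k with
  | zero =>
    rw [polySpace, pow_zero]
    exact Submodule.one_le.1 le_rfl
  | succ k ih =>
    have := mul_mem_polySpace ih (polySpace_one (m := m) ▸ one_mem_affSpace)
    simpa using this

theorem polySpace_mono {k l : ℕ} (h : k ≤ l) : polySpace m k ≤ polySpace m l := by
  intro f hf
  obtain ⟨n, rfl⟩ := Nat.exists_eq_add_of_le h
  have := mul_mem_polySpace hf (one_mem_polySpace n)
  simpa using this

theorem const_mem_polySpace (c : ℝ) (k : ℕ) : (fun _ => c : Eu m → ℝ) ∈ polySpace m k := by
  have := Submodule.smul_mem (polySpace m k) c (one_mem_polySpace k)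
  convert this using 1
  funext x
  simp

instance (k : ℕ) : FiniteDimensional ℝ (polySpace m k) := by
  have h : (affSpace m).FG :=
    Submodule.fg_span ((Set.finite_range _).insert _)
  exact Module.Finite.iff_fg.2 (h.pow k)

theorem affSpace_induction {C : (Eu m → ℝ) → Prop} (h1 : C 1) (hc : ∀ i, C fun x => x i)
    (hadd : ∀ f g, C f → C g → C (f + g)) (hsmul : ∀ (c : ℝ) f, C f → C (c • f))
    {f : Eu m → ℝ} (hf : f ∈ affSpace m) : C f := by
  induction hf using Submodule.span_induction with
  | mem x hx =>
    rcases hx with rfl | ⟨i, rfl⟩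
    · exact h1
    · exact hc i
  | zero => simpa using hsmul 0 1 h1
  | add x y _ _ hx hy => exact hadd x y hx hy
  | smul a x _ hx => exact hsmul a x hx

theorem polySpace_analytic {k : ℕ} {f : Eu m → ℝ} (hf : f ∈ polySpace m k) :
    AnalyticOnNhd ℝ f Set.univ := by
  have haff : ∀ f ∈ affSpace m, AnalyticOnNhd ℝ f Set.univ := fun f hf =>
    affSpace_induction (C := fun f => AnalyticOnNhd ℝ f Set.univ) analyticOnNhd_const
      (fun i => (EuclideanSpace.proj i : Eu m →L[ℝ] ℝ).analyticOnNhd _)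
      (fun f g hf hg => hf.add hg) (fun c f hf => analyticOnNhd_const.mul hf) hf
  induction hf using Submodule.pow_induction_on_left' with
  | algebraMap r => exact analyticOnNhd_const
  | add x y i _ _ hx hy => exact hx.add hy
  | mem_mul g hg i x _ hx => exact (haff g hg).mul hx

theorem polySpace_contDiff {k : ℕ} {f : Eu m → ℝ} (hf : f ∈ polySpace m k) : ContDiff ℝ ∞ f :=
  (contDiffOn_univ (n := ∞)).1 ((polySpace_analytic hf).contDiffOn uniqueDiffOn_univ)

/-- By the product rule, because the derivative of an affine factor is constant. The drop in degree
is not recorded, since one common finite dimensional space is enough for the inverse estimates. -/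
theorem pd_mem_polySpace {k : ℕ} {f : Eu m → ℝ} (hf : f ∈ polySpace m k) (j : Fin m) :
    pd j f ∈ polySpace m k := by
  have haff : ∀ f ∈ affSpace m, ∃ c : ℝ, ∀ x, pd j f x = c := fun f hf => by
    have : (∃ c : ℝ, ∀ x, pd j f x = c) ∧ Differentiable ℝ f := by
      refine affSpace_induction (C := fun f => (∃ c : ℝ, ∀ x, pd j f x = c) ∧ Differentiable ℝ f)
        ?_ ?_ ?_ ?_ hf
      · exact ⟨⟨0, fun x => pd_const 1 j x⟩, differentiable_const _⟩
      · exact fun i => ⟨⟨_, fun x => pd_coord i j x⟩, (contDiff_coord i).differentiable (by simp)⟩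
      · rintro f g ⟨⟨a, ha⟩, hf⟩ ⟨⟨b, hb⟩, hg⟩
        exact ⟨⟨a + b, fun x => by rw [← ha x, ← hb x]; exact pd_add (hf x) (hg x) j⟩, hf.add hg⟩
      · rintro c f ⟨⟨a, ha⟩, hf⟩
        exact ⟨⟨c * a, fun x => by rw [← ha x]; exact pd_const_mul (hf x) c j⟩, hf.const_smul c⟩
    exact this.1
  induction hf using Submodule.pow_induction_on_left' with
  | algebraMap r =>
    have : pd j (algebraMap ℝ (Eu m → ℝ) r) = fun _ => 0 := funext fun x => pd_const r j x
    rw [this]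
    exact Submodule.zero_mem _
  | add x y i hx hy hx' hy' =>
    have : pd j (x + y) = pd j x + pd j y := by
      funext w
      exact pd_add ((polySpace_contDiff hx).differentiable (by simp) w)
        ((polySpace_contDiff hy).differentiable (by simp) w) j
    rw [this]
    exact Submodule.add_mem _ hx' hy'
  | mem_mul g hg i x hx hx' =>
    obtain ⟨c, hc⟩ := haff g hg
    have hg' : g ∈ polySpace m 1 := polySpace_one (m := m) ▸ hg
    have : pd j (g * x) = c • x + g * pd j x := by
      funext w
      have := pd_mul ((polySpace_contDiff hg').differentiable (by simp) w)
        ((polySpace_contDiff hx).differentiable (by simp) w) j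
      rw [hc] at this
      exact this
    rw [this]
    refine Submodule.add_mem _ (Submodule.smul_mem _ _ (polySpace_mono (Nat.le_succ i) hx)) ?_
    rw [Nat.succ_eq_one_add]
    exact mul_mem_polySpace hg' hx'

/-- Serves to rescale balls, to restrict polynomials to a hyperplane and to extend them constantly
in the normal direction. -/
theorem comp_affine_mem_polySpace {n k : ℕ} {f : Eu m → ℝ} (hf : f ∈ polySpace m k)
    (A : Eu n →ᵃ[ℝ] Eu m) : (fun x => f (A x)) ∈ polySpace n k := by
  have haff : ∀ f ∈ affSpace m, (fun x => f (A x)) ∈ polySpace n 1 := fun f hf => by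
    refine affSpace_induction (C := fun f => (fun x => f (A x)) ∈ polySpace n 1) ?_ ?_ ?_ ?_ hf
    · exact one_mem_polySpace 1
    · exact fun i => affineMap_mem_polySpace
        (((EuclideanSpace.proj i : Eu m →L[ℝ] ℝ) : Eu m →ₗ[ℝ] ℝ).toAffineMap.comp A)
    · exact fun f g hf hg => Submodule.add_mem _ hf hg
    · exact fun c f hf => Submodule.smul_mem _ _ hf
  induction hf using Submodule.pow_induction_on_left' with
  | algebraMap r => exact const_mem_polySpace r 0
  | add x y i _ _ hx hy => exact Submodule.add_mem _ hx hy
  | mem_mul g hg i x _ hx =>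
    rw [Nat.succ_eq_one_add]
    exact mul_mem_polySpace (haff g hg) hx

theorem prod_mem_polySpace {ι : Type*} (s : Finset ι) {f : ι → Eu m → ℝ} {k : ι → ℕ}
    (hf : ∀ i ∈ s, f i ∈ polySpace m (k i)) : ∏ i ∈ s, f i ∈ polySpace m (∑ i ∈ s, k i) := by
  classical
  induction s using Finset.induction_on with
  | empty => simpa using one_mem_polySpace 0
  | insert a s ha ih =>
    rw [Finset.prod_insert ha, Finset.sum_insert ha]
    exact mul_mem_polySpace (hf a (Finset.mem_insert_self _ _))
      (ih fun i hi => hf i (Finset.mem_insert_of_mem hi))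

theorem eval_mem_polySpace {k : ℕ} {P : MvPolynomial (Fin m) ℝ} (hP : P.totalDegree ≤ k) :
    (fun x : Eu m => MvPolynomial.eval (fun i => x i) P) ∈ polySpace m k := by
  have : (fun x : Eu m => MvPolynomial.eval (fun i => x i) P)
      = ∑ s ∈ P.support, P.coeff s • ∏ i, (fun x : Eu m => x i) ^ (s i) := by
    funext x
    rw [MvPolynomial.eval_eq']
    simp
  rw [this]
  refine Submodule.sum_mem _ fun s hs => Submodule.smul_mem _ _ ?_
  have h1 : ∑ i, s i ≤ k := by
    refine le_trans ?_ ((MvPolynomial.le_totalDegree hs).trans hP)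
    rw [Finsupp.sum_fintype _ _ (fun _ => rfl)]
  refine polySpace_mono h1 (prod_mem_polySpace _ fun i _ => ?_)
  have : ∀ n : ℕ, (fun x : Eu m => x i) ^ n ∈ polySpace m n := fun n => by
    rw [polySpace]
    exact Submodule.pow_mem_pow _ (coord_mem_affSpace i) n
  exact this _

end Polynomials

/-! ### Inverse estimates by finite dimensionality -/

section NormEquivalence

/-- An injective `L` lets `T` factor through the range of `L`, and a linear map on a finite
dimensional normed space is bounded. -/
theorem exists_norm_le_of_ker_eq_bot {V X Y : Type*} [AddCommGroup V] [Module ℝ V]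
    [FiniteDimensional ℝ V] [NormedAddCommGroup X] [NormedSpace ℝ X] [NormedAddCommGroup Y]
    [NormedSpace ℝ Y] (L : V →ₗ[ℝ] X) (hL : Function.Injective L) (T : V →ₗ[ℝ] Y) :
    ∃ C : ℝ, 0 < C ∧ ∀ v, ‖T v‖ ≤ C * ‖L v‖ := by
  let e := LinearEquiv.ofInjective L hL
  let S : LinearMap.range L →L[ℝ] Y := (T ∘ₗ e.symm.toLinearMap).toContinuousLinearMap
  refine ⟨‖S‖ + 1, by positivity, fun v => ?_⟩
  have h := S.le_opNorm (e v)
  have h1 : S (e v) = T v := by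
    change T (e.symm (e v)) = T v
    rw [e.symm_apply_apply]
  have h2 : ‖e v‖ = ‖L v‖ := rfl
  rw [h1, h2] at h
  nlinarith [norm_nonneg (L v)]

variable {m : ℕ}

theorem memLp_poly {k : ℕ} (f : polySpace m k) :
    MemLp f.1 2 ((volume : Measure (Eu m)).restrict (Metric.ball 0 (1 / 2))) := by
  have hc := (polySpace_contDiff f.2).continuous
  obtain ⟨C, hC⟩ := (isCompact_closedBall (0 : Eu m) (1 / 2)).exists_bound_of_continuousOn
    hc.continuousOn
  have : IsFiniteMeasure ((volume : Measure (Eu m)).restrict (Metric.ball 0 (1 / 2))) :=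
    ⟨by simpa using measure_ball_lt_top⟩
  refine MemLp.of_bound hc.aestronglyMeasurable C ?_
  filter_upwards [ae_restrict_mem measurableSet_ball] with x hx
  exact hC x (Metric.ball_subset_closedBall hx)

/-- Restriction of polynomial functions to the ball of radius `1 / 2`, as an `L²` function. -/
noncomputable def polyToL2 (m k : ℕ) :
    polySpace m k →ₗ[ℝ] Lp ℝ 2 ((volume : Measure (Eu m)).restrict (Metric.ball 0 (1 / 2))) where
  toFun f := (memLp_poly f).toLp f.1
  map_add' f g := MemLp.toLp_add (memLp_poly f) (memLp_poly g)
  map_smul' c f := MemLp.toLp_const_smul c (memLp_poly f)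

theorem polyToL2_coeFn {k : ℕ} (f : polySpace m k) :
    polyToL2 m k f =ᵐ[(volume : Measure (Eu m)).restrict (Metric.ball 0 (1 / 2))] f.1 :=
  MemLp.coeFn_toLp (memLp_poly f)

theorem norm_sq_polyToL2 {k : ℕ} (f : polySpace m k) :
    ‖polyToL2 m k f‖ ^ 2 = ∫ x in Metric.ball (0 : Eu m) (1 / 2), f.1 x ^ 2 := by
  rw [← real_inner_self_eq_norm_sq, L2.inner_def]
  refine integral_congr_ae ?_
  filter_upwards [polyToL2_coeFn f] with x hx
  rw [hx]
  simp [sq]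

/-- A polynomial that vanishes almost everywhere on a ball vanishes on it by continuity, and then
everywhere by analyticity. -/
theorem polyToL2_injective (m k : ℕ) : Function.Injective (polyToL2 m k) := by
  rw [injective_iff_map_eq_zero]
  intro f hf
  have h1 := polyToL2_coeFn f
  rw [hf] at h1
  have h2 : f.1 =ᵐ[(volume : Measure (Eu m)).restrict (Metric.ball 0 (1 / 2))] fun _ => 0 :=
    h1.symm.trans (Lp.coeFn_zero ..)
  have h3 := Measure.eqOn_open_of_ae_eq h2 Metric.isOpen_ball
    (polySpace_contDiff f.2).continuous.continuousOn continuousOn_const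
  have h4 : f.1 =ᶠ[𝓝 0] fun _ => 0 := by
    filter_upwards [Metric.ball_mem_nhds (0 : Eu m) (by norm_num : (0 : ℝ) < 1 / 2)] with x hx
    exact h3 hx
  have h5 := (polySpace_analytic f.2).eq_of_eventuallyEq analyticOnNhd_const h4
  ext x
  rw [h5]
  rfl

/-- Restriction of polynomial functions to a closed ball, as a continuous function. -/
noncomputable def polyToC (m k : ℕ) (M : ℝ) :
    polySpace m k →ₗ[ℝ] C(Metric.closedBall (0 : Eu m) M, ℝ) where
  toFun f := ⟨fun x => f.1 x, (polySpace_contDiff f.2).continuous.comp continuous_subtype_val⟩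
  map_add' _ _ := rfl
  map_smul' _ _ := rfl

/-- Differentiation of polynomial functions. -/
noncomputable def polyPd (m k : ℕ) (j : Fin m) : polySpace m k →ₗ[ℝ] polySpace m k where
  toFun f := ⟨pd j f.1, pd_mem_polySpace f.2 j⟩
  map_add' f g := by
    ext x
    exact pd_add ((polySpace_contDiff f.2).differentiable (by simp) x)
      ((polySpace_contDiff g.2).differentiable (by simp) x) j
  map_smul' c f := by
    ext x
    exact pd_const_mul ((polySpace_contDiff f.2).differentiable (by simp) x) c j

/-- All norms on the finite dimensional polynomial space are comparable. The reference norm lives on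
the ball of radius 1/2, where the cutoffs equal 1, while M lets the estimate reach points far
outside it. -/
theorem exists_poly_bound_unit (m k : ℕ) (M : ℝ) : ∃ C : ℝ, 0 < C ∧ ∀ f ∈ polySpace m k,
    ∀ x ∈ Metric.closedBall (0 : Eu m) M,
      f x ^ 2 ≤ C * ∫ y in Metric.ball (0 : Eu m) (1 / 2), f y ^ 2 ∧
      ∀ j, pd j f x ^ 2 ≤ C * ∫ y in Metric.ball (0 : Eu m) (1 / 2), f y ^ 2 := by
  have key : ∀ T : polySpace m k →ₗ[ℝ] polySpace m k, ∃ C : ℝ, 0 < C ∧ ∀ f : polySpace m k,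
      ∀ x ∈ Metric.closedBall (0 : Eu m) M,
      (T f).1 x ^ 2 ≤ C * ∫ y in Metric.ball (0 : Eu m) (1 / 2), f.1 y ^ 2 := by
    intro T
    obtain ⟨C, hC, h⟩ := exists_norm_le_of_ker_eq_bot (polyToL2 m k) (polyToL2_injective m k)
      (polyToC m k M ∘ₗ T)
    refine ⟨C ^ 2, by positivity, fun f x hx => ?_⟩
    have h1 : ‖(T f).1 x‖ ≤ C * ‖polyToL2 m k f‖ :=
      ((polyToC m k M (T f)).norm_coe_le_norm ⟨x, hx⟩).trans (h f)
    rw [← norm_sq_polyToL2, ← mul_pow, ← sq_abs]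
    exact pow_le_pow_left₀ (abs_nonneg _) h1 2
  obtain ⟨C₀, hC₀, h₀⟩ := key LinearMap.id
  choose C₁ hC₁ h₁ using fun j => key (polyPd m k j)
  refine ⟨C₀ + ∑ j, C₁ j, add_pos_of_pos_of_nonneg hC₀ (Finset.sum_nonneg fun j _ => (hC₁ j).le),
    fun f hf x hx => ?_⟩
  have hI : 0 ≤ ∫ y in Metric.ball (0 : Eu m) (1 / 2), f y ^ 2 :=
    integral_nonneg fun y => sq_nonneg _
  refine ⟨(h₀ ⟨f, hf⟩ x hx).trans (mul_le_mul_of_nonneg_right ?_ hI), fun j =>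
    (h₁ j ⟨f, hf⟩ x hx).trans (mul_le_mul_of_nonneg_right ?_ hI)⟩
  · exact le_add_of_nonneg_right (Finset.sum_nonneg fun j _ => (hC₁ j).le)
  · have := Finset.single_le_sum (fun i _ => (hC₁ i).le) (Finset.mem_univ j)
    linarith

open scoped Pointwise in
/-- Inverse estimates for polynomial functions on balls. -/
theorem exists_poly_bound (m k : ℕ) (M : ℝ) : ∃ C : ℝ, 0 < C ∧ ∀ f ∈ polySpace m k,
    ∀ (y : Eu m) (ρ : ℝ), 0 < ρ → ∀ x ∈ Metric.closedBall y (M * ρ),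
      ρ ^ m * f x ^ 2 ≤ C * ∫ w in Metric.ball y (ρ / 2), f w ^ 2 ∧
      ∀ j, ρ ^ m * (ρ * pd j f x) ^ 2 ≤ C * ∫ w in Metric.ball y (ρ / 2), f w ^ 2 := by
  obtain ⟨C, hC, h⟩ := exists_poly_bound_unit m k M
  refine ⟨C, hC, fun f hf y ρ hρ x hx => ?_⟩
  -- Substituting w ↦ ρ w + y reduces to the reference ball; the integral produces ρ^m and every
  -- derivative a factor ρ.
  let A : Eu m →ᵃ[ℝ] Eu m := (ρ • (LinearMap.id : Eu m →ₗ[ℝ] Eu m)).toAffineMap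
    + AffineMap.const ℝ (Eu m) y
  have hA : ∀ w, A w = ρ • w + y := fun w => by simp [A]
  have hg := comp_affine_mem_polySpace hf A
  set g : Eu m → ℝ := fun w => f (A w) with hgdef
  have hint : ∫ w in Metric.ball y (ρ / 2), f w ^ 2
      = ρ ^ m * ∫ w in Metric.ball (0 : Eu m) (1 / 2), g w ^ 2 := by
    have h1 := (measurePreserving_add_right (volume : Measure (Eu m)) y).setIntegral_preimage_emb
      (MeasurableEquiv.addRight y).measurableEmbedding (fun w => f w ^ 2) (Metric.ball y (ρ / 2))
    have h2 := Measure.setIntegral_comp_smul_of_pos (volume : Measure (Eu m))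
      (fun w => f (w + y) ^ 2) (Metric.ball (0 : Eu m) (1 / 2)) hρ
    have h3 : (fun w => w + y) ⁻¹' Metric.ball y (ρ / 2) = Metric.ball 0 (ρ / 2) := by
      ext w
      simp
    have h4 : ρ • Metric.ball (0 : Eu m) (1 / 2) = Metric.ball 0 (ρ / 2) := by
      rw [smul_ball hρ.ne', smul_zero, Real.norm_of_nonneg hρ.le]
      congr 1
      ring
    rw [h3] at h1
    rw [h4, h1, finrank_euclideanSpace, Fintype.card_fin, smul_eq_mul] at h2
    simp only [hgdef, hA]
    rw [h2]
    field_simp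
  set x' : Eu m := ρ⁻¹ • (x - y) with hx'
  have hAx : A x' = x := by
    rw [hA, hx', smul_smul, mul_inv_cancel₀ hρ.ne', one_smul, sub_add_cancel]
  have hx'M : x' ∈ Metric.closedBall (0 : Eu m) M := by
    rw [Metric.mem_closedBall, dist_eq_norm] at hx
    rw [mem_closedBall_zero_iff, hx', norm_smul, norm_inv, Real.norm_of_nonneg hρ.le,
      inv_mul_le_iff₀ hρ]
    linarith
  obtain ⟨h1, h2⟩ := h g hg x' hx'M
  have hgx : g x' = f x := by rw [hgdef]; simp only [hAx]
  have hpd : ∀ j, pd j g x' = ρ * pd j f x := by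
    intro j
    have hf' : HasFDerivAt f (fderiv ℝ f (A x')) (A x') :=
      ((polySpace_contDiff hf).differentiable (by simp) _).hasFDerivAt
    have hA' : HasFDerivAt A (ρ • ContinuousLinearMap.id ℝ (Eu m)) x' := by
      have e : (A : Eu m → Eu m) = fun w => ρ • w + y := funext hA
      rw [e]
      exact ((hasFDerivAt_id x').const_smul ρ).add_const y
    have := hf'.comp x' hA'
    rw [pd, show g = f ∘ A from rfl, this.fderiv, hAx]
    simp [pd]
  rw [hint]
  have hρm : 0 < ρ ^ m := by positivity
  refine ⟨?_, fun j => ?_⟩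
  · rw [hgx] at h1
    calc _ ≤ ρ ^ m * _ := mul_le_mul_of_nonneg_left h1 hρm.le
      _ = _ := by ring
  · have h3 := h2 j
    rw [hpd] at h3
    calc _ ≤ ρ ^ m * _ := mul_le_mul_of_nonneg_left h3 hρm.le
      _ = _ := by ring

end NormEquivalence

/-! ### The divergence theorem on a half space -/

section HalfSpace

variable {m : ℕ}

/-- Orthonormal coordinates adapted to a hyperplane with unit normal `n`. -/
theorem exists_hyperplane_isometry {n : Eu (m + 1)} (hn : ‖n‖ = 1) :
    ∃ ι : Eu m →ₗᵢ[ℝ] Eu (m + 1), (∀ w, inner ℝ n (ι w) = 0) ∧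
      (∀ x, inner ℝ n x = 0 → ∃ w, ι w = x) ∧
      ∀ y, MeasurePreserving (fun q : ℝ × Eu m => y + (q.1 • n + ι q.2)) := by
  have hne : n ≠ 0 := by
    rintro rfl
    simp at hn
  have : Fact (Module.finrank ℝ (Eu (m + 1)) = m + 1) := ⟨by simp⟩
  let s : Submodule ℝ (Eu (m + 1)) := Submodule.span ℝ {n}
  let e₁ : ℝ ≃ₗᵢ[ℝ] s := LinearIsometryEquiv.toSpanUnitSingleton n hn
  let e₂ : Eu m ≃ₗᵢ[ℝ] sᗮ :=
    (OrthonormalBasis.fromOrthogonalSpanSingleton (𝕜 := ℝ) m hne).repr.symm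
  refine ⟨sᗮ.subtypeₗᵢ.comp e₂.toLinearIsometry, fun w => ?_, fun x hx => ?_, fun y => ?_⟩
  · exact Submodule.mem_orthogonal_singleton_iff_inner_right.1 (e₂ w).2
  · have hx' : x ∈ sᗮ := Submodule.mem_orthogonal_singleton_iff_inner_right.2 hx
    exact ⟨e₂.symm ⟨x, hx'⟩, by simp⟩
  · have h := (s.measurePreserving_measurableEquivProd y).symm
    rw [InnerProductSpace.euclideanHausdorffMeasure_eq_volume] at h
    have h2 := h.comp (e₁.measurePreserving.prod e₂.measurePreserving)
    have h3 : (fun q : ℝ × Eu m => y + (q.1 • n + (sᗮ.subtypeₗᵢ.comp e₂.toLinearIsometry) q.2))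
        = (s.measurableEquivProd y).symm ∘ Prod.map e₁ e₂ := by
      funext q
      simp [e₁, add_comm, s]
    rw [h3, Measure.volume_eq_prod]
    exact h2

/-- The open half space `{x | 0 < n · (x - y)}`. -/
def halfSpace (y n : Eu m) : Set (Eu m) := {x | 0 < inner ℝ n (x - y)}

theorem isOpen_halfSpace (y n : Eu m) : IsOpen (halfSpace y n) :=
  isOpen_lt continuous_const (by fun_prop)

theorem measurableEmbedding_hyperplane_coords {n : Eu (m + 1)} (hn : ‖n‖ = 1)
    {ι : Eu m →ₗᵢ[ℝ] Eu (m + 1)} (hι : ∀ w, inner ℝ n (ι w) = 0) (y : Eu (m + 1)) :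
    MeasurableEmbedding (fun q : ℝ × Eu m => y + (q.1 • n + ι q.2)) := by
  refine Continuous.measurableEmbedding ?_ ?_
  · exact continuous_const.add ((continuous_fst.smul continuous_const).add
      (ι.continuous.comp continuous_snd))
  · rintro ⟨t, w⟩ ⟨t', w'⟩ h
    have h1 : t • n + ι w = t' • n + ι w' := add_left_cancel h
    have h2 := congrArg (inner ℝ n) h1
    simp only [inner_add_right, inner_smul_right, hι, real_inner_self_eq_norm_sq, hn] at h2
    have h3 : t = t' := by linarith
    subst h3
    exact Prod.ext rfl (ι.injective (add_left_cancel h1))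

theorem setIntegral_halfSpace {n : Eu (m + 1)} (hn : ‖n‖ = 1)
    {ι : Eu m →ₗᵢ[ℝ] Eu (m + 1)} (hι : ∀ w, inner ℝ n (ι w) = 0) {y : Eu (m + 1)}
    (hmp : MeasurePreserving (fun q : ℝ × Eu m => y + (q.1 • n + ι q.2)))
    (g : Eu (m + 1) → ℝ) :
    ∫ x in halfSpace y n, g x
      = ∫ q, g (y + (q.1 • n + ι q.2))
          ∂((volume.restrict (Set.Ioi (0 : ℝ))).prod (volume : Measure (Eu m))) := by
  rw [← hmp.setIntegral_preimage_emb (measurableEmbedding_hyperplane_coords hn hι y)]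
  have : (fun q : ℝ × Eu m => y + (q.1 • n + ι q.2)) ⁻¹' halfSpace y n
      = Set.Ioi 0 ×ˢ Set.univ := by
    ext q
    simp [halfSpace, inner_add_right, inner_smul_right, hι, hn]
  rw [this, Measure.volume_eq_prod, ← Measure.prod_restrict, Measure.restrict_univ]

/-- The divergence theorem on a half space. -/
theorem setIntegral_halfSpace_fderiv {n : Eu (m + 1)} (hn : ‖n‖ = 1)
    {ι : Eu m →ₗᵢ[ℝ] Eu (m + 1)} (hι : ∀ w, inner ℝ n (ι w) = 0)
    (hsurj : ∀ x, inner ℝ n x = 0 → ∃ w, ι w = x) {y : Eu (m + 1)}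
    (hmp : MeasurePreserving (fun q : ℝ × Eu m => y + (q.1 • n + ι q.2)))
    {f : Eu (m + 1) → ℝ} (hf : ContDiff ℝ ∞ f) (hfc : HasCompactSupport f) (e : Eu (m + 1)) :
    ∫ x in halfSpace y n, fderiv ℝ f x e = - (inner ℝ n e * ∫ w, f (y + ι w)) := by
  -- The direction e is split into a normal and a tangential part. The normal derivative is
  -- integrated along the rays with direction n and leaves the boundary value; the tangential one
  -- integrates to zero on every parallel hyperplane.
  obtain ⟨w₀, hw₀⟩ := hsurj (e - inner ℝ n e • n) (by
    rw [inner_sub_right, inner_smul_right, real_inner_self_eq_norm_sq, hn]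
    ring)
  have he : e = inner ℝ n e • n + ι w₀ := by rw [hw₀]; abel
  have hint : ∀ e : Eu (m + 1), Integrable (fun x => fderiv ℝ f x e) := fun e =>
    ((hf.continuous_fderiv (by simp)).clm_apply continuous_const).integrable_of_hasCompactSupport
      (hfc.fderiv_apply ℝ e)
  have hΦ : Continuous (fun q : ℝ × Eu m => y + (q.1 • n + ι q.2)) :=
    continuous_const.add ((continuous_fst.smul continuous_const).add
      (ι.continuous.comp continuous_snd))
  have hint2 : ∀ e : Eu (m + 1), Integrable
      (fun q : ℝ × Eu m => fderiv ℝ f (y + (q.1 • n + ι q.2)) e)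
      ((volume.restrict (Set.Ioi (0 : ℝ))).prod (volume : Measure (Eu m))) := fun e => by
    have h1 : Integrable (fun q : ℝ × Eu m => fderiv ℝ f (y + (q.1 • n + ι q.2)) e) :=
      (hmp.integrable_comp_emb (measurableEmbedding_hyperplane_coords hn hι y)).2 (hint e)
    rw [Measure.volume_eq_prod] at h1
    have := h1.restrict (s := Set.Ioi 0 ×ˢ Set.univ)
    rwa [← Measure.prod_restrict, Measure.restrict_univ] at this
  have hd : Differentiable ℝ f := hf.differentiable (by simp)
  have hnormal : ∫ x in halfSpace y n, fderiv ℝ f x n = - ∫ w, f (y + ι w) := by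
    rw [setIntegral_halfSpace hn hι hmp, integral_prod_symm _ (hint2 n), ← integral_neg]
    refine integral_congr_ae (Eventually.of_forall fun w => ?_)
    have hder : ∀ t : ℝ, HasDerivAt (fun t : ℝ => f (y + (t • n + ι w)))
        (fderiv ℝ f (y + (t • n + ι w)) n) t := fun t => by
      have h1 : HasDerivAt (fun t : ℝ => y + (t • n + ι w)) n t := by
        have := (((hasDerivAt_id t).smul_const n).add_const (ι w)).const_add y
        simpa using! this
      exact (hd _).hasFDerivAt.comp_hasDerivAt t h1
    have hcl : Topology.IsClosedEmbedding (fun t : ℝ => y + (t • n + ι w)) := by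
      refine Isometry.isClosedEmbedding (Isometry.of_dist_eq fun a b => ?_)
      rw [dist_add_left, dist_add_right, dist_eq_norm, ← sub_smul, norm_smul, hn, mul_one,
        Real.dist_eq, Real.norm_eq_abs]
    have hsm : ContDiff ℝ 1 (fun t : ℝ => f (y + (t • n + ι w))) :=
      (hf.of_le (by simp)).comp (contDiff_const.add ((contDiff_id.smul contDiff_const).add
        contDiff_const))
    have := (hfc.comp_isClosedEmbedding hcl).integral_Ioi_deriv_eq hsm 0
    have h2 : deriv (fun t : ℝ => f (y + (t • n + ι w)))
        = fun t => fderiv ℝ f (y + (t • n + ι w)) n := funext fun t => (hder t).deriv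
    change ∫ x in Set.Ioi 0, deriv (fun t : ℝ => f (y + (t • n + ι w))) x
      = - f (y + ((0 : ℝ) • n + ι w)) at this
    rw [h2, zero_smul, zero_add] at this
    exact this
  have htan : ∫ x in halfSpace y n, fderiv ℝ f x (ι w₀) = 0 := by
    rw [setIntegral_halfSpace hn hι hmp, integral_prod _ (hint2 _)]
    refine integral_eq_zero_of_ae (Eventually.of_forall fun t => ?_)
    have hι' : ∀ w, HasFDerivAt (fun w => y + (t • n + ι w)) ι.toContinuousLinearMap w := fun w =>
      (ι.toContinuousLinearMap.hasFDerivAt.const_add (t • n)).const_add y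
    have hder : ∀ w, HasFDerivAt (fun w => f (y + (t • n + ι w)))
        ((fderiv ℝ f (y + (t • n + ι w))).comp ι.toContinuousLinearMap) w := fun w =>
      (hd _).hasFDerivAt.comp w (hι' w)
    have hcl : Topology.IsClosedEmbedding (fun w : Eu m => y + (t • n + ι w)) := by
      refine Isometry.isClosedEmbedding (Isometry.of_dist_eq fun a b => ?_)
      rw [dist_add_left, dist_add_left, ι.dist_map]
    have hsm : ContDiff ℝ 1 (fun w : Eu m => f (y + (t • n + ι w))) :=
      (hf.of_le (by simp)).comp (contDiff_const.add (contDiff_const.add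
        ι.toContinuousLinearMap.contDiff))
    have hcs : HasCompactSupport (fun w : Eu m => f (y + (t • n + ι w))) :=
      hfc.comp_isClosedEmbedding hcl
    have hi1 : Integrable (fun w : Eu m => f (y + (t • n + ι w))) :=
      hsm.continuous.integrable_of_hasCompactSupport hcs
    have hi2 : Integrable (fun w : Eu m => fderiv ℝ (fun w => f (y + (t • n + ι w))) w w₀) :=
      ((hsm.continuous_fderiv (by simp)).clm_apply continuous_const
        ).integrable_of_hasCompactSupport (hcs.fderiv_apply ℝ w₀)
    -- Integration by parts against the constant 1 shows that the derivative of a compactly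
    -- supported function has integral zero.
    have := integral_mul_fderiv_eq_neg_fderiv_mul_of_integrable (μ := (volume : Measure (Eu m)))
      (f := fun _ : Eu m => (1 : ℝ))
      (g := fun w : Eu m => f (y + (t • n + ι w))) (v := w₀) (by simp)
      (by simpa using hi2) (by simpa using hi1) (fun _ _ => differentiableAt_const _)
      (fun x _ => hsm.differentiable (by simp) x)
    simp only [one_mul, fderiv_fun_const, Pi.zero_apply, zero_apply, zero_mul,
      integral_zero, neg_zero] at this
    rw [Pi.zero_apply, ← this]
    refine integral_congr_ae (Eventually.of_forall fun w => ?_)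
    simp only [(hder w).fderiv]
    rfl
  have hsplit : ∀ x, fderiv ℝ f x e
      = inner ℝ n e * fderiv ℝ f x n + fderiv ℝ f x (ι w₀) := fun x => by
    conv_lhs => rw [he, map_add, map_smul, smul_eq_mul]
  rw [integral_congr_ae (Eventually.of_forall hsplit),
    integral_add ((hint n).integrableOn.const_mul _) (hint _).integrableOn, integral_const_mul,
    hnormal, htan]
  ring

end HalfSpace

/-! ### Cutoffs and the residual of an approximate solution -/

section LocalTesting

variable {d : ℕ} {Ω : Set (Eu d)} {z F : Eu d} {α : ℝ} {u : Eu d → Eu d}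
  {Du : Eu d → Matrix (Fin d) (Fin d) ℝ} {p : Eu d → ℝ}

/-- All cutoffs are dilates and translates of one bump, so the constant in the derivative bound is
the same for every ball. -/
theorem exists_cutoff (d : ℕ) : ∃ C : ℝ, 0 < C ∧ ∀ (y : Eu d) (ρ : ℝ), 0 < ρ →
    ∃ η : Eu d → ℝ, IsTest (Metric.ball y ρ) η ∧ (∀ x, 0 ≤ η x ∧ η x ≤ 1) ∧
      (∀ x ∈ Metric.ball y (ρ / 2), η x = 1) ∧ ∀ j x, |pd j η x| ≤ C / ρ := by
  let φ : ContDiffBump (0 : Eu d) := ⟨1 / 2, 3 / 4, by norm_num, by norm_num⟩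
  have hφ : ContDiff ℝ ∞ φ := φ.contDiff
  obtain ⟨M, hM⟩ : ∃ M : ℝ, ∀ x, ‖fderiv ℝ φ x‖ ≤ M :=
    (φ.hasCompactSupport.fderiv (𝕜 := ℝ)).exists_bound_of_continuous
      (hφ.continuous_fderiv (by simp))
  have hM0 : 0 ≤ M := (norm_nonneg _).trans (hM 0)
  refine ⟨M + 1, by positivity, fun y ρ hρ => ?_⟩
  have hA : ContDiff ℝ ∞ (fun x : Eu d => ρ⁻¹ • (x - y)) :=
    (contDiff_id.sub contDiff_const).const_smul ρ⁻¹
  have hsupp : Function.support (fun x => φ (ρ⁻¹ • (x - y)))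
      ⊆ Metric.closedBall y (3 / 4 * ρ) := fun x hx => by
    have h1 : ρ⁻¹ • (x - y) ∈ Function.support φ := hx
    rw [φ.support_eq, mem_ball_zero_iff, norm_smul, norm_inv, Real.norm_of_nonneg hρ.le,
      inv_mul_lt_iff₀ hρ] at h1
    rw [Metric.mem_closedBall, dist_eq_norm]
    change _ < ρ * (3 / 4) at h1
    linarith
  have hts : tsupport (fun x => φ (ρ⁻¹ • (x - y))) ⊆ Metric.closedBall y (3 / 4 * ρ) :=
    closure_minimal hsupp Metric.isClosed_closedBall
  refine ⟨fun x => φ (ρ⁻¹ • (x - y)), ⟨hφ.comp hA, ?_, hts.trans ?_⟩,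
    fun x => ⟨φ.nonneg, φ.le_one⟩, fun x hx => φ.one_of_mem_closedBall ?_, fun j x => ?_⟩
  · exact HasCompactSupport.of_support_subset_isCompact (isCompact_closedBall _ _) hsupp
  · exact Metric.closedBall_subset_ball (by linarith)
  · rw [Metric.mem_ball, dist_eq_norm] at hx
    rw [mem_closedBall_zero_iff, norm_smul, norm_inv, Real.norm_of_nonneg hρ.le,
      inv_mul_le_iff₀ hρ]
    change _ ≤ ρ * (1 / 2)
    linarith
  · have h1 : HasFDerivAt (fun x : Eu d => ρ⁻¹ • (x - y))
        (ρ⁻¹ • ContinuousLinearMap.id ℝ (Eu d)) x :=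
      ((hasFDerivAt_id x).sub_const y).const_smul ρ⁻¹
    have h2 := (hφ.differentiable (by simp) (ρ⁻¹ • (x - y))).hasFDerivAt.comp x h1
    have h3 : pd j (fun x => φ (ρ⁻¹ • (x - y))) x = ρ⁻¹ * pd j φ (ρ⁻¹ • (x - y)) := by
      rw [pd, show (fun x => φ (ρ⁻¹ • (x - y))) = φ ∘ fun x => ρ⁻¹ • (x - y) from rfl, h2.fderiv]
      simp [pd]
    rw [h3, abs_mul, abs_of_pos (inv_pos.2 hρ), inv_mul_eq_div]
    gcongr
    exact ((abs_pd_le j _ _).trans (hM _)).trans (by linarith)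

/-- The squared error of `(G, q)` as an approximation of `(Du, p)`. -/
noncomputable def errDensity (Du G : Eu d → Matrix (Fin d) (Fin d) ℝ) (p q : Eu d → ℝ)
    (x : Eu d) : ℝ :=
  frob (Du x - G x) (Du x - G x) + (p x - q x) ^ 2

theorem errDensity_nonneg (Du G : Eu d → Matrix (Fin d) (Fin d) ℝ) (p q : Eu d → ℝ)
    (x : Eu d) : 0 ≤ errDensity Du G p q x :=
  add_nonneg (frob_self_nonneg _) (sq_nonneg _)

/-- Testing the residual of a discrete approximation with a bump function. -/
theorem IsStokesSolution.abs_residual_le [NeZero d] (h : IsStokesSolution Ω z α F u Du p)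
    (hα : α < d) (hΩ : Bornology.IsBounded Ω) {B : Set (Eu d)}
    (hBv : volume B ≠ ⊤) (hBΩ : B ⊆ Ω)
    (hz : z ∉ B) {G : Eu d → Matrix (Fin d) (Fin d) ℝ} {q : Eu d → ℝ}
    (hG : ∀ i j, IntegrableOn (fun x => G x i j) B) (hq : IntegrableOn q B)
    (hE : IntegrableOn (errDensity Du G p q) B) {ψ : Eu d → ℝ} (hψ : IsTest B ψ) {b : ℝ}
    (hb : ∀ x j, pd j ψ x ^ 2 ≤ b) {ε : ℝ} (hε : 0 < ε) (i : Fin d) :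
    |∫ x, (∑ j, G x i j * pd j ψ x - q x * pd i ψ x)|
      ≤ (∫ x in B, errDensity Du G p q x) / ε + ε * ((d + 1) * b * volume.real B) := by
  have hψΩ := hψ.mono hBΩ
  have hb0 : 0 ≤ b := (sq_nonneg _).trans (hb 0 i)
  have h1 := h.momentum_comp hα hΩ hψΩ i
  rw [hψ.eq_zero hz, mul_zero, add_zero] at h1
  have hi1 : ∀ j, Integrable (fun x => Du x i j * pd j ψ x) := fun j =>
    integrable_mul_test (h.mem_u.1.grad i j).1 (hψΩ.pd j)
  have hi2 : Integrable (fun x => p x * pd i ψ x) := integrable_mul_test h.mem_p.1 (hψΩ.pd i)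
  have hi3 : ∀ j, Integrable (fun x => G x i j * pd j ψ x) := fun j =>
    integrable_mul_test (hG i j).locallyIntegrableOn (hψ.pd j)
  have hi4 : Integrable (fun x => q x * pd i ψ x) :=
    integrable_mul_test hq.locallyIntegrableOn (hψ.pd i)
  have hI1 : Integrable (fun x => ∑ j, G x i j * pd j ψ x - q x * pd i ψ x) :=
    (integrable_finsetSum _ fun j _ => hi3 j).sub hi4
  have hI2 : Integrable (fun x => ∑ j, Du x i j * pd j ψ x - p x * pd i ψ x) :=
    (integrable_finsetSum _ fun j _ => hi1 j).sub hi2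
  have h0 : ∫ x, (∑ j, Du x i j * pd j ψ x - p x * pd i ψ x) = 0 := by
    rw [integral_sub (integrable_finsetSum _ fun j _ => hi1 j) hi2,
      integral_finsetSum _ fun j _ => hi1 j, h1, sub_self]
  -- Because ψ z = 0, the exact pair satisfies the equation without source, and the residual of the
  -- approximation is that of the error with the opposite sign.
  have h2 : ∫ x, (∑ j, G x i j * pd j ψ x - q x * pd i ψ x)
      = - ∫ x, (∑ j, (Du x i j - G x i j) * pd j ψ x - (p x - q x) * pd i ψ x) := by
    have h5 := integral_sub hI2 hI1
    rw [h0, zero_sub] at h5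
    rw [← neg_eq_iff_eq_neg, ← h5]
    refine integral_congr_ae (Eventually.of_forall fun x => ?_)
    simp only [sub_mul, Finset.sum_sub_distrib]
    ring
  have hsupp : ∀ x ∉ B, ∑ j, (Du x i j - G x i j) * pd j ψ x - (p x - q x) * pd i ψ x = 0 := by
    intro x hx
    have : ∀ j, pd j ψ x = 0 := fun j => (hψ.pd j).eq_zero hx
    simp [this]
  rw [h2, abs_neg, ← setIntegral_eq_integral_of_forall_compl_eq_zero hsupp]
  have h3 : ∀ x, |∑ j, (Du x i j - G x i j) * pd j ψ x - (p x - q x) * pd i ψ x|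
      ≤ errDensity Du G p q x / ε + ε * ((d + 1) * b) := by
    intro x
    -- Young's inequality with ε left free: it is chosen later so that the second term can be
    -- absorbed.
    have hy : ∀ (s : ℝ) (j : Fin d), |s * pd j ψ x| ≤ s ^ 2 / ε + ε * b := by
      intro s j
      have e1 : |s * pd j ψ x| ≤ s ^ 2 / ε + ε * pd j ψ x ^ 2 := by
        rw [div_add' _ _ _ hε.ne', le_div_iff₀ hε, abs_mul, ← sq_abs s, ← sq_abs (pd j ψ x)]
        nlinarith [sq_nonneg (|s| - ε * |pd j ψ x|),
          mul_nonneg (mul_nonneg hε.le (abs_nonneg s)) (abs_nonneg (pd j ψ x))]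
      exact e1.trans (by gcongr; exact hb x j)
    have e2 : ∑ j, (Du x i j - G x i j) ^ 2 ≤ frob (Du x - G x) (Du x - G x) := by
      rw [frob_self]
      exact Finset.single_le_sum (f := fun i => ∑ j, (Du x - G x) i j ^ 2)
        (fun i _ => Finset.sum_nonneg fun j _ => sq_nonneg _) (Finset.mem_univ i)
    calc _ ≤ |∑ j, (Du x i j - G x i j) * pd j ψ x| + |(p x - q x) * pd i ψ x| := abs_sub _ _
      _ ≤ ∑ j, ((Du x i j - G x i j) ^ 2 / ε + ε * b) + ((p x - q x) ^ 2 / ε + ε * b) :=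
        add_le_add ((Finset.abs_sum_le_sum_abs _ _).trans (Finset.sum_le_sum fun j _ => hy _ j))
          (hy _ i)
      _ = (∑ j, (Du x i j - G x i j) ^ 2 + (p x - q x) ^ 2) / ε + ε * ((d + 1) * b) := by
        rw [Finset.sum_add_distrib, ← Finset.sum_div]
        simp only [Finset.sum_const, Finset.card_univ, Fintype.card_fin, nsmul_eq_mul]
        ring
      _ ≤ _ := by
        rw [errDensity]
        gcongr
  have hc : IntegrableOn (fun _ : Eu d => ε * ((d + 1) * b)) B := integrableOn_const hBv
  calc _ ≤ ∫ x in B, |∑ j, (Du x i j - G x i j) * pd j ψ x - (p x - q x) * pd i ψ x| :=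
        abs_integral_le_integral_abs
    _ ≤ ∫ x in B, (errDensity Du G p q x / ε + ε * ((d + 1) * b)) :=
        integral_mono_of_nonneg (Eventually.of_forall fun x => abs_nonneg _)
          ((hE.div_const ε).add hc) (Eventually.of_forall h3)
    _ = _ := by
        rw [integral_add (hE.div_const ε) hc, integral_div, setIntegral_const, smul_eq_mul]
        ring

end LocalTesting

/-! ### The element residual -/

section InteriorResidual

variable {d : ℕ} {Ω : Set (Eu d)} {z F : Eu d} {α : ℝ} {u : Eu d → Eu d}
  {Du : Eu d → Matrix (Fin d) (Fin d) ℝ} {p : Eu d → ℝ}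

/-- The `i`-th component of `ΔU - ∇P`. -/
noncomputable def residual (U : Fin d → Eu d → ℝ) (P : Eu d → ℝ) (i : Fin d) (x : Eu d) : ℝ :=
  lap (U i) x - pd i P x

theorem residual_mem_polySpace {k : ℕ} {U : Fin d → Eu d → ℝ} {P : Eu d → ℝ}
    (hU : ∀ i, U i ∈ polySpace d k) (hP : P ∈ polySpace d k) (i : Fin d) :
    residual U P i ∈ polySpace d k := by
  have : residual U P i = ∑ j, pd j (pd j (U i)) - pd i P := by
    funext x
    simp [residual, lap]
  rw [this]
  exact Submodule.sub_mem _ (Submodule.sum_mem _ fun j _ =>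
    pd_mem_polySpace (pd_mem_polySpace (hU i) j) j) (pd_mem_polySpace hP i)

theorem volume_real_ball (y : Eu d) {ρ : ℝ} (hρ : 0 < ρ) :
    (volume : Measure (Eu d)).real (Metric.ball y ρ)
      = ρ ^ d * (volume : Measure (Eu d)).real (Metric.ball 0 1) := by
  rw [measureReal_def, Measure.addHaar_ball_of_pos _ _ hρ, ENNReal.toReal_mul,
    ENNReal.toReal_ofReal (by positivity), finrank_euclideanSpace, Fintype.card_fin,
    measureReal_def]

theorem integrableOn_ball_of_ae_eq {f g : Eu d → ℝ} {y : Eu d} {ρ : ℝ} (hg : Continuous g)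
    (h : ∀ᵐ x, x ∈ Metric.ball y ρ → f x = g x) : IntegrableOn f (Metric.ball y ρ) := by
  have h1 : IntegrableOn g (Metric.ball y ρ) :=
    (hg.continuousOn.integrableOn_compact (isCompact_closedBall y ρ)).mono_set
      Metric.ball_subset_closedBall
  refine h1.congr ?_
  filter_upwards [ae_restrict_of_ae h, ae_restrict_mem Metric.isOpen_ball.measurableSet] with x hx h'
  exact (hx h').symm

/-- A polynomial is controlled on a ball by its integral against a cutoff. -/
theorem setIntegral_sq_le_of_cutoff {f η : Eu d → ℝ} {y : Eu d} {ρ : ℝ}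
    (hf : Continuous f) (hηc : Continuous η) (hη : HasCompactSupport η)
    (hη0 : ∀ x, 0 ≤ η x) (hη1 : ∀ x ∈ Metric.ball y (ρ / 2), η x = 1) :
    ∫ x in Metric.ball y (ρ / 2), f x ^ 2 ≤ ∫ x, η x * f x ^ 2 := by
  have hi : Integrable (fun x => η x * f x ^ 2) :=
    (hηc.mul (hf.pow 2)).integrable_of_hasCompactSupport hη.mul_right
  rw [setIntegral_congr_fun (g := fun x => η x * f x ^ 2) Metric.isOpen_ball.measurableSet
    fun x hx => by simp [hη1 x hx]]
  exact setIntegral_le_integral hi (Eventually.of_forall fun x =>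
    mul_nonneg (hη0 x) (sq_nonneg _))

/-- Both terms of the product rule scale like 1/ρ: the cutoff by construction, the polynomial by the
inverse estimate that supplies the bound S. -/
theorem sq_pd_mul_le {η f : Eu d → ℝ} {x : Eu d} {K ρ S : ℝ} (hρ : 0 < ρ)
    (hη : DifferentiableAt ℝ η x) (hf : DifferentiableAt ℝ f x) (h0 : 0 ≤ η x) (h1 : η x ≤ 1)
    {j : Fin d} (hηj : |pd j η x| ≤ K / ρ) (hfS : f x ^ 2 ≤ S) (hfj : (ρ * pd j f x) ^ 2 ≤ S) :
    pd j (fun x => f x * η x) x ^ 2 ≤ 2 * (K ^ 2 + 1) * S / ρ ^ 2 := by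
  rw [pd_mul hf hη, le_div_iff₀ (by positivity)]
  have e1 : (ρ * pd j η x) ^ 2 ≤ K ^ 2 := by
    rw [← sq_abs, abs_mul, abs_of_pos hρ]
    refine pow_le_pow_left₀ (by positivity) ?_ 2
    rwa [← le_div_iff₀' hρ]
  have hS : 0 ≤ S := (sq_nonneg _).trans hfS
  have e2 : (ρ * pd j f x * η x) ^ 2 ≤ S := by
    rw [mul_pow]
    calc _ ≤ S * 1 := by
          gcongr
          exact pow_le_one₀ h0 h1
      _ = S := mul_one _
  have e3 : (f x * (ρ * pd j η x)) ^ 2 ≤ S * K ^ 2 := by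
    rw [mul_pow]
    gcongr
  nlinarith [sq_nonneg (ρ * pd j f x * η x - f x * (ρ * pd j η x))]

/-- Lower bound of the local error by the element residual. -/
theorem exists_interior_residual_bound (d k : ℕ) [NeZero d] (M : ℝ) : ∃ C : ℝ, 0 < C ∧
    ∀ {Ω : Set (Eu d)} {z F : Eu d} {α : ℝ} {u : Eu d → Eu d}
      {Du : Eu d → Matrix (Fin d) (Fin d) ℝ} {p : Eu d → ℝ},
      IsStokesSolution Ω z α F u Du p → α < d → Bornology.IsBounded Ω →
    ∀ {y : Eu d} {ρ : ℝ}, 0 < ρ → Metric.ball y ρ ⊆ Ω → z ∉ Metric.ball y ρ →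
    ∀ {G : Eu d → Matrix (Fin d) (Fin d) ℝ} {q : Eu d → ℝ} {U : Fin d → Eu d → ℝ} {P : Eu d → ℝ},
      (∀ i, U i ∈ polySpace d k) → P ∈ polySpace d k →
      (∀ᵐ x, x ∈ Metric.ball y ρ → (∀ i j, G x i j = pd j (U i) x) ∧ q x = P x) →
      IntegrableOn (errDensity Du G p q) (Metric.ball y ρ) →
    ∀ x ∈ Metric.closedBall y (M * ρ), ∀ i,
      ρ ^ (d + 2) * residual U P i x ^ 2 ≤ C * ∫ x in Metric.ball y ρ, errDensity Du G p q x := by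
  obtain ⟨K, hK, hcut⟩ := exists_cutoff d
  obtain ⟨C₁, hC₁, hp₁⟩ := exists_poly_bound d k 1
  obtain ⟨C₂, hC₂, hp₂⟩ := exists_poly_bound d k M
  set κ := (volume : Measure (Eu d)).real (Metric.ball 0 1) with hκ
  have hκ0 : 0 < κ := measureReal_unitBall_pos d
  set c : ℝ := (d + 1) * (2 * (K ^ 2 + 1) * C₁) * κ with hc
  have hc0 : 0 < c := by positivity
  refine ⟨4 * c * C₂, by positivity, ?_⟩
  intro Ω z F α u Du p h hα hΩ y ρ hρ hBΩ hz G q U P hU hP hGq hE x hx i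
  obtain ⟨η, hη, hη01, hη1, hηd⟩ := hcut y ρ hρ
  set R := residual U P i with hR
  have hRp := residual_mem_polySpace hU hP i
  have hRs := polySpace_contDiff hRp
  set N := ∫ x, η x * R x ^ 2 with hN
  have hRN : ∫ x in Metric.ball y (ρ / 2), R x ^ 2 ≤ N :=
    setIntegral_sq_le_of_cutoff hRs.continuous hη.1.continuous hη.2.1 (fun x => (hη01 x).1) hη1
  have hψ : IsTest (Metric.ball y ρ) (fun x => R x * η x) := hη.mul_left hRs
  -- By the inverse estimate on the half ball, where η = 1, this bounds R² and (ρ ∂R)² on the whole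
  -- ball. The test function is thus controlled by N, the quantity to be estimated.
  set S := C₁ * N / ρ ^ d with hS
  have hρd : 0 < ρ ^ d := by positivity
  have hN0 : 0 ≤ N := integral_nonneg fun x => mul_nonneg (hη01 x).1 (sq_nonneg _)
  have hS0 : 0 ≤ S := by positivity
  have hb : ∀ x j, pd j (fun x => R x * η x) x ^ 2 ≤ 2 * (K ^ 2 + 1) * S / ρ ^ 2 := by
    intro x j
    by_cases hxB : x ∈ Metric.ball y ρ
    · have hx' : x ∈ Metric.closedBall y (1 * ρ) := by
        rw [one_mul]
        exact Metric.ball_subset_closedBall hxB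
      obtain ⟨h1, h2⟩ := hp₁ R hRp y ρ hρ x hx'
      have hle : C₁ * ∫ x in Metric.ball y (ρ / 2), R x ^ 2 ≤ C₁ * N :=
        mul_le_mul_of_nonneg_left hRN hC₁.le
      refine sq_pd_mul_le hρ (hη.1.differentiable (by simp) x) (hRs.differentiable (by simp) x)
        (hη01 x).1 (hη01 x).2 (hηd j x) ?_ ?_
      · rw [hS, le_div_iff₀' hρd]
        exact h1.trans hle
      · rw [hS, le_div_iff₀' hρd]
        exact (h2 j).trans hle
    · rw [(hψ.pd j).eq_zero hxB, zero_pow two_ne_zero]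
      positivity
  have hG : ∀ i j, IntegrableOn (fun x => G x i j) (Metric.ball y ρ) := fun i j =>
    integrableOn_ball_of_ae_eq (contDiff_pd (polySpace_contDiff (hU i)) j).continuous
      (hGq.mono fun x hx hxB => (hx hxB).1 i j)
  have hq : IntegrableOn q (Metric.ball y ρ) :=
    integrableOn_ball_of_ae_eq (polySpace_contDiff hP).continuous
      (hGq.mono fun x hx hxB => (hx hxB).2)
  -- Integration by parts tests the residual with itself, times the cutoff.
  have hident : ∫ x, (∑ j, G x i j * pd j (fun x => R x * η x) x
      - q x * pd i (fun x => R x * η x) x) = - N := by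
    have e1 : ∀ᵐ x, (∑ j, G x i j * pd j (fun x => R x * η x) x
        - q x * pd i (fun x => R x * η x) x)
        = ∑ j, pd j (U i) x * pd j (fun x => R x * η x) x
          - P x * pd i (fun x => R x * η x) x := by
      filter_upwards [hGq] with x hx
      by_cases hxB : x ∈ Metric.ball y ρ
      · obtain ⟨h1, h2⟩ := hx hxB
        simp only [h1, h2]
      · simp [(hψ.pd _).eq_zero hxB]
    have hUi := polySpace_contDiff (hU i)
    have hi1 : ∀ j, Integrable (fun x => pd j (U i) x * pd j (fun x => R x * η x) x) := fun j =>
      ((contDiff_pd hUi j).continuous.mul (contDiff_pd hψ.1 j).continuous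
        ).integrable_of_hasCompactSupport (hasCompactSupport_pd hψ.2.1 j).mul_left
    have hi2 : Integrable (fun x => P x * pd i (fun x => R x * η x) x) :=
      ((polySpace_contDiff hP).continuous.mul (contDiff_pd hψ.1 i).continuous
        ).integrable_of_hasCompactSupport (hasCompactSupport_pd hψ.2.1 i).mul_left
    have hi3 : ∀ j, Integrable (fun x => pd j (pd j (U i)) x * (R x * η x)) := fun j =>
      ((contDiff_pd (contDiff_pd hUi j) j).continuous.mul hψ.1.continuous
        ).integrable_of_hasCompactSupport hψ.2.1.mul_left
    have hi4 : Integrable (fun x => pd i P x * (R x * η x)) :=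
      ((contDiff_pd (polySpace_contDiff hP) i).continuous.mul hψ.1.continuous
        ).integrable_of_hasCompactSupport hψ.2.1.mul_left
    rw [integral_congr_ae e1, integral_sub (integrable_finsetSum _ fun j _ => hi1 j) hi2,
      integral_finsetSum _ fun j _ => hi1 j, integral_mul_pd (polySpace_contDiff hP) hψ.1 hψ.2.1,
      Finset.sum_congr rfl fun j _ =>
        integral_mul_pd (contDiff_pd hUi j) hψ.1 hψ.2.1 j, Finset.sum_neg_distrib,
      ← integral_finsetSum _ fun j _ => hi3 j, hN]
    have : ∀ x, η x * R x ^ 2 = ∑ j, pd j (pd j (U i)) x * (R x * η x)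
        - pd i P x * (R x * η x) := by
      intro x
      rw [← Finset.sum_mul, ← sub_mul, sq]
      have : ∑ j, pd j (pd j (U i)) x - pd i P x = R x := rfl
      rw [this]
      ring
    rw [integral_congr_ae (Eventually.of_forall this),
      integral_sub (integrable_finsetSum _ fun j _ => hi3 j) hi4]
    ring
  -- This ε makes the second Young term exactly N/2, which is absorbed on the left.
  have hmain := h.abs_residual_le hα hΩ measure_ball_lt_top.ne hBΩ hz hG hq hE hψ hb
    (ε := ρ ^ 2 / (2 * c)) (by positivity) i
  rw [hident, abs_neg, abs_of_nonneg hN0, volume_real_ball y hρ, ← hκ] at hmain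
  have e2 : ρ ^ 2 / (2 * c) * ((d + 1) * (2 * (K ^ 2 + 1) * S / ρ ^ 2) * (ρ ^ d * κ)) = N / 2 := by
    rw [hS, hc]
    field_simp
  rw [e2, div_div_eq_mul_div] at hmain
  have e3 : ρ ^ 2 * N ≤ 4 * c * ∫ x in Metric.ball y ρ, errDensity Du G p q x := by
    have : N / 2 ≤ (∫ x in Metric.ball y ρ, errDensity Du G p q x) * (2 * c) / ρ ^ 2 := by linarith
    rw [le_div_iff₀ (by positivity)] at this
    linarith
  -- Norm equivalence passes from the half ball to every point within distance M ρ.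
  have h3 := (hp₂ R hRp y ρ hρ x hx).1.trans (mul_le_mul_of_nonneg_left hRN hC₂.le)
  calc ρ ^ (d + 2) * R x ^ 2 = ρ ^ 2 * (ρ ^ d * R x ^ 2) := by ring
    _ ≤ ρ ^ 2 * (C₂ * N) := by gcongr
    _ = C₂ * (ρ ^ 2 * N) := by ring
    _ ≤ C₂ * (4 * c * ∫ x in Metric.ball y ρ, errDensity Du G p q x) := by gcongr
    _ = _ := by ring

end InteriorResidual

/-! ### The jump of the normal stress across a hyperplane -/

section Jump

variable {m : ℕ}

/-- The `i`-th component of `(∇U - P I) n`. -/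
noncomputable def normalFlux (n : Eu m) (U : Fin m → Eu m → ℝ) (P : Eu m → ℝ) (i : Fin m)
    (x : Eu m) : ℝ :=
  ∑ j, n j * pd j (U i) x - P x * n i

theorem normalFlux_mem_polySpace {k : ℕ} {U : Fin m → Eu m → ℝ} {P : Eu m → ℝ}
    (hU : ∀ i, U i ∈ polySpace m k) (hP : P ∈ polySpace m k) (n : Eu m) (i : Fin m) :
    normalFlux n U P i ∈ polySpace m k := by
  have : normalFlux n U P i = ∑ j, n j • pd j (U i) - n i • P := by
    funext x
    simp [normalFlux, mul_comm]
  rw [this]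
  exact Submodule.sub_mem _ (Submodule.sum_mem _ fun j _ =>
    Submodule.smul_mem _ _ (pd_mem_polySpace (hU i) j)) (Submodule.smul_mem _ _ hP)

theorem normalFlux_neg (n : Eu m) (U : Fin m → Eu m → ℝ) (P : Eu m → ℝ) (i : Fin m) (x : Eu m) :
    normalFlux (-n) U P i x = - normalFlux n U P i x := by
  simp only [normalFlux, PiLp.neg_apply, neg_mul, Finset.sum_neg_distrib, mul_neg]
  ring

/-- Integration by parts on a half space. -/
theorem setIntegral_halfSpace_momentum {n : Eu (m + 1)} (hn : ‖n‖ = 1)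
    {ι : Eu m →ₗᵢ[ℝ] Eu (m + 1)} (hι : ∀ w, inner ℝ n (ι w) = 0)
    (hsurj : ∀ x, inner ℝ n x = 0 → ∃ w, ι w = x) {y : Eu (m + 1)}
    (hmp : MeasurePreserving (fun q : ℝ × Eu m => y + (q.1 • n + ι q.2)))
    {U : Fin (m + 1) → Eu (m + 1) → ℝ} {P ψ : Eu (m + 1) → ℝ} (hU : ∀ i, ContDiff ℝ ∞ (U i))
    (hP : ContDiff ℝ ∞ P) (hψ : ContDiff ℝ ∞ ψ) (hψc : HasCompactSupport ψ) (i : Fin (m + 1)) :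
    ∫ x in halfSpace y n, (∑ j, pd j (U i) x * pd j ψ x - P x * pd i ψ x)
      = - (∫ x in halfSpace y n, residual U P i x * ψ x)
        - ∫ w, normalFlux n U P i (y + ι w) * ψ (y + ι w) := by
  have hdiff : ∀ {f : Eu (m + 1) → ℝ}, ContDiff ℝ ∞ f → ∀ x, DifferentiableAt ℝ f x :=
    fun hf x => hf.differentiable (by simp) x
  have hUj : ∀ j, ContDiff ℝ ∞ (fun x => pd j (U i) x * ψ x) := fun j =>
    (contDiff_pd (hU i) j).mul hψ
  have hUjc : ∀ j, HasCompactSupport (fun x => pd j (U i) x * ψ x) := fun j => hψc.mul_left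
  have hPψ : ContDiff ℝ ∞ (fun x => P x * ψ x) := hP.mul hψ
  have hPψc : HasCompactSupport (fun x => P x * ψ x) := hψc.mul_left
  have hdiv : ∀ {f : Eu (m + 1) → ℝ}, ContDiff ℝ ∞ f → HasCompactSupport f → ∀ j,
      ∫ x in halfSpace y n, pd j f x = - (n j * ∫ w, f (y + ι w)) := by
    intro f hf hfc j
    have := setIntegral_halfSpace_fderiv hn hι hsurj hmp hf hfc (unitVec j)
    rwa [inner_unitVec] at this
  have hint : ∀ {f : Eu (m + 1) → ℝ}, ContDiff ℝ ∞ f → HasCompactSupport f → ∀ j,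
      IntegrableOn (pd j f) (halfSpace y n) := fun hf hfc j =>
    ((contDiff_pd hf j).continuous.integrable_of_hasCompactSupport
      (hasCompactSupport_pd hfc j)).integrableOn
  have hcl : Topology.IsClosedEmbedding (fun w : Eu m => y + ι w) := by
    refine Isometry.isClosedEmbedding (Isometry.of_dist_eq fun a b => ?_)
    rw [dist_add_left, ι.dist_map]
  have hint' : ∀ {f : Eu (m + 1) → ℝ}, ContDiff ℝ ∞ f → HasCompactSupport f →
      Integrable (fun w : Eu m => f (y + ι w)) := fun hf hfc =>
    (hf.continuous.comp hcl.continuous).integrable_of_hasCompactSupport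
      (hfc.comp_isClosedEmbedding hcl)
  have hres : ContDiff ℝ ∞ (residual U P i) := by
    have : residual U P i = fun x => ∑ j, pd j (pd j (U i)) x - pd i P x := rfl
    rw [this]
    exact (ContDiff.sum fun j _ => contDiff_pd (contDiff_pd (hU i) j) j).sub (contDiff_pd hP i)
  have hresi : IntegrableOn (fun x => residual U P i x * ψ x) (halfSpace y n) :=
    ((hres.mul hψ).continuous.integrable_of_hasCompactSupport hψc.mul_left).integrableOn
  have hpt : ∀ x, ∑ j, pd j (U i) x * pd j ψ x - P x * pd i ψ x
      = (∑ j, pd j (fun x => pd j (U i) x * ψ x) x - pd i (fun x => P x * ψ x) x)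
        - residual U P i x * ψ x := by
    intro x
    have e1 : ∀ j, pd j (fun x => pd j (U i) x * ψ x) x
        = pd j (pd j (U i)) x * ψ x + pd j (U i) x * pd j ψ x := fun j =>
      pd_mul (hdiff (contDiff_pd (hU i) j) x) (hdiff hψ x) j
    rw [pd_mul (hdiff hP x) (hdiff hψ x), Finset.sum_congr rfl fun j _ => e1 j,
      Finset.sum_add_distrib, ← Finset.sum_mul, residual, lap]
    ring
  have hI : IntegrableOn (fun x => ∑ j, pd j (fun x => pd j (U i) x * ψ x) x
      - pd i (fun x => P x * ψ x) x) (halfSpace y n) :=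
    (integrable_finsetSum _ fun j _ => hint (hUj j) (hUjc j) j).sub (hint hPψ hPψc i)
  rw [integral_congr_ae (Eventually.of_forall hpt), integral_sub hI hresi,
    integral_sub (integrable_finsetSum _ fun j _ => hint (hUj j) (hUjc j) j) (hint hPψ hPψc i),
    integral_finsetSum _ fun j _ => hint (hUj j) (hUjc j) j,
    Finset.sum_congr rfl fun j _ => hdiv (hUj j) (hUjc j) j, hdiv hPψ hPψc i]
  have hflux : ∫ w, normalFlux n U P i (y + ι w) * ψ (y + ι w)
      = ∑ j, n j * (∫ w, pd j (U i) (y + ι w) * ψ (y + ι w))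
        - n i * ∫ w, P (y + ι w) * ψ (y + ι w) := by
    have hj : ∀ j, Integrable (fun w => n j * (pd j (U i) (y + ι w) * ψ (y + ι w))) := fun j =>
      (hint' (hUj j) (hUjc j)).const_mul (n j)
    have hp : Integrable (fun w => n i * (P (y + ι w) * ψ (y + ι w))) :=
      (hint' hPψ hPψc).const_mul (n i)
    simp_rw [← integral_const_mul]
    rw [← integral_finsetSum _ fun j _ => hj j, ← integral_sub
      (integrable_finsetSum _ fun j _ => hj j) hp]
    refine integral_congr_ae (Eventually.of_forall fun w => ?_)
    simp only [normalFlux, sub_mul, Finset.sum_mul, mul_assoc]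
    rw [mul_left_comm (n i)]
  rw [hflux, Finset.sum_neg_distrib]
  ring

theorem ae_inner_sub_ne_zero {n : Eu (m + 1)} (hn : ‖n‖ = 1) (y : Eu (m + 1)) :
    ∀ᵐ x, inner ℝ n (x - y) ≠ 0 := by
  obtain ⟨ι, hι, -, hmp⟩ := exists_hyperplane_isometry hn
  have hmeas : MeasurableSet {x : Eu (m + 1) | inner ℝ n (x - y) = 0} :=
    (isClosed_eq (by fun_prop) continuous_const).measurableSet
  have h0 := (hmp y).measure_preimage hmeas.nullMeasurableSet
  have h1 : (fun q : ℝ × Eu m => y + (q.1 • n + ι q.2)) ⁻¹' {x | inner ℝ n (x - y) = 0}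
      = {0} ×ˢ Set.univ := by
    ext q
    simp [inner_add_right, inner_smul_right, hι, hn]
  rw [h1, Measure.volume_eq_prod, Measure.prod_prod, Real.volume_singleton, zero_mul] at h0
  rw [ae_iff]
  simpa using! h0.symm

theorem integral_eq_halfSpace_add {n : Eu (m + 1)} (hn : ‖n‖ = 1) (y : Eu (m + 1))
    {f : Eu (m + 1) → ℝ} (hf : Integrable f) :
    ∫ x, f x = (∫ x in halfSpace y n, f x) + ∫ x in halfSpace y (-n), f x := by
  rw [← integral_add_compl (isOpen_halfSpace y n).measurableSet hf]
  congr 1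
  refine setIntegral_congr_set ?_
  filter_upwards [ae_inner_sub_ne_zero hn y] with x hx
  apply propext
  change ¬ (0 < inner ℝ n (x - y)) ↔ 0 < inner ℝ (-n) (x - y)
  rw [inner_neg_left, not_lt, Left.neg_pos_iff]
  exact ⟨fun h => lt_of_le_of_ne h hx, le_of_lt⟩

theorem integrableOn_ball_of_ae_eq_halfSpace {n : Eu (m + 1)} (hn : ‖n‖ = 1) {y : Eu (m + 1)}
    {ρ : ℝ} {f g g' : Eu (m + 1) → ℝ} (hg : Continuous g) (hg' : Continuous g')
    (h : ∀ᵐ x, x ∈ Metric.ball y ρ → x ∈ halfSpace y n → f x = g x)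
    (h' : ∀ᵐ x, x ∈ Metric.ball y ρ → x ∈ halfSpace y (-n) → f x = g' x) :
    IntegrableOn f (Metric.ball y ρ) := by
  have key : ∀ {g : Eu (m + 1) → ℝ} {n : Eu (m + 1)}, Continuous g →
      (∀ᵐ x, x ∈ Metric.ball y ρ → x ∈ halfSpace y n → f x = g x) →
      IntegrableOn f (Metric.ball y ρ ∩ halfSpace y n) := by
    intro g n hg h
    have h1 : IntegrableOn g (Metric.ball y ρ ∩ halfSpace y n) :=
      (hg.continuousOn.integrableOn_compact (isCompact_closedBall y ρ)).mono_set
        (Set.inter_subset_left.trans Metric.ball_subset_closedBall)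
    refine h1.congr ?_
    filter_upwards [ae_restrict_of_ae h, ae_restrict_mem
      (Metric.isOpen_ball.inter (isOpen_halfSpace y n)).measurableSet] with x hx h'
    exact (hx h'.1 h'.2).symm
  refine ((key hg h).union (key hg' h')).congr_set_ae ?_
  filter_upwards [ae_inner_sub_ne_zero hn y] with x hx
  apply propext
  change x ∈ Metric.ball y ρ ↔ (x ∈ Metric.ball y ρ ∧ 0 < inner ℝ n (x - y)) ∨
    (x ∈ Metric.ball y ρ ∧ 0 < inner ℝ (-n) (x - y))
  rw [inner_neg_left, Left.neg_pos_iff, ← and_or_left]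
  exact ⟨fun h => ⟨h, (lt_or_gt_of_ne hx).symm⟩, fun h => h.1⟩

/-- Young's inequality with a free parameter δ on the ball that carries ψ. -/
theorem abs_setIntegral_mul_le {f ψ : Eu m → ℝ} {y : Eu m} {ρ A S δ : ℝ} (hρ : 0 < ρ)
    (hδ : 0 < δ) {H : Set (Eu m)} (hH : MeasurableSet H) (hA : ∀ x ∈ Metric.ball y ρ, f x ^ 2 ≤ A)
    (hS : ∀ x, ψ x ^ 2 ≤ S) (hψ : ∀ x ∉ Metric.ball y ρ, ψ x = 0) :
    |∫ x in H, f x * ψ x|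
      ≤ (A / δ + δ * S) * (ρ ^ m * (volume : Measure (Eu m)).real (Metric.ball 0 1)) := by
  have h1 : ∫ x in H, f x * ψ x = ∫ x in H ∩ Metric.ball y ρ, f x * ψ x :=
    setIntegral_eq_of_subset_of_forall_sdiff_eq_zero hH Set.inter_subset_left
      fun x (hx : x ∈ H \ (H ∩ Metric.ball y ρ)) => by
        change f x * ψ x = 0
        rw [hψ x fun h => hx.2 ⟨hx.1, h⟩, mul_zero]
  have hfin : volume (H ∩ Metric.ball y ρ) < ⊤ :=
    (measure_mono Set.inter_subset_right).trans_lt measure_ball_lt_top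
  have h2 : ∀ x ∈ H ∩ Metric.ball y ρ, ‖f x * ψ x‖ ≤ A / δ + δ * S := by
    intro x hx
    have e1 : |f x * ψ x| ≤ f x ^ 2 / δ + δ * ψ x ^ 2 := by
      rw [div_add' _ _ _ hδ.ne', le_div_iff₀ hδ, abs_mul, ← sq_abs (f x), ← sq_abs (ψ x)]
      nlinarith [sq_nonneg (|f x| - δ * |ψ x|),
        mul_nonneg (mul_nonneg hδ.le (abs_nonneg (f x))) (abs_nonneg (ψ x))]
    refine e1.trans ?_
    gcongr
    · exact hA x hx.2
    · exact hS x
  have hA0 : 0 ≤ A := (sq_nonneg _).trans (hA y (Metric.mem_ball_self hρ))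
  have hS0 : 0 ≤ S := (sq_nonneg _).trans (hS y)
  rw [h1, ← Real.norm_eq_abs, ← volume_real_ball y hρ]
  refine (norm_setIntegral_le_of_norm_le_const hfin h2).trans ?_
  gcongr
  · exact measure_ball_lt_top.ne
  · exact Set.inter_subset_right

/-- Lower bound of the local error by the jump of the normal stress. -/
theorem exists_jump_bound (m k : ℕ) (M : ℝ) : ∃ C : ℝ, 0 < C ∧
    ∀ {Ω : Set (Eu (m + 1))} {z F : Eu (m + 1)} {α : ℝ} {u : Eu (m + 1) → Eu (m + 1)}
      {Du : Eu (m + 1) → Matrix (Fin (m + 1)) (Fin (m + 1)) ℝ} {p : Eu (m + 1) → ℝ},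
      IsStokesSolution Ω z α F u Du p → α < (m + 1 : ℕ) → Bornology.IsBounded Ω →
    ∀ {y : Eu (m + 1)} {ρ : ℝ}, 0 < ρ → Metric.ball y ρ ⊆ Ω → z ∉ Metric.ball y ρ →
    ∀ {n : Eu (m + 1)}, ‖n‖ = 1 →
    ∀ {G : Eu (m + 1) → Matrix (Fin (m + 1)) (Fin (m + 1)) ℝ} {q : Eu (m + 1) → ℝ}
      {U U' : Fin (m + 1) → Eu (m + 1) → ℝ} {P P' : Eu (m + 1) → ℝ},
      (∀ i, U i ∈ polySpace (m + 1) k) → P ∈ polySpace (m + 1) k →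
      (∀ i, U' i ∈ polySpace (m + 1) k) → P' ∈ polySpace (m + 1) k →
      (∀ᵐ x, x ∈ Metric.ball y ρ → x ∈ halfSpace y n →
        (∀ i j, G x i j = pd j (U i) x) ∧ q x = P x) →
      (∀ᵐ x, x ∈ Metric.ball y ρ → x ∈ halfSpace y (-n) →
        (∀ i j, G x i j = pd j (U' i) x) ∧ q x = P' x) →
      IntegrableOn (errDensity Du G p q) (Metric.ball y ρ) →
    ∀ {A : ℝ}, (∀ x ∈ Metric.ball y ρ, ∀ i, residual U P i x ^ 2 ≤ A) →
      (∀ x ∈ Metric.ball y ρ, ∀ i, residual U' P' i x ^ 2 ≤ A) →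
    ∀ x ∈ Metric.closedBall y (M * ρ), inner ℝ n (x - y) = 0 → ∀ i,
      ρ ^ (m + 1) * (normalFlux n U P i x - normalFlux n U' P' i x) ^ 2
        ≤ C * ((∫ x in Metric.ball y ρ, errDensity Du G p q x) + ρ ^ (m + 3) * A) := by
  obtain ⟨K, hK, hcut⟩ := exists_cutoff (m + 1)
  obtain ⟨C₁, hC₁, hp₁⟩ := exists_poly_bound m k 1
  obtain ⟨C₂, hC₂, hp₂⟩ := exists_poly_bound m k M
  obtain ⟨C₃, hC₃, hp₃⟩ := exists_poly_bound (m + 1) k 1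
  set κ := (volume : Measure (Eu (m + 1))).real (Metric.ball 0 1) with hκ
  have hκ0 : 0 < κ := measureReal_unitBall_pos (m + 1)
  set c : ℝ := ((m + 1 : ℕ) + 1) * (2 * (K ^ 2 + 1) * (1 + C₃ * κ) * C₁) * κ with hc
  have hc0 : 0 < c := by positivity
  refine ⟨C₂ * (8 * c + 32 * C₁ * κ ^ 2), by positivity, ?_⟩
  intro Ω z F α u Du p h hα hΩ y ρ hρ hBΩ hz n hn G q U U' P P' hU hP hU' hP' hGq hGq' hE A hA hA'
    x hx hxn i
  obtain ⟨ι, hι, hsurj, hmp⟩ := exists_hyperplane_isometry hn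
  obtain ⟨η, hη, hη01, hη1, hηd⟩ := hcut y ρ hρ
  let Lin : Eu m →ᵃ[ℝ] Eu (m + 1) :=
    ι.toLinearMap.toAffineMap + AffineMap.const ℝ (Eu m) y
  have hLin : ∀ w, Lin w = y + ι w := fun w => by simp [Lin, add_comm]
  -- The adjoint of the parametrisation is the orthogonal projection onto the hyperplane, read in
  -- its coordinates.
  let ιa := ContinuousLinearMap.adjoint ι.toContinuousLinearMap
  have hιa : ∀ w, ιa (ι w) = w := fun w => by
    refine ext_inner_right ℝ fun v => ?_
    rw [ContinuousLinearMap.adjoint_inner_left]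
    exact ι.inner_map_map w v
  have hιan : ∀ x, ‖ιa x‖ ≤ ‖x‖ := fun x => by
    refine (ιa.le_opNorm x).trans ?_
    rw [LinearIsometryEquiv.norm_map]
    exact mul_le_of_le_one_left (norm_nonneg _) ι.norm_toContinuousLinearMap_le
  let π : Eu (m + 1) →ᵃ[ℝ] Eu m :=
    (ιa : Eu (m + 1) →ₗ[ℝ] Eu m).toAffineMap - AffineMap.const ℝ (Eu (m + 1)) (ιa y)
  have hπ : ∀ x, π x = ιa (x - y) := fun x => by simp [π]
  have hπι : ∀ w, π (y + ι w) = w := fun w => by rw [hπ, add_sub_cancel_left, hιa]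
  set J : Eu m → ℝ := fun w => normalFlux n U P i (y + ι w) - normalFlux n U' P' i (y + ι w)
    with hJ
  have hJp : J ∈ polySpace m k := by
    have := comp_affine_mem_polySpace (Submodule.sub_mem _ (normalFlux_mem_polySpace hU hP n i)
      (normalFlux_mem_polySpace hU' hP' n i)) Lin
    simpa [hLin, hJ] using this
  -- The jump is a polynomial on the hyperplane, extended constantly along the normal so that it can
  -- serve as a factor of the test function.
  set Jx : Eu (m + 1) → ℝ := fun x => J (π x) with hJx
  have hJxp : Jx ∈ polySpace (m + 1) k := comp_affine_mem_polySpace hJp π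
  have hJs := polySpace_contDiff hJp
  have hJxs := polySpace_contDiff hJxp
  have hcl : Topology.IsClosedEmbedding (fun w : Eu m => y + ι w) := by
    refine Isometry.isClosedEmbedding (Isometry.of_dist_eq fun a b => ?_)
    rw [dist_add_left, ι.dist_map]
  set N := ∫ w, η (y + ι w) * J w ^ 2 with hN
  have hJN : ∫ w in Metric.ball 0 (ρ / 2), J w ^ 2 ≤ N :=
    setIntegral_sq_le_of_cutoff hJs.continuous (hη.1.continuous.comp hcl.continuous)
      (hη.2.1.comp_isClosedEmbedding hcl) (fun w => (hη01 _).1) fun w hw => hη1 _ (by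
        rw [Metric.mem_ball, dist_eq_norm, add_sub_cancel_left, ι.norm_map]
        exact mem_ball_zero_iff.1 hw)
  have hψ : IsTest (Metric.ball y ρ) (fun x => Jx x * η x) := hη.mul_left hJxs
  set S := C₁ * N / ρ ^ m with hS
  have hρm : 0 < ρ ^ m := by positivity
  have hN0 : 0 ≤ N := integral_nonneg fun x => mul_nonneg (hη01 _).1 (sq_nonneg _)
  have hS0 : 0 ≤ S := by positivity
  have hJS : ∀ x ∈ Metric.closedBall y ρ, Jx x ^ 2 ≤ S := by
    intro x hx
    have h1 : π x ∈ Metric.closedBall (0 : Eu m) (1 * ρ) := by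
      rw [mem_closedBall_zero_iff, hπ, one_mul]
      refine (hιan _).trans ?_
      rwa [← dist_eq_norm]
    rw [hS, le_div_iff₀' hρm]
    exact ((hp₁ J hJp 0 ρ hρ _ h1).1).trans (mul_le_mul_of_nonneg_left hJN hC₁.le)
  -- The inverse estimate in dimension m + 1 is applied to the extension, and its right-hand side is
  -- bounded by the supremum bound S obtained in dimension m.
  have hJd : ∀ x ∈ Metric.ball y ρ, ∀ j, (ρ * pd j Jx x) ^ 2 ≤ C₃ * κ * S := by
    intro x hx j
    have hx' : x ∈ Metric.closedBall y (1 * ρ) := by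
      rw [one_mul]
      exact Metric.ball_subset_closedBall hx
    have h1 := (hp₃ Jx hJxp y ρ hρ x hx').2 j
    have h2 : ∫ w in Metric.ball y (ρ / 2), Jx w ^ 2 ≤ S * (ρ ^ (m + 1) * κ) := by
      have h3 : ‖∫ w in Metric.ball y (ρ / 2), Jx w ^ 2‖
          ≤ S * (volume : Measure (Eu (m + 1))).real (Metric.ball y (ρ / 2)) := by
        refine norm_setIntegral_le_of_norm_le_const measure_ball_lt_top fun w hw => ?_
        rw [Real.norm_of_nonneg (sq_nonneg _)]
        exact hJS w (Metric.ball_subset_closedBall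
          (Metric.ball_subset_ball (by linarith) hw))
      refine (le_abs_self _).trans (h3.trans ?_)
      rw [volume_real_ball y (by positivity)]
      gcongr
      linarith
    have h4 : ρ ^ (m + 1) * (ρ * pd j Jx x) ^ 2 ≤ ρ ^ (m + 1) * (C₃ * κ * S) := by
      refine h1.trans ((mul_le_mul_of_nonneg_left h2 hC₃.le).trans (le_of_eq ?_))
      ring
    exact le_of_mul_le_mul_left h4 (by positivity)
  set S' := (1 + C₃ * κ) * S with hS'
  have hSS' : S ≤ S' := by
    rw [hS', one_add_mul]
    exact le_add_of_nonneg_right (by positivity)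
  have hb : ∀ x j, pd j (fun x => Jx x * η x) x ^ 2 ≤ 2 * (K ^ 2 + 1) * S' / ρ ^ 2 := by
    intro x j
    by_cases hxB : x ∈ Metric.ball y ρ
    · refine sq_pd_mul_le hρ (hη.1.differentiable (by simp) x) (hJxs.differentiable (by simp) x)
        (hη01 x).1 (hη01 x).2 (hηd j x)
        ((hJS x (Metric.ball_subset_closedBall hxB)).trans hSS') ((hJd x hxB j).trans ?_)
      rw [hS', one_add_mul]
      exact le_add_of_nonneg_left hS0
    · rw [(hψ.pd j).eq_zero hxB, zero_pow two_ne_zero]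
      positivity
  have hψS : ∀ x, (Jx x * η x) ^ 2 ≤ S := by
    intro x
    by_cases hxB : x ∈ Metric.ball y ρ
    · rw [mul_pow]
      calc Jx x ^ 2 * η x ^ 2 ≤ S * 1 := by
            gcongr
            · exact hJS x (Metric.ball_subset_closedBall hxB)
            · exact pow_le_one₀ (hη01 x).1 (hη01 x).2
        _ = S := mul_one S
    · rw [hψ.eq_zero hxB, zero_pow two_ne_zero]
      exact hS0
  have hUs : ∀ i, ContDiff ℝ ∞ (U i) := fun i => polySpace_contDiff (hU i)
  have hUs' : ∀ i, ContDiff ℝ ∞ (U' i) := fun i => polySpace_contDiff (hU' i)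
  have hPs := polySpace_contDiff hP
  have hPs' := polySpace_contDiff hP'
  have hG : ∀ i j, IntegrableOn (fun x => G x i j) (Metric.ball y ρ) := fun i j =>
    integrableOn_ball_of_ae_eq_halfSpace hn (contDiff_pd (hUs i) j).continuous
      (contDiff_pd (hUs' i) j).continuous (hGq.mono fun x hx h1 h2 => (hx h1 h2).1 i j)
      (hGq'.mono fun x hx h1 h2 => (hx h1 h2).1 i j)
  have hq : IntegrableOn q (Metric.ball y ρ) :=
    integrableOn_ball_of_ae_eq_halfSpace hn hPs.continuous hPs'.continuous
      (hGq.mono fun x hx h1 h2 => (hx h1 h2).2) (hGq'.mono fun x hx h1 h2 => (hx h1 h2).2)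
  have hI : Integrable (fun x => ∑ j, G x i j * pd j (fun x => Jx x * η x) x
      - q x * pd i (fun x => Jx x * η x) x) :=
    (integrable_finsetSum _ fun j _ => integrable_mul_test (hG i j).locallyIntegrableOn
      (hψ.pd j)).sub (integrable_mul_test hq.locallyIntegrableOn (hψ.pd i))
  have hcongr : ∀ {n : Eu (m + 1)} {U : Fin (m + 1) → Eu (m + 1) → ℝ} {P : Eu (m + 1) → ℝ},
      (∀ᵐ x, x ∈ Metric.ball y ρ → x ∈ halfSpace y n →
        (∀ i j, G x i j = pd j (U i) x) ∧ q x = P x) →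
      ∫ x in halfSpace y n, (∑ j, G x i j * pd j (fun x => Jx x * η x) x
        - q x * pd i (fun x => Jx x * η x) x)
      = ∫ x in halfSpace y n, (∑ j, pd j (U i) x * pd j (fun x => Jx x * η x) x
        - P x * pd i (fun x => Jx x * η x) x) := by
    intro n U P hGq
    refine setIntegral_congr_ae (isOpen_halfSpace y n).measurableSet ?_
    filter_upwards [hGq] with x hx hxH
    by_cases hxB : x ∈ Metric.ball y ρ
    · obtain ⟨h1, h2⟩ := hx hxB hxH
      simp only [h1, h2]
    · simp [(hψ.pd _).eq_zero hxB]
  have hneg : ∀ w, inner ℝ (-n) (ι w) = 0 := fun w => by rw [inner_neg_left, hι, neg_zero]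
  have hnegs : ∀ x, inner ℝ (-n) x = 0 → ∃ w, ι w = x := fun x hx =>
    hsurj x (by rwa [inner_neg_left, neg_eq_zero] at hx)
  have hnegmp : MeasurePreserving (fun q : ℝ × Eu m => y + (q.1 • -n + ι q.2)) := by
    have h1 : MeasurePreserving (fun q : ℝ × Eu m => (-q.1, q.2)) := by
      have := (Measure.measurePreserving_neg (volume : Measure ℝ)).prod
        (MeasurePreserving.id (volume : Measure (Eu m)))
      exact this
    have h2 := (hmp y).comp h1
    convert h2 using 1
    funext q
    simp
  set R₁ := ∫ x in halfSpace y n, residual U P i x * (Jx x * η x) with hR₁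
  set R₂ := ∫ x in halfSpace y (-n), residual U' P' i x * (Jx x * η x) with hR₂
  have hψι : ∀ w, Jx (y + ι w) * η (y + ι w) = J w * η (y + ι w) := fun w => by
    rw [hJx]
    simp only [hπι]
  -- Integration by parts on the two half spaces: their normals are opposite, so the boundary terms
  -- combine to the jump tested with itself, and the two element residuals remain as volume terms.
  have hident : ∫ x, (∑ j, G x i j * pd j (fun x => Jx x * η x) x
      - q x * pd i (fun x => Jx x * η x) x) = - R₁ - R₂ - N := by
    rw [integral_eq_halfSpace_add hn y hI, hcongr hGq, hcongr hGq',
      setIntegral_halfSpace_momentum hn hι hsurj (hmp y) hUs hPs hψ.1 hψ.2.1,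
      setIntegral_halfSpace_momentum (by rwa [norm_neg]) hneg hnegs hnegmp hUs' hPs' hψ.1 hψ.2.1,
      ← hR₁, ← hR₂]
    have e : ∀ {f : Eu (m + 1) → ℝ}, ContDiff ℝ ∞ f →
        Integrable (fun w => f (y + ι w) * (Jx (y + ι w) * η (y + ι w))) := fun hf =>
      ((hf.mul hψ.1).continuous.comp hcl.continuous).integrable_of_hasCompactSupport
        ((hψ.2.1.mul_left).comp_isClosedEmbedding hcl)
    have h1 := integral_add (e (polySpace_contDiff (normalFlux_mem_polySpace hU hP n i)))
      (e (polySpace_contDiff (normalFlux_mem_polySpace hU' hP' (-n) i)))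
    have h2 : ∫ w, (normalFlux n U P i (y + ι w) * (Jx (y + ι w) * η (y + ι w))
        + normalFlux (-n) U' P' i (y + ι w) * (Jx (y + ι w) * η (y + ι w))) = N := by
      refine integral_congr_ae (Eventually.of_forall fun w => ?_)
      simp only [normalFlux_neg, hψι]
      rw [hJ]
      ring
    rw [h2] at h1
    rw [h1]
    ring
  -- The parameters are fixed so that the error term costs N/4 and each of the two volume residuals
  -- N/8, together N/2, which is absorbed.
  have hmain := h.abs_residual_le hα hΩ measure_ball_lt_top.ne hBΩ hz hG hq hE hψ hb
    (ε := ρ / (4 * c)) (by positivity) i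
  rw [hident, volume_real_ball y hρ, ← hκ] at hmain
  have e2 : ρ / (4 * c) * (((m + 1 : ℕ) + 1) * (2 * (K ^ 2 + 1) * S' / ρ ^ 2) * (ρ ^ (m + 1) * κ))
      = N / 4 := by
    rw [hS', hS, hc, pow_succ ρ m]
    field_simp
  rw [e2, div_div_eq_mul_div] at hmain
  have hδ : 0 < 1 / (8 * C₁ * κ * ρ) := by positivity
  have hRb : (A / (1 / (8 * C₁ * κ * ρ)) + 1 / (8 * C₁ * κ * ρ) * S) * (ρ ^ (m + 1) * κ)
      = 8 * C₁ * κ ^ 2 * ρ ^ (m + 2) * A + N / 8 := by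
    rw [hS, pow_succ ρ m, pow_add ρ m 2]
    field_simp
  have hR₁b := abs_setIntegral_mul_le hρ hδ (isOpen_halfSpace y n).measurableSet
    (fun x hx => hA x hx i) hψS fun x hx => hψ.eq_zero hx
  have hR₂b := abs_setIntegral_mul_le hρ hδ (isOpen_halfSpace y (-n)).measurableSet
    (fun x hx => hA' x hx i) hψS fun x hx => hψ.eq_zero hx
  rw [← hκ, hRb] at hR₁b hR₂b
  set I := ∫ x in Metric.ball y ρ, errDensity Du G p q x with hIdef
  have e3 : ρ * N ≤ 8 * c * I + 32 * C₁ * κ ^ 2 * (ρ ^ (m + 3) * A) := by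
    have h1 := abs_le.1 hmain
    have h2 := abs_le.1 hR₁b
    have h3 := abs_le.1 hR₂b
    have h4 : N / 2 - 16 * C₁ * κ ^ 2 * ρ ^ (m + 2) * A ≤ I * (4 * c) / ρ := by linarith
    rw [le_div_iff₀ hρ] at h4
    have h5 : ρ ^ (m + 3) = ρ ^ (m + 2) * ρ := pow_succ ρ (m + 2)
    rw [h5]
    linarith
  obtain ⟨w, hw⟩ := hsurj (x - y) hxn
  have hwx : y + ι w = x := by rw [hw]; abel
  have hwM : w ∈ Metric.closedBall (0 : Eu m) (M * ρ) := by
    rw [mem_closedBall_zero_iff, ← ι.norm_map, hw, ← dist_eq_norm]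
    exact hx
  have h3 := (hp₂ J hJp 0 ρ hρ w hwM).1.trans (mul_le_mul_of_nonneg_left hJN hC₂.le)
  have hJw : J w = normalFlux n U P i x - normalFlux n U' P' i x := by
    rw [hJ]
    simp only [hwx]
  rw [hJw] at h3
  have hI0 : 0 ≤ I := integral_nonneg fun x => errDensity_nonneg _ _ _ _ x
  have hA0 : 0 ≤ A := (sq_nonneg _).trans (hA y (Metric.mem_ball_self hρ) i)
  calc _ = ρ * (ρ ^ m * (normalFlux n U P i x - normalFlux n U' P' i x) ^ 2) := by ring
    _ ≤ ρ * (C₂ * N) := by gcongr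
    _ = C₂ * (ρ * N) := by ring
    _ ≤ C₂ * (8 * c * I + 32 * C₁ * κ ^ 2 * (ρ ^ (m + 3) * A)) := by gcongr
    _ ≤ C₂ * ((8 * c + 32 * C₁ * κ ^ 2) * (I + ρ ^ (m + 3) * A)) := by
      have h6 : 0 ≤ 8 * c * (ρ ^ (m + 3) * A) := by positivity
      have h7 : 0 ≤ 32 * C₁ * κ ^ 2 * I := by positivity
      gcongr
      linarith
    _ = _ := by ring

end Jump

/-! ### Barycentric coordinates, side normals and balls in a simplex -/

section SimplexGeometry

variable {d : ℕ} {T : Finset (Eu d)}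

/-- Barycentric coordinates of a nondegenerate simplex together with their gradients. -/
structure BaryCoords (T : Finset (Eu d)) where
  lam : Eu d → Eu d → ℝ
  grad : Eu d → Eu d
  self : ∀ a ∈ T, lam a a = 1
  ne : ∀ a ∈ T, ∀ b ∈ T, b ≠ a → lam a b = 0
  diff : ∀ a ∈ T, ∀ x y, lam a x - lam a y = inner ℝ (grad a) (x - y)
  mem_simplex : ∀ x, x ∈ simplex T ↔ ∀ a ∈ T, 0 ≤ lam a x
  sum_one : ∀ x, ∑ a ∈ T, lam a x = 1

theorem nonempty_baryCoords (hc : T.card = d + 1)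
    (hi : AffineIndependent ℝ (fun a : T => (a : Eu d))) : Nonempty (BaryCoords T) := by
  classical
  have htot : affineSpan ℝ (Set.range fun a : T => (a : Eu d)) = ⊤ := by
    rw [hi.affineSpan_eq_top_iff_card_eq_finrank_add_one]
    simpa using hc
  let b : AffineBasis T ℝ (Eu d) := ⟨fun a => (a : Eu d), hi, htot⟩
  have hb : ∀ a : T, b a = (a : Eu d) := fun a => rfl
  have hrange : Set.range b = (T : Set (Eu d)) := by
    ext x
    simp [hb]
  let lin : T → (Eu d →L[ℝ] ℝ) := fun a => (b.coord a).linear.toContinuousLinearMap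
  refine ⟨{
    lam := fun a x => if h : a ∈ T then b.coord ⟨a, h⟩ x else 0
    grad := fun a => if h : a ∈ T then (InnerProductSpace.toDual ℝ (Eu d)).symm (lin ⟨a, h⟩) else 0
    self := fun a ha => ?_
    ne := fun a ha c hc hca => ?_
    diff := fun a ha x y => ?_
    mem_simplex := fun x => ?_
    sum_one := fun x => ?_ }⟩
  · rw [dif_pos ha]
    exact b.coord_apply_eq ⟨a, ha⟩
  · rw [dif_pos ha]
    exact b.coord_apply_ne (i := ⟨a, ha⟩) (j := ⟨c, hc⟩) fun h => hca (congrArg Subtype.val h).symm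
  · rw [dif_pos ha, dif_pos ha, dif_pos ha, InnerProductSpace.toDual_symm_apply]
    exact ((b.coord ⟨a, ha⟩).linearMap_vsub x y).symm
  · rw [simplex, ← hrange, b.convexHull_eq_nonneg_coord]
    simp only [Set.mem_ofPred_eq, Subtype.forall]
    exact forall₂_congr fun a ha => by rw [dif_pos ha]
  · rw [← b.sum_coord_apply_eq_one x, ← Finset.sum_coe_sort T]
    exact Finset.sum_congr rfl fun a _ => by rw [dif_pos a.2]

theorem isCompact_simplex (T : Finset (Eu d)) : IsCompact (simplex T) :=
  T.finite_toSet.isCompact_convexHull (𝕜 := ℝ)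

theorem isClosed_simplex (T : Finset (Eu d)) : IsClosed (simplex T) :=
  (isCompact_simplex T).isClosed

theorem convex_simplex (T : Finset (Eu d)) : Convex ℝ (simplex T) := convex_convexHull ℝ _

theorem subset_simplex (T : Finset (Eu d)) : (T : Set (Eu d)) ⊆ simplex T :=
  subset_convexHull ℝ _

theorem dist_le_hT {x y : Eu d} (hx : x ∈ simplex T) (hy : y ∈ simplex T) : dist x y ≤ hT T :=
  Metric.dist_le_diam_of_mem (isCompact_simplex T).isBounded hx hy

theorem volume_frontier_simplex (T : Finset (Eu d)) : volume (frontier (simplex T)) = 0 :=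
  (convex_simplex T).addHaar_frontier volume

theorem ae_mem_interior_simplex (T : Finset (Eu d)) :
    ∀ᵐ x, x ∈ simplex T → x ∈ interior (simplex T) := by
  have h : ∀ᵐ x, x ∉ frontier (simplex T) := by
    rw [ae_iff]
    simpa using! volume_frontier_simplex T
  filter_upwards [h] with x hx hxT
  by_contra hxi
  exact hx ⟨subset_closure hxT, hxi⟩

/-- The barycentre of a set of points. -/
noncomputable def barycentre (S : Finset (Eu d)) : Eu d := (S.card : ℝ)⁻¹ • ∑ a ∈ S, a

namespace BaryCoords

theorem lam_barycentre (b : BaryCoords T) {a : Eu d} (ha : a ∈ T) {S : Finset (Eu d)} (hS : S.Nonempty) :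
    b.lam a (barycentre S) = (S.card : ℝ)⁻¹ * ∑ c ∈ S, b.lam a c := by
  have hS0 : (S.card : ℝ) ≠ 0 := by exact_mod_cast hS.card_ne_zero
  have h1 := b.diff a ha (barycentre S) 0
  have h2 : ∀ c, b.lam a c = b.lam a 0 + inner ℝ (b.grad a) c := fun c => by
    have := b.diff a ha c 0
    rw [sub_zero] at this
    linarith
  rw [h2, Finset.sum_congr rfl fun c _ => h2 c, barycentre, inner_smul_right, inner_sum,
    Finset.sum_add_distrib, Finset.sum_const, nsmul_eq_mul]
  field_simp

theorem lam_le_one (b : BaryCoords T) {a : Eu d} (ha : a ∈ T) {x : Eu d} (hx : x ∈ simplex T) : b.lam a x ≤ 1 := by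
  rw [← b.sum_one x]
  exact Finset.single_le_sum (fun c hc => (b.mem_simplex x).1 hx c hc) ha

/-- Moving from the centre by r against the gradient lowers the coordinate by r ‖grad‖, yet both
values lie between 0 and 1. -/
theorem mul_norm_grad_le (b : BaryCoords T) {c : Eu d} {r : ℝ} (hr : 0 ≤ r) (h : Metric.closedBall c r ⊆ simplex T)
    {a : Eu d} (ha : a ∈ T) : r * ‖b.grad a‖ ≤ 1 := by
  rcases eq_or_ne (b.grad a) 0 with h0 | h0
  · rw [h0, norm_zero, mul_zero]
    exact zero_le_one
  have hn : 0 < ‖b.grad a‖ := norm_pos_iff.2 h0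
  have hmem : c - (r * ‖b.grad a‖⁻¹) • b.grad a ∈ simplex T := by
    refine h ?_
    rw [Metric.mem_closedBall, dist_eq_norm, sub_sub_cancel_left, norm_neg, norm_smul,
      Real.norm_of_nonneg (by positivity), mul_assoc, inv_mul_cancel₀ hn.ne', mul_one]
  have h1 := (b.mem_simplex _).1 hmem a ha
  have h2 := b.lam_le_one ha (h (Metric.mem_closedBall_self hr))
  have h3 := b.diff a ha c (c - (r * ‖b.grad a‖⁻¹) • b.grad a)
  rw [sub_sub_cancel, inner_smul_right, real_inner_self_eq_norm_sq] at h3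
  have h4 : r * ‖b.grad a‖⁻¹ * ‖b.grad a‖ ^ 2 = r * ‖b.grad a‖ := by
    field_simp
  linarith

theorem one_eq_inner (b : BaryCoords T) {a c : Eu d} (ha : a ∈ T) (hc : c ∈ T) (hac : c ≠ a) :
    1 = inner ℝ (b.grad a) (a - c) := by
  rw [← b.diff a ha, b.self a ha, b.ne a ha c hc hac, sub_zero]

theorem grad_ne_zero (b : BaryCoords T) {a c : Eu d} (ha : a ∈ T) (hc : c ∈ T) (hac : c ≠ a) : b.grad a ≠ 0 := by
  intro h
  have := b.one_eq_inner ha hc hac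
  rw [h, inner_zero_left] at this
  exact one_ne_zero this

/-- A barycentric coordinate changes by 1 along an edge ending at its vertex, while its gradient is
at most 1/r; so edges are no shorter than the radius of an inscribed ball. -/
theorem le_dist (b : BaryCoords T) {y : Eu d} {r : ℝ} (hr : 0 ≤ r) (h : Metric.closedBall y r ⊆ simplex T)
    {a c : Eu d} (ha : a ∈ T) (hc : c ∈ T) (hac : c ≠ a) : r ≤ dist a c := by
  have h1 := b.mul_norm_grad_le hr h ha
  have h2 : 1 ≤ ‖b.grad a‖ * dist a c := by
    rw [b.one_eq_inner ha hc hac, dist_eq_norm]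
    exact real_inner_le_norm _ _
  calc r = r * 1 := (mul_one r).symm
    _ ≤ r * (‖b.grad a‖ * dist a c) := by gcongr
    _ = r * ‖b.grad a‖ * dist a c := by ring
    _ ≤ 1 * dist a c := by gcongr
    _ = dist a c := one_mul _

end BaryCoords

section Side

variable {S : Finset (Eu d)}

theorem exists_opposite_vertex (hc : T.card = d + 1) (hST : S ⊆ T) (hS : S.card = d) :
    ∃ a ∈ T, a ∉ S ∧ ∀ c ∈ T, c ≠ a → c ∈ S := by
  classical
  have h1 : (T \ S).card = 1 := by
    rw [Finset.card_sdiff_of_subset hST]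
    omega
  obtain ⟨a, ha⟩ := Finset.card_eq_one.1 h1
  have ha' : a ∈ T \ S := by rw [ha]; exact Finset.mem_singleton_self a
  refine ⟨a, (Finset.mem_sdiff.1 ha').1, (Finset.mem_sdiff.1 ha').2, fun c hcT hca => ?_⟩
  by_contra hcS
  have : c ∈ T \ S := Finset.mem_sdiff.2 ⟨hcT, hcS⟩
  rw [ha] at this
  exact hca (Finset.mem_singleton.1 this)

/-- The orthogonal complement of the direction of a side is a line. -/
theorem orthogonal_vectorSpan_side (hi : AffineIndependent ℝ (fun a : T => (a : Eu d)))
    (hST : S ⊆ T) (hS : S.card = d) (hd : 1 ≤ d) {g : Eu d} (hg : g ≠ 0)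
    (hgS : ∀ a ∈ S, ∀ c ∈ S, inner ℝ g (a - c) = 0) :
    (vectorSpan ℝ (S : Set (Eu d)))ᗮ = Submodule.span ℝ {g} := by
  have hSi : AffineIndependent ℝ (fun a : S => (a : Eu d)) :=
    hi.comp_embedding ⟨fun a : S => (⟨a, hST a.2⟩ : T), fun a c h =>
      Subtype.ext (congrArg (fun t : T => (t : Eu d)) h)⟩
  have h1 : Module.finrank ℝ (vectorSpan ℝ (S : Set (Eu d))) = d - 1 := by
    have := hSi.finrank_vectorSpan (n := d - 1) (by simp; omega)
    rwa [Subtype.range_coe_subtype, Finset.setOfPred_mem] at this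
  have h2 : Module.finrank ℝ (vectorSpan ℝ (S : Set (Eu d)))ᗮ = 1 :=
    Submodule.finrank_add_finrank_orthogonal' (by
      rw [h1, finrank_euclideanSpace, Fintype.card_fin]
      omega)
  refine (Submodule.eq_of_le_of_finrank_eq ?_ ?_).symm
  · rw [Submodule.span_singleton_le_iff_mem, Submodule.mem_orthogonal']
    intro v hv
    rw [vectorSpan] at hv
    induction hv using Submodule.span_induction with
    | mem x hx =>
      obtain ⟨a, ha, c, hc, rfl⟩ := hx
      exact hgS a ha c hc
    | zero => exact inner_zero_right _
    | add x y _ _ hx hy => rw [inner_add_right, hx, hy, add_zero]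
    | smul r x _ hx => rw [inner_smul_right, hx, mul_zero]
  · rw [h2, finrank_span_singleton hg]

theorem BaryCoords.inner_side (b : BaryCoords T) (hST : S ⊆ T) {a : Eu d} (ha : a ∈ T)
    (haS : a ∉ S) {x y : Eu d} (hx : x ∈ simplex S) (hy : y ∈ simplex S) :
    inner ℝ (b.grad a) (x - y) = 0 := by
  have key : ∀ x ∈ simplex S, b.lam a x = 0 := by
    intro x hx
    have hconv : Convex ℝ {x | b.lam a x = 0} := by
      have : {x | b.lam a x = 0} = {x | inner ℝ (b.grad a) x = - b.lam a 0} := by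
        ext x
        have := b.diff a ha x 0
        rw [sub_zero] at this
        simp only [Set.mem_ofPred_eq]
        constructor <;> intro h <;> linarith
      rw [this]
      exact convex_hyperplane (IsLinearMap.mk (fun _ _ => inner_add_right _ _ _)
        fun _ _ => inner_smul_right _ _ _) _
    exact convexHull_min (fun c hc => b.ne a ha c (hST hc) fun h => haS (h ▸ hc)) hconv hx
  rw [← b.diff a ha, key x hx, key y hy, sub_zero]

theorem barycentre_mem_simplex (hS : S.Nonempty) : barycentre S ∈ simplex S := by
  have h : (0 : ℝ) < S.card := by exact_mod_cast hS.card_pos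
  rw [barycentre, Finset.smul_sum, simplex]
  refine (convex_convexHull ℝ _).sum_mem (fun _ _ => by positivity) ?_
    fun a ha => subset_convexHull ℝ _ ha
  rw [Finset.sum_const, nsmul_eq_mul]
  field_simp

/-- The gradient of the coordinate of the opposite vertex spans the line orthogonal to the side. It
points inwards, because that coordinate is positive at the barycentre of T and zero at that of S. -/
theorem BaryCoords.sideNormal_eq (b : BaryCoords T)
    (hi : AffineIndependent ℝ (fun a : T => (a : Eu d))) (hST : S ⊆ T) (hS : S.card = d)
    (hd : 1 ≤ d) {a : Eu d} (ha : a ∈ T) (haS : a ∉ S) :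
    sideNormal T S = ‖b.grad a‖⁻¹ • b.grad a := by
  have hSne : S.Nonempty := Finset.card_pos.1 (by omega)
  obtain ⟨c, hc⟩ := hSne
  have hSne : S.Nonempty := ⟨c, hc⟩
  have hg : b.grad a ≠ 0 := b.grad_ne_zero ha (hST hc) fun h => haS (h ▸ hc)
  have horth := orthogonal_vectorSpan_side hi hST hS hd hg fun x hx y hy =>
    b.inner_side hST ha haS (subset_simplex S hx) (subset_simplex S hy)
  have hTne : T.Nonempty := ⟨a, ha⟩
  have hpos : 0 < inner ℝ (b.grad a) (barycentre T - barycentre S) := by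
    have h1 : ∑ c ∈ T, b.lam a c = 1 := by
      rw [Finset.sum_eq_single_of_mem a ha fun c hc hca => b.ne a ha c hc hca, b.self a ha]
    have h2 : ∑ c ∈ S, b.lam a c = 0 :=
      Finset.sum_eq_zero fun c hc => b.ne a ha c (hST hc) fun h => haS (h ▸ hc)
    rw [← b.diff a ha, b.lam_barycentre ha hTne, b.lam_barycentre ha hSne, h1, h2, mul_one,
      mul_zero, sub_zero]
    have : (0 : ℝ) < T.card := by exact_mod_cast hTne.card_pos
    positivity
  have hgn : 0 < ‖b.grad a‖ := norm_pos_iff.2 hg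
  change ‖(vectorSpan ℝ (S : Set (Eu d)))ᗮ.starProjection (barycentre T - barycentre S)‖⁻¹ •
    (vectorSpan ℝ (S : Set (Eu d)))ᗮ.starProjection (barycentre T - barycentre S) = _
  have hproj : (vectorSpan ℝ (S : Set (Eu d)))ᗮ.starProjection (barycentre T - barycentre S)
      = (inner ℝ (b.grad a) (barycentre T - barycentre S) / ‖b.grad a‖ ^ 2) • b.grad a := by
    simp only [horth]
    rw [Submodule.starProjection_singleton]
    rfl
  rw [hproj, norm_smul, Real.norm_of_nonneg (by positivity), smul_smul]
  congr 1
  field_simp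

theorem BaryCoords.norm_sideNormal (b : BaryCoords T)
    (hi : AffineIndependent ℝ (fun a : T => (a : Eu d))) (hST : S ⊆ T) (hS : S.card = d)
    (hd : 1 ≤ d) {a : Eu d} (ha : a ∈ T) (haS : a ∉ S) : ‖sideNormal T S‖ = 1 := by
  obtain ⟨c, hc⟩ : S.Nonempty := Finset.card_pos.1 (by omega)
  have hg : b.grad a ≠ 0 := b.grad_ne_zero ha (hST hc) fun h => haS (h ▸ hc)
  rw [b.sideNormal_eq hi hST hS hd ha haS, norm_smul, norm_inv, norm_norm,
    inv_mul_cancel₀ (norm_ne_zero_iff.2 hg)]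

/-- Near the barycentre of a side, a simplex is a half ball. -/
theorem mem_simplex_of_side (hc : T.card = d + 1)
    (hi : AffineIndependent ℝ (fun a : T => (a : Eu d))) (hST : S ⊆ T) (hS : S.card = d)
    (hd : 1 ≤ d) {c : Eu d} {r : ℝ} (hr : 0 ≤ r) (h : Metric.closedBall c r ⊆ simplex T)
    {x : Eu d} (hx : x ∈ Metric.closedBall (barycentre S) (r / d))
    (hxn : 0 ≤ inner ℝ (sideNormal T S) (x - barycentre S)) : x ∈ simplex T := by
  obtain ⟨b⟩ := nonempty_baryCoords hc hi
  obtain ⟨a₀, ha₀, ha₀S, hother⟩ := exists_opposite_vertex hc hST hS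
  have hSne : S.Nonempty := Finset.card_pos.1 (by omega)
  have hd0 : (0 : ℝ) < d := by exact_mod_cast hd
  obtain ⟨c₀, hc₀⟩ := hSne
  have hSne : S.Nonempty := ⟨c₀, hc₀⟩
  have hg : b.grad a₀ ≠ 0 := b.grad_ne_zero ha₀ (hST hc₀) fun h => ha₀S (h ▸ hc₀)
  rw [b.sideNormal_eq hi hST hS hd ha₀ ha₀S, real_inner_smul_left,
    mul_nonneg_iff_of_pos_left (inv_pos.2 (norm_pos_iff.2 hg)), ← b.diff a₀ ha₀] at hxn
  rw [b.mem_simplex]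
  intro a ha
  by_cases haa : a = a₀
  · subst haa
    have h2 : ∑ c ∈ S, b.lam a c = 0 :=
      Finset.sum_eq_zero fun c hc => b.ne a ha c (hST hc) fun h => ha₀S (h ▸ hc)
    rw [b.lam_barycentre ha hSne, h2, mul_zero, sub_zero] at hxn
    exact hxn
  -- The coordinates of the vertices of the side equal 1/d at its barycentre. Within distance r/d
  -- they change by at most ‖grad‖ r / d ≤ 1/d, hence stay nonnegative.
  · have haS := hother a ha haa
    have h2 : ∑ c ∈ S, b.lam a c = 1 := by
      rw [Finset.sum_eq_single_of_mem a haS fun c hc hca => b.ne a ha c (hST hc) hca, b.self a ha]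
    have h3 := b.diff a ha x (barycentre S)
    rw [b.lam_barycentre ha hSne, h2, mul_one, hS] at h3
    have h4 := b.mul_norm_grad_le hr h ha
    rw [Metric.mem_closedBall, dist_eq_norm] at hx
    have h5 := abs_le.1 (abs_real_inner_le_norm (b.grad a) (x - barycentre S))
    have h6 : ‖b.grad a‖ * ‖x - barycentre S‖ ≤ (d : ℝ)⁻¹ :=
      calc _ ≤ ‖b.grad a‖ * (r / d) := by gcongr
        _ = r * ‖b.grad a‖ * (d : ℝ)⁻¹ := by ring
        _ ≤ 1 * (d : ℝ)⁻¹ := by gcongr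
        _ = _ := one_mul _
    linarith [h5.1]

end Side

/-- The two candidates c ± (r/2) e are at distance r from each other, so at least one is r/2 away
from z, and a ball of radius r/4 around it keeps distance r/4. -/
theorem exists_far_ball (c z : Eu d) {e : Eu d} (he : ‖e‖ = 1) {r : ℝ} (hr : 0 < r) :
    ∃ s : ℝ, |s| = r / 2 ∧ ∀ x ∈ Metric.ball (c + s • e) (r / 4), r / 4 ≤ ‖x - z‖ := by
  have key : ∃ s : ℝ, |s| = r / 2 ∧ r / 2 ≤ ‖c + s • e - z‖ := by
    by_contra! hcon
    have h1 := hcon (r / 2) (abs_of_pos (by positivity))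
    have h2 := hcon (-(r / 2)) (by rw [abs_neg, abs_of_pos (by positivity)])
    have h3 : (c + (r / 2) • e - z) - (c + (-(r / 2)) • e - z) = r • e := by
      rw [neg_smul]
      have : r • e = (r / 2) • e + (r / 2) • e := by rw [← add_smul, add_halves]
      rw [this]
      abel
    have h4 := norm_sub_le (c + (r / 2) • e - z) (c + (-(r / 2)) • e - z)
    rw [h3, norm_smul, he, Real.norm_of_nonneg hr.le] at h4
    linarith
  obtain ⟨s, hs, hsz⟩ := key
  refine ⟨s, hs, fun x hx => ?_⟩
  rw [Metric.mem_ball, dist_comm, dist_eq_norm] at hx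
  have := norm_sub_le_norm_sub_add_norm_sub (c + s • e) x z
  linarith

end SimplexGeometry

/-! ### Geometry of shape regular meshes -/

section MeshGeometry

variable {d : ℕ} {Ω : Set (Eu d)}

/-- A Lipschitz domain lies locally on one side of its boundary. From a boundary point in the
interior of the closure one could step to a point strictly below the graph that is still in the
closure, but near it no point belongs to Ω. -/
theorem IsLipschitzDomain.interior_closure_subset (hΩ : IsLipschitzDomain Ω) :
    interior (closure Ω) ⊆ Ω := by
  intro x hx
  by_contra hxΩ
  have hxf : x ∈ frontier Ω :=
    ⟨interior_subset hx, by rwa [hΩ.isOpen.interior_eq]⟩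
  obtain ⟨e, g, K, r, he, hg, hinv, hr, hloc⟩ := hΩ.boundary x hxf
  have hgx : inner ℝ x e ≤ g x := by
    by_contra! h
    exact hxΩ ((hloc x (Metric.mem_ball_self hr)).2 h)
  obtain ⟨δ, hδ, hball⟩ := Metric.isOpen_iff.1 isOpen_interior x hx
  set t : ℝ := min δ r / 2 with ht
  have ht0 : 0 < t := half_pos (lt_min hδ hr)
  have htm : t < min δ r := half_lt_self (lt_min hδ hr)
  set w := x + (-t) • e with hw
  have hwd : dist w x = t := by
    rw [hw, dist_eq_norm, add_sub_cancel_left, norm_smul, he, mul_one, norm_neg,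
      Real.norm_of_nonneg ht0.le]
  have hwc : w ∈ closure Ω :=
    interior_subset (hball (by rw [Metric.mem_ball, hwd]; exact htm.trans_le (min_le_left _ _)))
  have hopen : IsOpen {y : Eu d | inner ℝ y e < g y} :=
    isOpen_lt (by fun_prop) hg.continuous
  have hwg : w ∈ {y : Eu d | inner ℝ y e < g y} := by
    change inner ℝ w e < g w
    rw [hw, hinv, inner_add_left, real_inner_smul_left, real_inner_self_eq_norm_sq, he]
    linarith
  have hwb : w ∈ Metric.ball x r := by
    rw [Metric.mem_ball, hwd]
    exact htm.trans_le (min_le_right _ _)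
  obtain ⟨y, ⟨hy1, hy2⟩, hyΩ⟩ := mem_closure_iff.1 hwc _ (hopen.inter Metric.isOpen_ball) ⟨hwg, hwb⟩
  exact lt_asymm hy1 ((hloc y hy2).1 hyΩ)

variable (𝒯 : Triangulation Ω) {T T' : Finset (Eu d)} {z : Eu d} {σ : ℝ}

theorem Triangulation.simplex_subset (hTm : T ∈ 𝒯.cells) : simplex T ⊆ closure Ω := by
  rw [← 𝒯.cover]
  exact Set.subset_biUnion_of_mem (u := fun T => simplex T) hTm

theorem Triangulation.interior_simplex_subset (hΩ : IsLipschitzDomain Ω) (hTm : T ∈ 𝒯.cells) :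
    interior (simplex T) ⊆ Ω :=
  (interior_mono (𝒯.simplex_subset hTm)).trans hΩ.interior_closure_subset

theorem Triangulation.hT_pos (hd : 1 ≤ d) (hTm : T ∈ 𝒯.cells) : 0 < hT T := by
  have h1 : 1 < T.card := by
    rw [𝒯.card_eq T hTm]
    omega
  obtain ⟨a, ha, c, hc, hac⟩ := Finset.one_lt_card.1 h1
  exact (dist_pos.2 hac).trans_le (dist_le_hT (subset_simplex T ha) (subset_simplex T hc))

theorem norm_sub_le_DT {x : Eu d} (hx : x ∈ simplex T) : ‖x - z‖ ≤ DT z T := by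
  refine le_csSup ?_ ⟨x, hx, rfl⟩
  exact ((isCompact_simplex T).image (by fun_prop)).bddAbove

theorem DT_le {x : Eu d} (hx : x ∈ simplex T) : DT z T ≤ hT T + ‖x - z‖ := by
  refine csSup_le ⟨_, x, hx, rfl⟩ ?_
  rintro _ ⟨y, hy, rfl⟩
  have h1 := dist_le_hT hy hx
  have h2 := norm_sub_le_norm_sub_add_norm_sub y x z
  rw [dist_eq_norm] at h1
  linarith

theorem Triangulation.DT_pos (hd : 1 ≤ d) (hTm : T ∈ 𝒯.cells) : 0 < DT z T := by
  have h1 : 1 < T.card := by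
    rw [𝒯.card_eq T hTm]
    omega
  obtain ⟨a, ha, c, hc, hac⟩ := Finset.one_lt_card.1 h1
  have h2 : 0 < ‖a - z‖ ∨ 0 < ‖c - z‖ := by
    by_contra! h
    have e1 := sub_eq_zero.1 (norm_le_zero_iff.1 h.1)
    have e2 := sub_eq_zero.1 (norm_le_zero_iff.1 h.2)
    exact hac (e1.trans e2.symm)
  rcases h2 with h | h
  · exact h.trans_le (norm_sub_le_DT (subset_simplex T ha))
  · exact h.trans_le (norm_sub_le_DT (subset_simplex T hc))

theorem mem_neighbours {𝒯 : Triangulation Ω} :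
    T' ∈ neighbours 𝒯 T ↔ T' ∈ 𝒯.cells ∧ T' ≠ T ∧ (side T T').card = d := by
  classical
  rw [neighbours, Finset.mem_filter, side]

theorem side_subset_left (T T' : Finset (Eu d)) : side T T' ⊆ T := by
  classical
  exact Finset.inter_subset_left

theorem side_subset_right (T T' : Finset (Eu d)) : side T T' ⊆ T' := by
  classical
  exact Finset.inter_subset_right

theorem Triangulation.simplex_inter (hTm : T ∈ 𝒯.cells) (hT' : T' ∈ 𝒯.cells) :
    simplex T ∩ simplex T' = simplex (side T T') := by
  classical
  rw [𝒯.conforming T hTm T' hT', simplex, side, Finset.coe_inter]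

theorem simplex_side_subset_left (T T' : Finset (Eu d)) : simplex (side T T') ⊆ simplex T :=
  convexHull_mono (Finset.coe_subset.2 (side_subset_left T T'))

theorem simplex_side_subset_right (T T' : Finset (Eu d)) : simplex (side T T') ⊆ simplex T' :=
  convexHull_mono (Finset.coe_subset.2 (side_subset_right T T'))

theorem simplex_subset_patch : simplex T ⊆ patch 𝒯 T := Set.subset_union_left

theorem simplex_neighbour_subset_patch (hT' : T' ∈ neighbours 𝒯 T) :
    simplex T' ⊆ patch 𝒯 T :=
  (Set.subset_biUnion_of_mem (u := fun T => simplex T) hT').trans Set.subset_union_right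

/-- The unit normals of two elements on a common side are opposite. -/
theorem Triangulation.sideNormal_eq_neg (hd : 1 ≤ d) (hTm : T ∈ 𝒯.cells) (hT' : T' ∈ 𝒯.cells)
    (hS : (side T T').card = d) {c c' : Eu d} {r r' : ℝ} (hr : 0 < r) (hr' : 0 < r')
    (h : Metric.closedBall c r ⊆ simplex T) (h' : Metric.closedBall c' r' ⊆ simplex T') :
    sideNormal T' (side T T') = - sideNormal T (side T T') := by
  obtain ⟨b⟩ := nonempty_baryCoords (𝒯.card_eq T hTm) (𝒯.indep T hTm)
  obtain ⟨b'⟩ := nonempty_baryCoords (𝒯.card_eq T' hT') (𝒯.indep T' hT')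
  set S := side T T' with hSdef
  have hST : S ⊆ T := side_subset_left T T'
  have hST' : S ⊆ T' := side_subset_right T T'
  obtain ⟨a, ha, haS, -⟩ := exists_opposite_vertex (𝒯.card_eq T hTm) hST hS
  obtain ⟨a', ha', haS', -⟩ := exists_opposite_vertex (𝒯.card_eq T' hT') hST' hS
  obtain ⟨v, hv⟩ : S.Nonempty := Finset.card_pos.1 (by omega)
  have hSne : S.Nonempty := ⟨v, hv⟩
  have hg : b.grad a ≠ 0 := b.grad_ne_zero ha (hST hv) fun h => haS (h ▸ hv)
  have hg' : b'.grad a' ≠ 0 := b'.grad_ne_zero ha' (hST' hv) fun h => haS' (h ▸ hv)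
  have ho := orthogonal_vectorSpan_side (𝒯.indep T hTm) hST hS hd hg fun x hx y hy =>
    b.inner_side hST ha haS (subset_simplex S hx) (subset_simplex S hy)
  have ho' := orthogonal_vectorSpan_side (𝒯.indep T' hT') hST' hS hd hg' fun x hx y hy =>
    b'.inner_side hST' ha' haS' (subset_simplex S hx) (subset_simplex S hy)
  have hmem : b'.grad a' ∈ Submodule.span ℝ {b.grad a} := by
    rw [← ho, ho']
    exact Submodule.mem_span_singleton_self _
  obtain ⟨t, ht⟩ := Submodule.mem_span_singleton.1 hmem
  have hn := b.sideNormal_eq (𝒯.indep T hTm) hST hS hd ha haS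
  have hn' := b'.sideNormal_eq (𝒯.indep T' hT') hST' hS hd ha' haS'
  have hgn : 0 < ‖b.grad a‖ := norm_pos_iff.2 hg
  have hgn' : 0 < ‖b'.grad a'‖ := norm_pos_iff.2 hg'
  -- If both gradients pointed to the same side, a point slightly off the barycentre of the side
  -- would lie in both simplices, hence by conformity in the common side, although its coordinate
  -- for the opposite vertex is positive.
  have ht0 : t < 0 := by
    by_contra! htn
    have hd0 : (0 : ℝ) < d := by exact_mod_cast hd
    set s : ℝ := min r r' / d * ‖b.grad a‖⁻¹ with hs
    have hm : 0 < min r r' := lt_min hr hr'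
    have hs0 : 0 < s := by positivity
    set x := barycentre S + s • b.grad a with hx
    have hxb : ∀ {ρ : ℝ}, min r r' ≤ ρ → x ∈ Metric.closedBall (barycentre S) (ρ / d) := by
      intro ρ hρ
      rw [Metric.mem_closedBall, hx, dist_eq_norm, add_sub_cancel_left, norm_smul,
        Real.norm_of_nonneg hs0.le, hs, mul_assoc, inv_mul_cancel₀ hgn.ne', mul_one]
      gcongr
    have hxT : x ∈ simplex T := by
      refine mem_simplex_of_side (𝒯.card_eq T hTm) (𝒯.indep T hTm) hST hS hd hr.le h
        (hxb (min_le_left _ _)) ?_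
      rw [hn, hx, add_sub_cancel_left, real_inner_smul_left, inner_smul_right,
        real_inner_self_eq_norm_sq]
      positivity
    have hxT' : x ∈ simplex T' := by
      refine mem_simplex_of_side (𝒯.card_eq T' hT') (𝒯.indep T' hT') hST' hS hd hr'.le h'
        (hxb (min_le_right _ _)) ?_
      rw [hn', hx, add_sub_cancel_left, real_inner_smul_left, inner_smul_right, ← ht,
        real_inner_smul_left, real_inner_self_eq_norm_sq]
      positivity
    have hxS : x ∈ simplex S := by
      rw [hSdef, ← 𝒯.simplex_inter hTm hT']
      exact ⟨hxT, hxT'⟩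
    have h0 := b.inner_side hST ha haS hxS (barycentre_mem_simplex hSne)
    rw [hx, add_sub_cancel_left, inner_smul_right, real_inner_self_eq_norm_sq] at h0
    have : 0 < s * ‖b.grad a‖ ^ 2 := by positivity
    exact this.ne' h0
  have ht' : t ≠ 0 := ht0.ne
  rw [hn, hn', ← ht, norm_smul, Real.norm_of_nonpos ht0.le, smul_smul, ← neg_smul]
  congr 1
  field_simp

section ShapeRegular

variable {𝒯}

/-- For d ≥ 2 the common side contains an edge, whose length is at least σ h_T by the inscribed ball
and at most h_T'. -/
theorem ShapeRegular.hT_le (h𝒯 : ShapeRegular σ 𝒯) (hσ : 0 < σ) (hd : 2 ≤ d) (hTm : T ∈ 𝒯.cells)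
    (hT' : (side T T').card = d) : σ * hT T ≤ hT T' := by
  obtain ⟨c, hc⟩ := h𝒯 T hTm
  obtain ⟨b⟩ := nonempty_baryCoords (𝒯.card_eq T hTm) (𝒯.indep T hTm)
  obtain ⟨a, ha, v, hv, hav⟩ := Finset.one_lt_card.1 (by omega : 1 < (side T T').card)
  have h0 := 𝒯.hT_pos (by omega) hTm
  exact (b.le_dist (by positivity) hc (side_subset_left T T' ha) (side_subset_left T T' hv)
    hav.symm).trans (dist_le_hT (subset_simplex T' (side_subset_right T T' ha))
      (subset_simplex T' (side_subset_right T T' hv)))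

/-- The inscribed ball contains a quarter-size ball that avoids z, by moving the centre half a
radius in a suitable direction. -/
theorem ShapeRegular.exists_interior_ball (h𝒯 : ShapeRegular σ 𝒯) (hσ : 0 < σ) (hd : 1 ≤ d)
    (hTm : T ∈ 𝒯.cells) (z : Eu d) :
    ∃ y ∈ simplex T, Metric.ball y (σ * hT T / 4) ⊆ interior (simplex T) ∧
      ∀ x ∈ Metric.ball y (σ * hT T / 4), σ * hT T / 4 ≤ ‖x - z‖ := by
  obtain ⟨c, hc⟩ := h𝒯 T hTm
  have h0 := 𝒯.hT_pos hd hTm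
  have hr : 0 < σ * hT T := by positivity
  obtain ⟨s, hs, hfar⟩ := exists_far_ball c z (norm_unitVec (⟨0, hd⟩ : Fin d)) hr
  set y := c + s • (unitVec ⟨0, hd⟩ : Eu d) with hy
  have hyc : dist y c = σ * hT T / 2 := by
    rw [hy, dist_eq_norm, add_sub_cancel_left, norm_smul, norm_unitVec, mul_one, Real.norm_eq_abs,
      hs]
  refine ⟨y, hc ?_, interior_maximal (fun x hx => hc ?_) Metric.isOpen_ball, hfar⟩
  · rw [Metric.mem_closedBall, hyc]
    linarith
  · rw [Metric.mem_ball] at hx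
    rw [Metric.mem_closedBall]
    have := dist_triangle x y c
    linarith

/-- A ball centred on a common side, contained in the two adjacent elements, whose distance to a
given point is not small. -/
theorem ShapeRegular.exists_side_ball (h𝒯 : ShapeRegular σ 𝒯) (hσ : 0 < σ) (hd : 2 ≤ d)
    (hTm : T ∈ 𝒯.cells) (hT' : T' ∈ neighbours 𝒯 T) (z : Eu d) {r : ℝ} (hr : 0 < r)
    (hrT : d * r ≤ σ * hT T) (hrT' : d * r ≤ σ * hT T') :
    ∃ y ∈ simplex (side T T'),
      (∀ x ∈ Metric.ball y (r / 4), 0 ≤ inner ℝ (sideNormal T (side T T')) (x - y) →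
        x ∈ simplex T) ∧
      (∀ x ∈ Metric.ball y (r / 4), inner ℝ (sideNormal T (side T T')) (x - y) ≤ 0 →
        x ∈ simplex T') ∧
      (∀ x ∈ Metric.ball y (r / 4), r / 4 ≤ ‖x - z‖) ∧
      (∀ x ∈ simplex (side T T'), inner ℝ (sideNormal T (side T T')) (x - y) = 0) := by
  obtain ⟨hT'c, -, hS⟩ := mem_neighbours.1 hT'
  obtain ⟨c, hc⟩ := h𝒯 T hTm
  obtain ⟨c', hc'⟩ := h𝒯 T' hT'c
  obtain ⟨b⟩ := nonempty_baryCoords (𝒯.card_eq T hTm) (𝒯.indep T hTm)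
  have h0 := 𝒯.hT_pos (by omega) hTm
  have h0' := 𝒯.hT_pos (by omega) hT'c
  have hneg := 𝒯.sideNormal_eq_neg (by omega) hTm hT'c hS (by positivity) (by positivity) hc hc'
  set S := side T T' with hSdef
  have hST : S ⊆ T := side_subset_left T T'
  have hST' : S ⊆ T' := side_subset_right T T'
  obtain ⟨a, ha, haS, -⟩ := exists_opposite_vertex (𝒯.card_eq T hTm) hST hS
  obtain ⟨v, hv, w, hw, hvw⟩ := Finset.one_lt_card.1 (by omega : 1 < S.card)
  have hSne : S.Nonempty := ⟨v, hv⟩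
  set n := sideNormal T S with hn
  have hinner : ∀ x ∈ simplex S, ∀ y ∈ simplex S, inner ℝ n (x - y) = 0 := by
    intro x hx y hy
    rw [hn, b.sideNormal_eq (𝒯.indep T hTm) hST hS (by omega) ha haS, real_inner_smul_left,
      b.inner_side hST ha haS hx hy, mul_zero]
  -- An edge direction of the side: moving the centre along it leaves the distances to the
  -- hyperplane of the side unchanged, so the half-ball description persists.
  set e : Eu d := ‖v - w‖⁻¹ • (v - w) with he
  have hvw0 : ‖v - w‖ ≠ 0 := norm_ne_zero_iff.2 (sub_ne_zero.2 hvw)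
  have he1 : ‖e‖ = 1 := by
    rw [he, norm_smul, norm_inv, norm_norm, inv_mul_cancel₀ hvw0]
  have hne0 : inner ℝ n e = 0 := by
    rw [he, inner_smul_right, hinner v (subset_simplex S hv) w (subset_simplex S hw), mul_zero]
  obtain ⟨s, hs, hfar⟩ := exists_far_ball (barycentre S) z he1 hr
  have hd0 : (0 : ℝ) < d := by exact_mod_cast (by omega : 0 < d)
  set y := barycentre S + s • e with hy
  have hyx : ∀ x, inner ℝ n (x - y) = inner ℝ n (x - barycentre S) := by
    intro x
    rw [hy, ← sub_sub, inner_sub_right, inner_smul_right, hne0, mul_zero, sub_zero]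
  have hxb : ∀ x ∈ Metric.ball y (r / 4), ∀ {R : ℝ}, d * r ≤ R →
      x ∈ Metric.closedBall (barycentre S) (R / d) := by
    intro x hx R hR
    have h1 : dist y (barycentre S) = r / 2 := by
      rw [hy, dist_eq_norm, add_sub_cancel_left, norm_smul, he1, mul_one, Real.norm_eq_abs, hs]
    rw [Metric.mem_ball] at hx
    have h2 := dist_triangle x y (barycentre S)
    have h3 : r ≤ R / d := by
      rw [le_div_iff₀ hd0]
      linarith
    rw [Metric.mem_closedBall]
    linarith
  have hin : ∀ x ∈ Metric.ball y (r / 4), 0 ≤ inner ℝ n (x - y) → x ∈ simplex T := by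
    intro x hx hxn
    refine mem_simplex_of_side (𝒯.card_eq T hTm) (𝒯.indep T hTm) hST hS (by omega)
      (by positivity) hc (hxb x hx hrT) ?_
    rw [← hn, ← hyx]
    exact hxn
  have hin' : ∀ x ∈ Metric.ball y (r / 4), inner ℝ n (x - y) ≤ 0 → x ∈ simplex T' := by
    intro x hx hxn
    refine mem_simplex_of_side (𝒯.card_eq T' hT'c) (𝒯.indep T' hT'c) hST' hS (by omega)
      (by positivity) hc' (hxb x hx hrT') ?_
    rw [hneg, inner_neg_left, ← hyx]
    linarith
  have hyb : y ∈ Metric.ball y (r / 4) := Metric.mem_ball_self (by positivity)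
  have hyS : y ∈ simplex S := by
    rw [hSdef, ← 𝒯.simplex_inter hTm hT'c]
    exact ⟨hin y hyb (by rw [sub_self, inner_zero_right]),
      hin' y hyb (by rw [sub_self, inner_zero_right])⟩
  exact ⟨y, hyS, hin, hin', hfar, fun x hx => hinner x hx y hyS⟩

/-- Distinct neighbours use distinct sides: three elements with a common side would have pairwise
opposite unit normals on it. A simplex has d + 1 sides. -/
theorem ShapeRegular.card_neighbours_le (h𝒯 : ShapeRegular σ 𝒯) (hσ : 0 < σ) (hd : 1 ≤ d)
    (hTm : T ∈ 𝒯.cells) : (neighbours 𝒯 T).card ≤ d + 1 := by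
  have hmaps : ∀ T' ∈ neighbours 𝒯 T, side T T' ∈ T.powersetCard d := fun T' hT' =>
    Finset.mem_powersetCard.2 ⟨side_subset_left T T', (mem_neighbours.1 hT').2.2⟩
  have hinj : Set.InjOn (fun T' => side T T') (neighbours 𝒯 T) := by
    intro T₁ h₁ T₂ h₂ h12
    by_contra hne
    change side T T₁ = side T T₂ at h12
    obtain ⟨h₁c, -, h₁s⟩ := mem_neighbours.1 h₁
    obtain ⟨h₂c, -, h₂s⟩ := mem_neighbours.1 h₂
    obtain ⟨c, hc⟩ := h𝒯 T hTm
    obtain ⟨c₁, hc₁⟩ := h𝒯 T₁ h₁c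
    obtain ⟨c₂, hc₂⟩ := h𝒯 T₂ h₂c
    have h0 := 𝒯.hT_pos hd hTm
    have h0₁ := 𝒯.hT_pos hd h₁c
    have h0₂ := 𝒯.hT_pos hd h₂c
    have hs : side T₁ T₂ = side T T₁ := by
      classical
      have hsub : side T T₁ ⊆ side T₁ T₂ := fun x hx =>
        Finset.mem_inter.2 ⟨side_subset_right T T₁ hx, side_subset_right T T₂ (h12 ▸ hx)⟩
      have hlt : (side T₁ T₂).card < d + 1 := by
        rw [← 𝒯.card_eq T₁ h₁c]
        refine Finset.card_lt_card ⟨side_subset_left T₁ T₂, fun hsup => hne ?_⟩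
        refine Finset.eq_of_subset_of_card_le (hsup.trans (side_subset_right T₁ T₂)) ?_
        rw [𝒯.card_eq T₁ h₁c, 𝒯.card_eq T₂ h₂c]
      exact (Finset.eq_of_subset_of_card_le hsub (by omega)).symm
    have e1 := 𝒯.sideNormal_eq_neg hd hTm h₁c h₁s (by positivity) (by positivity) hc hc₁
    have e2 := 𝒯.sideNormal_eq_neg hd hTm h₂c h₂s (by positivity) (by positivity) hc hc₂
    have e3 := 𝒯.sideNormal_eq_neg hd h₁c h₂c (by rw [hs, h₁s]) (by positivity)
      (by positivity) hc₁ hc₂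
    rw [hs] at e3
    rw [← h12] at e2
    obtain ⟨b⟩ := nonempty_baryCoords (𝒯.card_eq T₁ h₁c) (𝒯.indep T₁ h₁c)
    obtain ⟨a, ha, haS, -⟩ :=
      exists_opposite_vertex (𝒯.card_eq T₁ h₁c) (side_subset_right T T₁) h₁s
    have e4 := b.norm_sideNormal (𝒯.indep T₁ h₁c) (side_subset_right T T₁) h₁s hd ha haS
    rw [e2, ← e1] at e3
    have e5 : sideNormal T₁ (side T T₁) = 0 := by
      have e6 : (2 : ℝ) • sideNormal T₁ (side T T₁) = 0 := by
        rw [two_smul]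
        nth_rewrite 2 [e3]
        exact add_neg_cancel _
      exact (smul_eq_zero.1 e6).resolve_left two_ne_zero
    rw [e5, norm_zero] at e4
    exact zero_ne_one e4
  calc (neighbours 𝒯 T).card ≤ (T.powersetCard d).card :=
        Finset.card_le_card_of_injOn _ hmaps hinj
    _ = d + 1 := by rw [Finset.card_powersetCard, 𝒯.card_eq T hTm, Nat.choose_succ_self_right]

end ShapeRegular

end MeshGeometry

/-! ### Discrete functions as polynomials on each element -/

section CellRepresentation

variable {d : ℕ}

theorem exists_affineMap_of_mem_affSpace {f : Eu d → ℝ} (hf : f ∈ affSpace d) :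
    ∃ A : Eu d →ᵃ[ℝ] ℝ, ∀ x, A x = f x :=
  affSpace_induction (C := fun f => ∃ A : Eu d →ᵃ[ℝ] ℝ, ∀ x, A x = f x)
    ⟨AffineMap.const ℝ _ 1, fun _ => rfl⟩
    (fun i => ⟨((EuclideanSpace.proj i : Eu d →L[ℝ] ℝ) : Eu d →ₗ[ℝ] ℝ).toAffineMap, fun _ => rfl⟩)
    (fun f g ⟨A, hA⟩ ⟨B, hB⟩ => ⟨A + B, fun x => by simp [hA, hB]⟩)
    (fun c f ⟨A, hA⟩ => ⟨c • A, fun x => by simp [hA]⟩) hf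

/-- The vector field with components `U i`. -/
noncomputable def fieldOf (U : Fin d → Eu d → ℝ) (x : Eu d) : Eu d :=
  WithLp.toLp 2 fun i => U i x

theorem contDiff_fieldOf {U : Fin d → Eu d → ℝ} (hU : ∀ i, ContDiff ℝ ∞ (U i)) :
    ContDiff ℝ ∞ (fieldOf U) :=
  (contDiff_piLp 2).2 hU

/-- On the simplex `T` the pair `(v, q)` is given by the polynomials `U` and the affine
function `P`. -/
structure IsCellRep (T : Finset (Eu d)) (v : Eu d → Eu d) (q : Eu d → ℝ)
    (U : Fin d → Eu d → ℝ) (P : Eu d →ᵃ[ℝ] ℝ) : Prop where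
  mem_u : ∀ i, U i ∈ polySpace d (d + 1)
  eq_u : ∀ x ∈ simplex T, v x = fieldOf U x
  eq_p : ∀ x ∈ simplex T, q x = P x

theorem IsPolyOn.exists_mem {k : ℕ} {T : Finset (Eu d)} {f : Eu d → ℝ} (h : IsPolyOn k T f) :
    ∃ g ∈ polySpace d k, ∀ x ∈ simplex T, f x = g x := by
  obtain ⟨P, hP, hfP⟩ := h
  exact ⟨_, eval_mem_polySpace hP, hfP⟩

/-- The degree d + 1 accommodates the bubble, a product of d + 1 affine functions, and for d ≥ 1
also the quadratics, so both pairs are treated at once. -/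
theorem StablePair.IsLocalVelocity.exists_mem {π : StablePair} {T : Finset (Eu d)}
    (hT : T.card = d + 1) (hd : 1 ≤ d) {f : Eu d → ℝ} (h : π.IsLocalVelocity T f) :
    ∃ g ∈ polySpace d (d + 1), ∀ x ∈ simplex T, f x = g x := by
  cases π with
  | mini =>
    obtain ⟨g, c, lam, hg, -, hf⟩ := h
    obtain ⟨g', hg', hgg'⟩ := hg.exists_mem
    have hprod : ∏ a ∈ T, (lam a : Eu d → ℝ) ∈ polySpace d (d + 1) := by
      have := prod_mem_polySpace T (f := fun a => (lam a : Eu d → ℝ)) (k := fun _ => 1)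
        fun a _ => affineMap_mem_polySpace (lam a)
      simpa [hT] using this
    refine ⟨g' + c • ∏ a ∈ T, (lam a : Eu d → ℝ), Submodule.add_mem _
      (polySpace_mono (by omega) hg') (Submodule.smul_mem _ _ hprod), fun x hx => ?_⟩
    rw [hf x hx, hgg' x hx]
    simp
  | taylorHood =>
    obtain ⟨g, hg, hfg⟩ := IsPolyOn.exists_mem (k := 2) h
    exact ⟨g, polySpace_mono (by omega) hg, hfg⟩

theorem IsDiscreteSolution.exists_cellRep {π : StablePair} {Ω : Set (Eu d)} {𝒯 : Triangulation Ω}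
    {z F : Eu d} {uT : Eu d → Eu d} {pT : Eu d → ℝ} (h : IsDiscreteSolution π 𝒯 z F uT pT)
    (hd : 1 ≤ d) {T : Finset (Eu d)} (hT : T ∈ 𝒯.cells) :
    ∃ U P, IsCellRep T uT pT U P := by
  choose U hU hUe using fun i => (h.mem_u.loc T hT i).exists_mem (𝒯.card_eq T hT) hd
  obtain ⟨g, hg, hpg⟩ := (h.mem_p.loc T hT).exists_mem
  rw [polySpace_one] at hg
  obtain ⟨A, hA⟩ := exists_affineMap_of_mem_affSpace hg
  refine ⟨U, A, hU, fun x hx => ?_, fun x hx => by rw [hpg x hx, hA]⟩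
  ext i
  exact hUe i x hx

namespace IsCellRep

variable {T : Finset (Eu d)} {v : Eu d → Eu d} {q : Eu d → ℝ} {U : Fin d → Eu d → ℝ}
  {P : Eu d →ᵃ[ℝ] ℝ}

theorem mem_p (_h : IsCellRep T v q U P) : (P : Eu d → ℝ) ∈ polySpace d (d + 1) :=
  polySpace_mono (by omega) (affineMap_mem_polySpace P)

theorem contDiff_u (h : IsCellRep T v q U P) (i : Fin d) : ContDiff ℝ ∞ (U i) :=
  polySpace_contDiff (h.mem_u i)

theorem contDiff_field (h : IsCellRep T v q U P) : ContDiff ℝ ∞ (fieldOf U) :=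
  contDiff_fieldOf h.contDiff_u

theorem eventuallyEq_u (h : IsCellRep T v q U P) {x : Eu d} (hx : x ∈ interior (simplex T)) :
    v =ᶠ[𝓝 x] fieldOf U := by
  filter_upwards [isOpen_interior.mem_nhds hx] with y hy using h.eq_u y (interior_subset hy)

theorem eventuallyEq_p (h : IsCellRep T v q U P) {x : Eu d} (hx : x ∈ interior (simplex T)) :
    q =ᶠ[𝓝 x] P := by
  filter_upwards [isOpen_interior.mem_nhds hx] with y hy using h.eq_p y (interior_subset hy)

theorem jac_eq (h : IsCellRep T v q U P) {x : Eu d} (hx : x ∈ interior (simplex T)) (i j : Fin d) :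
    jac v x i j = pd j (U i) x := by
  have h1 : jac v x i j = jac (fieldOf U) x i j := by
    rw [jac, jac, (h.eventuallyEq_u hx).fderiv_eq]
  rw [h1, jac_apply_of_contDiff h.contDiff_field]
  rfl

theorem _root_.StokesFEM.laplacian_eq_lap {f : Eu d → ℝ} (hf : ContDiff ℝ ∞ f) (x : Eu d) :
    Laplacian.laplacian f x = lap f x := by
  rw [InnerProductSpace.laplacian_eq_iteratedFDeriv_orthonormalBasis f
    (EuclideanSpace.basisFun (Fin d) ℝ), lap]
  refine Finset.sum_congr rfl fun j _ => ?_
  have h1 : DifferentiableAt ℝ (fderiv ℝ f) x :=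
    (hf.fderiv_right (m := ∞) (by simp)).differentiable (by simp) x
  rw [iteratedFDeriv_two_apply]
  change _ = fderiv ℝ (fun y => fderiv ℝ f y (unitVec j)) x (unitVec j)
  rw [fderiv_clm_apply h1 (differentiableAt_const _)]
  simp [unitVec]

theorem _root_.StokesFEM.gradient_apply (f : Eu d → ℝ) (x : Eu d) (i : Fin d) :
    gradient f x i = pd i f x := by
  rw [← inner_unitVec, gradient, InnerProductSpace.toDual_symm_apply, pd]

theorem residual_eq (h : IsCellRep T v q U P) {x : Eu d} (hx : x ∈ interior (simplex T))
    (i : Fin d) : (Laplacian.laplacian v x - gradient q x) i = residual U P i x := by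
  have h1 : Laplacian.laplacian v x = Laplacian.laplacian (fieldOf U) x :=
    (InnerProductSpace.laplacian_congr_nhds (h.eventuallyEq_u hx)).eq_of_nhds
  have h2 : gradient q x = gradient P x := by
    rw [gradient, gradient, (h.eventuallyEq_p hx).fderiv_eq]
  have h3 := ((h.contDiff_field.of_le (m := 2) (by norm_cast)).contDiffAt (x := x)
    ).laplacian_CLM_comp_left (l := (EuclideanSpace.proj i : Eu d →L[ℝ] ℝ))
  have h4 : (EuclideanSpace.proj i : Eu d →L[ℝ] ℝ) ∘ fieldOf U = U i := rfl
  rw [h4, laplacian_eq_lap (h.contDiff_u i)] at h3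
  rw [h1, h2, PiLp.sub_apply, gradient_apply, residual, h3]
  rfl

/-- A convex set with nonempty interior has unique derivatives up to its boundary, so the one-sided
derivative on a side is that of the polynomial representing v. -/
theorem normalStress_eq (h : IsCellRep T v q U P) (hT : (interior (simplex T)).Nonempty)
    {S : Finset (Eu d)} {x : Eu d} (hx : x ∈ simplex T) (i : Fin d) :
    normalStress v q T S x i = normalFlux (sideNormal T S) U P i x := by
  have hud : UniqueDiffWithinAt ℝ (simplex T) x :=
    uniqueDiffWithinAt_convex (convex_simplex T) hT (subset_closure hx)
  have h1 : fderivWithin ℝ v (simplex T) x = fderiv ℝ (fieldOf U) x := by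
    rw [fderivWithin_congr h.eq_u (h.eq_u x hx)]
    exact (h.contDiff_field.differentiable (by simp) x).fderivWithin hud
  have h2 : ∀ n : Eu d, fderiv ℝ (fieldOf U) x n i = ∑ j, n j * pd j (U i) x := by
    intro n
    have hn : n = ∑ j, n j • (unitVec j : Eu d) := by
      have := (EuclideanSpace.basisFun (Fin d) ℝ).sum_repr n
      simpa [unitVec] using! this.symm
    have h3 : ∀ j, fderiv ℝ (fieldOf U) x (unitVec j) i = pd j (U i) x := fun j =>
      jac_apply_of_contDiff h.contDiff_field x i j
    conv_lhs => rw [hn, map_sum]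
    simp [h3]
  rw [normalStress, h1, h.eq_p x hx, PiLp.sub_apply, h2, PiLp.smul_apply, smul_eq_mul, normalFlux]

end IsCellRep

theorem memWL2_polySpace [NeZero d] (z : Eu d) {α : ℝ} (hα : -(d : ℝ) < α) {s : Set (Eu d)}
    (hs : Bornology.IsBounded s) {k : ℕ} {f : Eu d → ℝ} (hf : f ∈ polySpace d k) :
    MemWL2 z α s f := by
  have hc := (polySpace_contDiff hf).continuous
  obtain ⟨R, hR⟩ := hs.subset_closedBall 0
  -- A bump equal to 1 on the bounded set reduces to functions with compact support.
  let χ : ContDiffBump (0 : Eu d) := ⟨|R| + 1, |R| + 2, by positivity, by linarith⟩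
  have h1 : MemWL2 z α (Metric.closedBall 0 R) (fun x => χ x * f x) :=
    memWL2_of_bounded z hα Metric.isBounded_closedBall (χ.continuous.mul hc)
      χ.hasCompactSupport.mul_right
  refine ⟨hc.locallyIntegrable.locallyIntegrableOn s, IntegrableOn.mono_set ?_ hR⟩
  refine h1.2.congr_fun (fun x hx => ?_) measurableSet_closedBall
  have : χ x = 1 := χ.one_of_mem_closedBall
    (Metric.closedBall_subset_closedBall ((le_abs_self R).trans (by linarith)) hx)
  simp only [this, one_mul]

end CellRepresentation

/-! ### The weighted error on a patch and the pointwise residual bound -/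

section LocalErrors

variable {d : ℕ}

/-- An exact and a discrete solution of the Stokes problem on a shape regular mesh. -/
structure IsErrorSetting (Ω : Set (Eu d)) (z : Eu d) (α σ : ℝ) (π : StablePair)
    (𝒯 : Triangulation Ω) (F : Eu d) (u : Eu d → Eu d) (Du : Eu d → Matrix (Fin d) (Fin d) ℝ)
    (p : Eu d → ℝ) (uT : Eu d → Eu d) (pT : Eu d → ℝ) : Prop where
  two_le : 2 ≤ d
  domain : IsLipschitzDomain Ω
  pos : 0 < α
  lt : α < d
  sigma_pos : 0 < σ
  regular : ShapeRegular σ 𝒯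
  exact_sol : IsStokesSolution Ω z α F u Du p
  discrete_sol : IsDiscreteSolution π 𝒯 z F uT pT

/-- The weighted squared error on the patch of `T`. -/
noncomputable def patchError {Ω : Set (Eu d)} (𝒯 : Triangulation Ω) (z : Eu d) (α : ℝ)
    (Du : Eu d → Matrix (Fin d) (Fin d) ℝ) (p : Eu d → ℝ) (uT : Eu d → Eu d) (pT : Eu d → ℝ)
    (T : Finset (Eu d)) : ℝ :=
  ∫ x in patch 𝒯 T, weight z α x * errDensity Du (jac uT) p pT x

variable {Ω : Set (Eu d)} {z : Eu d} {α σ : ℝ} {π : StablePair}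
  {𝒯 : Triangulation Ω} {F : Eu d} {u : Eu d → Eu d} {Du : Eu d → Matrix (Fin d) (Fin d) ℝ}
  {p : Eu d → ℝ} {uT : Eu d → Eu d} {pT : Eu d → ℝ} {T T' : Finset (Eu d)}

theorem integrableOn_simplex_of_interior {f : Eu d → ℝ}
    (h : IntegrableOn f (interior (simplex T))) : IntegrableOn f (simplex T) := by
  refine h.congr_set_ae ?_
  filter_upwards [ae_mem_interior_simplex T] with x hx
  exact propext ⟨hx, fun h => interior_subset h⟩

theorem integrableOn_patch {f : Eu d → ℝ} (hTm : T ∈ 𝒯.cells)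
    (h : ∀ T ∈ 𝒯.cells, IntegrableOn f (simplex T)) : IntegrableOn f (patch 𝒯 T) :=
  (h T hTm).union (integrableOn_finset_iUnion.2 fun T' hT' => h T' (mem_neighbours.1 hT').1)

namespace IsErrorSetting

theorem one_le (h : IsErrorSetting Ω z α σ π 𝒯 F u Du p uT pT) : 1 ≤ d := by
  have := h.two_le
  omega

theorem neZero (h : IsErrorSetting Ω z α σ π 𝒯 F u Du p uT pT) : NeZero d := ⟨by have := h.two_le; omega⟩

theorem integrableOn_frob (h : IsErrorSetting Ω z α σ π 𝒯 F u Du p uT pT)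
    (hTm : T ∈ 𝒯.cells) :
    IntegrableOn (fun x => weight z α x * frob (Du x - jac uT x) (Du x - jac uT x))
      (simplex T) := by
  have := h.neZero
  obtain ⟨U, P, hrep⟩ := h.discrete_sol.exists_cellRep h.one_le hTm
  -- The bounds on Du are available in Ω only and the simplex may touch ∂Ω; its interior lies in Ω
  -- and differs from it by a null set.
  refine integrableOn_simplex_of_interior ?_
  have hsub := 𝒯.interior_simplex_subset h.domain hTm
  have hα : -(d : ℝ) < α := by
    have := h.pos
    have : (0 : ℝ) ≤ d := Nat.cast_nonneg d
    linarith
  have hij : ∀ i j, IntegrableOn (fun x => weight z α x * (Du x i j - jac uT x i j) ^ 2)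
      (interior (simplex T)) := fun i j => by
    have h1 : MemWL2 z α (interior (simplex T)) (fun x => Du x i j) :=
      ⟨(h.exact_sol.mem_u.1.grad i j).1.mono_set hsub,
        (h.exact_sol.mem_u.1.grad i j).2.mono_set hsub⟩
    have h2 : MemWL2 z α (interior (simplex T)) (pd j (U i)) :=
      memWL2_polySpace z hα ((isCompact_simplex T).isBounded.subset interior_subset)
        (pd_mem_polySpace (hrep.mem_u i) j)
    refine (h1.sub h2).2.congr_fun (fun x hx => ?_) isOpen_interior.measurableSet
    simp only [hrep.jac_eq hx]
  refine (integrable_finsetSum Finset.univ fun i _ =>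
    integrable_finsetSum Finset.univ fun j _ => hij i j).congr ?_
  refine Eventually.of_forall fun x => ?_
  simp only [frob_self, Matrix.sub_apply, Finset.mul_sum]

theorem integrableOn_pressure (h : IsErrorSetting Ω z α σ π 𝒯 F u Du p uT pT)
    (hTm : T ∈ 𝒯.cells) :
    IntegrableOn (fun x => weight z α x * (p x - pT x) ^ 2) (simplex T) := by
  have := h.neZero
  obtain ⟨U, P, hrep⟩ := h.discrete_sol.exists_cellRep h.one_le hTm
  refine integrableOn_simplex_of_interior ?_
  have hsub := 𝒯.interior_simplex_subset h.domain hTm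
  have hα : -(d : ℝ) < α := by
    have := h.pos
    have : (0 : ℝ) ≤ d := Nat.cast_nonneg d
    linarith
  have h1 : MemWL2 z α (interior (simplex T)) p :=
    ⟨h.exact_sol.mem_p.1.mono_set hsub, h.exact_sol.mem_p.2.mono_set hsub⟩
  have h2 : MemWL2 z α (interior (simplex T)) P :=
    memWL2_polySpace z hα ((isCompact_simplex T).isBounded.subset interior_subset) hrep.mem_p
  refine (h1.sub h2).2.congr_fun (fun x hx => ?_) isOpen_interior.measurableSet
  simp only [hrep.eq_p x (interior_subset hx)]

theorem integrableOn_err (h : IsErrorSetting Ω z α σ π 𝒯 F u Du p uT pT)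
    (hTm : T ∈ 𝒯.cells) :
    IntegrableOn (fun x => weight z α x * errDensity Du (jac uT) p pT x) (simplex T) := by
  refine ((h.integrableOn_frob hTm).add (h.integrableOn_pressure hTm)).congr ?_
  exact Eventually.of_forall fun x => by simp only [errDensity, mul_add, Pi.add_apply]

theorem patchError_eq (h : IsErrorSetting Ω z α σ π 𝒯 F u Du p uT pT)
    (hTm : T ∈ 𝒯.cells) : patchError 𝒯 z α Du p uT pT T
    = (∫ x in patch 𝒯 T, weight z α x * frob (Du x - jac uT x) (Du x - jac uT x))
      + ∫ x in patch 𝒯 T, weight z α x * (p x - pT x) ^ 2 := by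
  rw [patchError, ← integral_add (integrableOn_patch hTm fun _ => h.integrableOn_frob)
    (integrableOn_patch hTm fun _ => h.integrableOn_pressure)]
  simp only [errDensity, mul_add]

theorem _root_.StokesFEM.patchError_nonneg : 0 ≤ patchError 𝒯 z α Du p uT pT T :=
  integral_nonneg fun x => mul_nonneg (weight_nonneg z α x) (errDensity_nonneg _ _ _ _ x)

/-- Away from `z` the unweighted error is controlled by the weighted one. -/
theorem setIntegral_err_le (h : IsErrorSetting Ω z α σ π 𝒯 F u Du p uT pT)
    (hTm : T ∈ 𝒯.cells) {B : Set (Eu d)} (hB : MeasurableSet B)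
    (hBT : B ⊆ patch 𝒯 T) {K : ℝ} (hK : 0 < K) (hBz : ∀ x ∈ B, DT z T ≤ K * ‖x - z‖) :
    IntegrableOn (errDensity Du (jac uT) p pT) B ∧
      DT z T ^ α * ∫ x in B, errDensity Du (jac uT) p pT x
        ≤ K ^ α * patchError 𝒯 z α Du p uT pT T := by
  have hD : 0 < DT z T := 𝒯.DT_pos h.one_le hTm
  have hint : IntegrableOn (fun x => weight z α x * errDensity Du (jac uT) p pT x) (patch 𝒯 T) :=
    integrableOn_patch hTm fun _ => h.integrableOn_err
  have hintB := hint.mono_set hBT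
  have hxpos : ∀ x ∈ B, 0 < ‖x - z‖ := fun x hx => by
    have := hD.trans_le (hBz x hx)
    exact pos_of_mul_pos_right this hK.le
  have hw : ∀ x ∈ B, DT z T ^ α ≤ K ^ α * weight z α x := fun x hx => by
    rw [weight, ← Real.mul_rpow hK.le (norm_nonneg _)]
    exact Real.rpow_le_rpow hD.le (hBz x hx) h.pos.le
  have hle : ∀ x ∈ B, DT z T ^ α * errDensity Du (jac uT) p pT x
      ≤ K ^ α * (weight z α x * errDensity Du (jac uT) p pT x) := fun x hx => by
    rw [← mul_assoc]
    exact mul_le_mul_of_nonneg_right (hw x hx) (errDensity_nonneg _ _ _ _ x)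
  -- Measurability of the unweighted density is recovered by multiplying the weighted one by the
  -- inverse weight, which is finite on B.
  have hmeas : AEStronglyMeasurable (errDensity Du (jac uT) p pT) (volume.restrict B) := by
    refine ((measurable_weight z (-α)).aestronglyMeasurable.mul
      hintB.aestronglyMeasurable).congr ?_
    filter_upwards [ae_restrict_mem hB] with x hx
    rw [Pi.mul_apply, ← mul_assoc, weight, weight, ← Real.rpow_add (hxpos x hx), neg_add_cancel,
      Real.rpow_zero, one_mul]
  have hDα : 0 < DT z T ^ α := Real.rpow_pos_of_pos hD α
  have hDint : IntegrableOn (fun x => DT z T ^ α * errDensity Du (jac uT) p pT x) B := by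
    refine (hintB.const_mul (K ^ α)).mono' (hmeas.const_mul _) ?_
    filter_upwards [ae_restrict_mem hB] with x hx
    rw [Real.norm_of_nonneg (mul_nonneg hDα.le (errDensity_nonneg _ _ _ _ x))]
    exact hle x hx
  refine ⟨?_, ?_⟩
  · have := hDint.const_mul (DT z T ^ α)⁻¹
    refine this.congr (Eventually.of_forall fun x => ?_)
    simp only
    rw [← mul_assoc, inv_mul_cancel₀ hDα.ne', one_mul]
  · rw [← integral_const_mul]
    calc _ ≤ ∫ x in B, K ^ α * (weight z α x * errDensity Du (jac uT) p pT x) :=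
          setIntegral_mono_on hDint (hintB.const_mul _) hB hle
      _ = K ^ α * ∫ x in B, weight z α x * errDensity Du (jac uT) p pT x :=
          integral_const_mul _ _
      _ ≤ _ := by
          refine mul_le_mul_of_nonneg_left ?_ (Real.rpow_nonneg hK.le α)
          exact setIntegral_mono_set hint (Eventually.of_forall fun x =>
            mul_nonneg (weight_nonneg z α x) (errDensity_nonneg _ _ _ _ x))
            (Eventually.of_forall hBT)

/-- For a neighbour, a common vertex links the elements: D_T ≤ h_T + h_T' + |x - z|. Here h_T ≤ h_T'
/ σ and h_T' ≤ |x - z| / c, which gives the three summands. -/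
theorem DT_le_of_mem (h : IsErrorSetting Ω z α σ π 𝒯 F u Du p uT pT)
    (hTm : T ∈ 𝒯.cells) (hT' : T' = T ∨ T' ∈ neighbours 𝒯 T) {x : Eu d}
    (hx : x ∈ simplex T') {c : ℝ} (hc : 0 < c) (hxz : c * hT T' ≤ ‖x - z‖) :
    DT z T ≤ (1 / (c * σ) + 1 / c + 1) * ‖x - z‖ := by
  have hσ := h.sigma_pos
  have h1 : hT T' ≤ 1 / c * ‖x - z‖ := by
    rw [one_div_mul_eq_div, le_div_iff₀' hc]
    exact hxz
  have hn := norm_nonneg (x - z)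
  rcases hT' with rfl | hT'
  · have h2 := DT_le (z := z) hx
    have h3 : 0 ≤ 1 / (c * σ) * ‖x - z‖ := by positivity
    linarith
  · obtain ⟨-, -, hS⟩ := mem_neighbours.1 hT'
    obtain ⟨s, hs⟩ : (side T T').Nonempty := Finset.card_pos.1 (by have := h.two_le; omega)
    have h2 := DT_le (z := z) (subset_simplex T (side_subset_left T T' hs))
    have h3 := dist_le_hT (subset_simplex T' (side_subset_right T T' hs)) hx
    rw [dist_eq_norm] at h3
    have h4 := norm_sub_le_norm_sub_add_norm_sub s x z
    have h5 := h.regular.hT_le hσ h.two_le hTm hS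
    have h6 : hT T ≤ 1 / (c * σ) * ‖x - z‖ := by
      rw [one_div_mul_eq_div, le_div_iff₀' (by positivity)]
      nlinarith
    linarith

end IsErrorSetting

/-- The residual of the discrete solution on an element of the patch is controlled by the local
error. -/
theorem exists_residual_le_patchError (d : ℕ) (α σ : ℝ) : ∃ C : ℝ, 0 < C ∧
    ∀ {Ω : Set (Eu d)} {z : Eu d} {π : StablePair} {𝒯 : Triangulation Ω} {F : Eu d}
      {u : Eu d → Eu d} {Du : Eu d → Matrix (Fin d) (Fin d) ℝ} {p : Eu d → ℝ} {uT : Eu d → Eu d}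
      {pT : Eu d → ℝ}, IsErrorSetting Ω z α σ π 𝒯 F u Du p uT pT →
    ∀ {T T' : Finset (Eu d)}, T ∈ 𝒯.cells → (T' = T ∨ T' ∈ neighbours 𝒯 T) →
    ∀ {U : Fin d → Eu d → ℝ} {P : Eu d →ᵃ[ℝ] ℝ}, IsCellRep T' uT pT U P →
    ∀ {x s : Eu d}, s ∈ simplex T' → dist x s ≤ hT T' → ∀ i,
      hT T' ^ (d + 2) * DT z T ^ α * residual U P i x ^ 2
        ≤ C * patchError 𝒯 z α Du p uT pT T := by
  by_cases hd : d = 0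
  · refine ⟨1, one_pos, ?_⟩
    intro Ω z π 𝒯 F u Du p uT pT h
    have := h.two_le
    omega
  by_cases hσ : 0 < σ
  swap
  · exact ⟨1, one_pos, fun h => absurd h.sigma_pos hσ⟩
  have : NeZero d := ⟨hd⟩
  -- The ball has radius σ h / 4, so the factor 8/σ reaches distance 2h. This covers points outside
  -- the element but within h of it, where the jump estimate needs the extended polynomial.
  obtain ⟨C, hC, hres⟩ := exists_interior_residual_bound d (d + 1) (8 / σ)
  set c : ℝ := σ / 4 with hc
  have hc0 : 0 < c := by positivity
  set K : ℝ := 1 / (c * σ) + 1 / c + 1 with hK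
  have hK0 : 0 < K := by positivity
  refine ⟨C * K ^ α / c ^ (d + 2), by positivity, ?_⟩
  intro Ω z π 𝒯 F u Du p uT pT h T T' hTm hT' U P hrep x s hs hxs i
  have hT'c : T' ∈ 𝒯.cells := by
    rcases hT' with rfl | hT'
    · exact hTm
    · exact (mem_neighbours.1 hT').1
  have hT'p : simplex T' ⊆ patch 𝒯 T := by
    rcases hT' with rfl | hT'
    · exact simplex_subset_patch 𝒯
    · exact simplex_neighbour_subset_patch 𝒯 hT'
  have hh : 0 < hT T' := 𝒯.hT_pos h.one_le hT'c
  obtain ⟨y, hy, hball, hfar⟩ := h.regular.exists_interior_ball hσ h.one_le hT'c z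
  have hρe : σ * hT T' / 4 = c * hT T' := by rw [hc]; ring
  rw [hρe] at hball hfar
  have hρ : 0 < c * hT T' := by positivity
  have hzB : z ∉ Metric.ball y (c * hT T') := fun hz => by
    have := hfar z hz
    rw [sub_self, norm_zero] at this
    exact this.not_gt hρ
  obtain ⟨hE, hEQ⟩ := h.setIntegral_err_le hTm Metric.isOpen_ball.measurableSet
    (hball.trans (interior_subset.trans hT'p)) hK0
    fun x hx => h.DT_le_of_mem hTm hT' (interior_subset (hball hx)) hc0 (hfar x hx)
  have hae : ∀ᵐ x, x ∈ Metric.ball y (c * hT T') →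
      (∀ i j, jac uT x i j = pd j (U i) x) ∧ pT x = P x :=
    Eventually.of_forall fun x hx => ⟨fun i j => hrep.jac_eq (hball hx) i j,
      hrep.eq_p x (interior_subset (hball hx))⟩
  have hx : x ∈ Metric.closedBall y (8 / σ * (c * hT T')) := by
    have h1 := dist_le_hT hs hy
    have h2 := dist_triangle x s y
    have h3 : 8 / σ * (c * hT T') = 2 * hT T' := by
      rw [hc]
      field_simp
      norm_num
    rw [Metric.mem_closedBall, h3]
    linarith
  have hmain := hres h.exact_sol h.lt h.domain.isBounded hρ
    (hball.trans (𝒯.interior_simplex_subset h.domain hT'c)) hzB hrep.mem_u hrep.mem_p hae hE x hx i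
  have hD : 0 < DT z T ^ α := Real.rpow_pos_of_pos (𝒯.DT_pos h.one_le hTm) α
  rw [mul_pow] at hmain
  rw [div_mul_eq_mul_div, le_div_iff₀ (by positivity)]
  calc _ = DT z T ^ α * (c ^ (d + 2) * hT T' ^ (d + 2) * residual U P i x ^ 2) := by ring
    _ ≤ DT z T ^ α * (C * ∫ x in Metric.ball y (c * hT T'),
          errDensity Du (jac uT) p pT x) := by gcongr
    _ = C * (DT z T ^ α * ∫ x in Metric.ball y (c * hT T'),
          errDensity Du (jac uT) p pT x) := by ring
    _ ≤ C * (K ^ α * patchError 𝒯 z α Du p uT pT T) := by gcongr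
    _ = _ := by ring

end LocalErrors

/-! ### The jump term on one side -/

section JumpEstimate

/-- An isometric parametrisation of the hyperplane turns surface measure into Lebesgue measure. -/
theorem euclideanHausdorffMeasure_hyperplane_le {m : ℕ} {n y : Eu (m + 1)} (hn : ‖n‖ = 1)
    {A : Set (Eu (m + 1))} {r : ℝ} (hA : ∀ x ∈ A, inner ℝ n (x - y) = 0 ∧ dist x y ≤ r) :
    (Measure.euclideanHausdorffMeasure m : Measure (Eu (m + 1))) A
      ≤ volume (Metric.closedBall (0 : Eu m) r) := by
  obtain ⟨ι, -, hsurj, -⟩ := exists_hyperplane_isometry hn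
  have hiso : Isometry (fun w : Eu m => y + ι w) :=
    Isometry.of_dist_eq fun a b => by rw [dist_add_left, ι.dist_map]
  have hsub : A ⊆ (fun w : Eu m => y + ι w) '' Metric.closedBall (0 : Eu m) r := by
    intro x hx
    obtain ⟨h1, h2⟩ := hA x hx
    obtain ⟨w, hw⟩ := hsurj (x - y) h1
    refine ⟨w, ?_, ?_⟩
    · rw [mem_closedBall_zero_iff, ← ι.norm_map, hw, ← dist_eq_norm]
      exact h2
    · simp only [hw]
      abel
  refine (measure_mono hsub).trans (le_of_eq ?_)
  rw [hiso.euclideanHausdorffMeasure_image, EuclideanSpace.euclideanHausdorffMeasure_eq_volume]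

theorem volume_real_closedBall {m : ℕ} {r : ℝ} (hr : 0 < r) (y : Eu m) :
    (volume : Measure (Eu m)).real (Metric.closedBall y r)
      = r ^ m * (volume : Measure (Eu m)).real (Metric.ball 0 1) := by
  rw [measureReal_def, Measure.addHaar_closedBall _ _ hr.le, ENNReal.toReal_mul,
    ENNReal.toReal_ofReal (by positivity), finrank_euclideanSpace, Fintype.card_fin,
    measureReal_def]

/-- The jump of the discrete normal stress on a side is controlled by the local error. -/
theorem exists_jump_le_patchError (m : ℕ) (α σ : ℝ) : ∃ C : ℝ, 0 < C ∧
    ∀ {Ω : Set (Eu (m + 1))} {z : Eu (m + 1)} {π : StablePair} {𝒯 : Triangulation Ω}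
      {F : Eu (m + 1)} {u : Eu (m + 1) → Eu (m + 1)}
      {Du : Eu (m + 1) → Matrix (Fin (m + 1)) (Fin (m + 1)) ℝ} {p : Eu (m + 1) → ℝ}
      {uT : Eu (m + 1) → Eu (m + 1)} {pT : Eu (m + 1) → ℝ},
      IsErrorSetting Ω z α σ π 𝒯 F u Du p uT pT →
    ∀ {T T' : Finset (Eu (m + 1))}, T ∈ 𝒯.cells → T' ∈ neighbours 𝒯 T →
      hT T * DT z T ^ α * ∫ x in simplex (side T T'), ‖stressJump uT pT T T' x‖ ^ 2
          ∂(Measure.euclideanHausdorffMeasure m)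
        ≤ C * patchError 𝒯 z α Du p uT pT T := by
  by_cases hσ : 0 < σ
  swap
  · exact ⟨1, one_pos, fun h => absurd h.sigma_pos hσ⟩
  obtain ⟨C₁, hC₁, hres⟩ := exists_residual_le_patchError (m + 1) α σ
  -- The radius s² h_T / (m + 1) suits both elements: s² ≤ σ for T, and s² h_T ≤ σ² h_T ≤ σ h_T' for
  -- its neighbour.
  set s : ℝ := min 1 σ with hs
  have hs0 : 0 < s := lt_min one_pos hσ
  have hs1 : s ≤ 1 := min_le_left _ _
  have hsσ : s ≤ σ := min_le_right _ _
  have hm0 : (0 : ℝ) < (m + 1 : ℕ) := by positivity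
  set c : ℝ := s ^ 2 / (m + 1 : ℕ) / 4 with hc
  have hc0 : 0 < c := by positivity
  have hcs : c ≤ s ^ 2 := by
    rw [hc, div_div, div_le_iff₀ (by positivity)]
    have h1 : (1 : ℝ) ≤ (m + 1 : ℕ) := by exact_mod_cast Nat.le_add_left 1 m
    nlinarith [sq_nonneg s]
  -- The ball has radius c h_T, so the factor 1/c makes the estimate reach the whole side.
  obtain ⟨C₂, hC₂, hjump⟩ := exists_jump_bound m (m + 1 + 1) (1 / c)
  set K : ℝ := 1 / c + 2 with hK
  have hK0 : 0 < K := by positivity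
  set κ := (volume : Measure (Eu m)).real (Metric.ball 0 1) with hκ
  have hκ0 : 0 < κ := measureReal_unitBall_pos m
  -- The second summand accounts for the neighbour, whose diameter is only known to be at least σ
  -- h_T.
  set A₀ : ℝ := C₁ * (1 + 1 / σ ^ (m + 3)) with hA₀
  have hA₀0 : 0 < A₀ := by positivity
  set C₃ : ℝ := C₂ * (K ^ α + c ^ (m + 3) * A₀) / c ^ (m + 1) with hC₃
  refine ⟨(m + 1 : ℕ) * C₃ * κ, by positivity, ?_⟩
  intro Ω z π 𝒯 F u Du p uT pT h T T' hTm hT'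
  obtain ⟨hT'm, -, hS⟩ := mem_neighbours.1 hT'
  have hh : 0 < hT T := 𝒯.hT_pos h.one_le hTm
  have hh' : 0 < hT T' := 𝒯.hT_pos h.one_le hT'm
  have hhh' : σ * hT T ≤ hT T' := h.regular.hT_le hσ h.two_le hTm hS
  obtain ⟨U, P, hrep⟩ := h.discrete_sol.exists_cellRep h.one_le hTm
  obtain ⟨U', P', hrep'⟩ := h.discrete_sol.exists_cellRep h.one_le hT'm
  obtain ⟨y, hyS, hin, hin', hfar, hplane⟩ := h.regular.exists_side_ball hσ h.two_le hTm hT' z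
    (r := s ^ 2 / (m + 1 : ℕ) * hT T) (by positivity)
    (by
      rw [← mul_assoc, mul_div_cancel₀ _ hm0.ne']
      refine mul_le_mul_of_nonneg_right ?_ hh.le
      nlinarith)
    (by
      rw [← mul_assoc, mul_div_cancel₀ _ hm0.ne']
      calc s ^ 2 * hT T = s * s * hT T := by ring
        _ ≤ σ * σ * hT T := by gcongr
        _ = σ * (σ * hT T) := by ring
        _ ≤ σ * hT T' := by gcongr)
  obtain ⟨b⟩ := nonempty_baryCoords (𝒯.card_eq T hTm) (𝒯.indep T hTm)
  obtain ⟨a, ha, haS, -⟩ := exists_opposite_vertex (𝒯.card_eq T hTm) (side_subset_left T T') hS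
  have hn := b.norm_sideNormal (𝒯.indep T hTm) (side_subset_left T T') hS h.one_le ha haS
  obtain ⟨c₁, hc₁⟩ := h.regular T hTm
  obtain ⟨c₂, hc₂⟩ := h.regular T' hT'm
  have hneg := 𝒯.sideNormal_eq_neg h.one_le hTm hT'm hS (by positivity) (by positivity) hc₁ hc₂
  set n := sideNormal T (side T T') with hndef
  have hρe : s ^ 2 / (m + 1 : ℕ) * hT T / 4 = c * hT T := by rw [hc]; ring
  rw [hρe] at hin hin' hfar
  have hρ : 0 < c * hT T := by positivity
  set B := Metric.ball y (c * hT T) with hB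
  have hBsub : B ⊆ simplex T ∪ simplex T' := by
    intro x hx
    rcases le_total 0 (inner ℝ n (x - y)) with h0 | h0
    · exact Or.inl (hin x hx h0)
    · exact Or.inr (hin' x hx h0)
  have hBpatch : B ⊆ patch 𝒯 T := hBsub.trans
    (Set.union_subset (simplex_subset_patch 𝒯) (simplex_neighbour_subset_patch 𝒯 hT'))
  -- The side may touch ∂Ω, but an open ball covered by the two elements lies in the interior of the
  -- closure of Ω.
  have hBΩ : B ⊆ Ω := by
    refine (interior_maximal (hBsub.trans (Set.union_subset (𝒯.simplex_subset hTm)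
      (𝒯.simplex_subset hT'm))) Metric.isOpen_ball).trans h.domain.interior_closure_subset
  have hzB : z ∉ B := fun hz => by
    have := hfar z hz
    rw [sub_self, norm_zero] at this
    exact this.not_gt hρ
  have hyT : y ∈ simplex T := simplex_side_subset_left T T' hyS
  have hyT' : y ∈ simplex T' := simplex_side_subset_right T T' hyS
  have hD : 0 < DT z T ^ α := Real.rpow_pos_of_pos (𝒯.DT_pos h.one_le hTm) α
  set Q := patchError 𝒯 z α Du p uT pT T with hQ
  have hQ0 : 0 ≤ Q := patchError_nonneg
  have hDB : ∀ x ∈ B, DT z T ≤ K * ‖x - z‖ := by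
    intro x hx
    have h3 := hfar x hx
    have h1 : hT T ≤ 1 / c * ‖x - z‖ := by
      rw [one_div_mul_eq_div, le_div_iff₀' hc0]
      exact h3
    have h2 := DT_le (z := z) hyT
    have h4 := norm_sub_le_norm_sub_add_norm_sub y x z
    have h5 := Metric.mem_ball.1 hx
    rw [dist_comm, dist_eq_norm] at h5
    rw [hK]
    linarith
  obtain ⟨hE, hEQ⟩ := h.setIntegral_err_le hTm Metric.isOpen_ball.measurableSet hBpatch hK0 hDB
  rw [← hQ] at hEQ
  have hae : ∀ᵐ x, x ∈ B → x ∈ halfSpace y n →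
      (∀ i j, jac uT x i j = pd j (U i) x) ∧ pT x = P x := by
    filter_upwards [ae_mem_interior_simplex T] with x hx hxB hxH
    have hxT := hin x hxB (le_of_lt hxH)
    exact ⟨fun i j => hrep.jac_eq (hx hxT) i j, hrep.eq_p x hxT⟩
  have hae' : ∀ᵐ x, x ∈ B → x ∈ halfSpace y (-n) →
      (∀ i j, jac uT x i j = pd j (U' i) x) ∧ pT x = P' x := by
    filter_upwards [ae_mem_interior_simplex T'] with x hx hxB hxH
    have hxn : 0 < inner ℝ (-n) (x - y) := hxH
    rw [inner_neg_left, Left.neg_pos_iff] at hxn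
    have hxT := hin' x hxB hxn.le
    exact ⟨fun i j => hrep'.jac_eq (hx hxT) i j, hrep'.eq_p x hxT⟩
  set A : ℝ := A₀ * Q / (hT T ^ (m + 3) * DT z T ^ α) with hA
  have hden : 0 < hT T ^ (m + 3) * DT z T ^ α := by positivity
  have hA1 : ∀ x ∈ B, ∀ i, residual U P i x ^ 2 ≤ A := by
    intro x hx i
    have hxd : dist x y ≤ hT T := by
      refine (Metric.mem_ball.1 hx).le.trans (mul_le_of_le_one_left hh.le (hcs.trans ?_))
      exact pow_le_one₀ hs0.le hs1
    have h1 := hres h hTm (Or.inl rfl) hrep hyT hxd i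
    rw [hA, le_div_iff₀ hden]
    calc residual U P i x ^ 2 * (hT T ^ (m + 3) * DT z T ^ α)
        = hT T ^ (m + 1 + 2) * DT z T ^ α * residual U P i x ^ 2 := by ring
      _ ≤ C₁ * Q := h1
      _ ≤ A₀ * Q := by
        refine mul_le_mul_of_nonneg_right ?_ hQ0
        rw [hA₀]
        refine le_mul_of_one_le_right hC₁.le (le_add_of_nonneg_right (by positivity))
  have hA2 : ∀ x ∈ B, ∀ i, residual U' P' i x ^ 2 ≤ A := by
    intro x hx i
    have hxd : dist x y ≤ hT T' := by
      refine (Metric.mem_ball.1 hx).le.trans (le_trans ?_ hhh')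
      refine mul_le_mul_of_nonneg_right (hcs.trans ?_) hh.le
      nlinarith
    have h1 := hres h hTm (Or.inr hT') hrep' hyT' hxd i
    rw [hA, le_div_iff₀ hden]
    have h2 : σ ^ (m + 3) * hT T ^ (m + 3) ≤ hT T' ^ (m + 3) := by
      rw [← mul_pow]
      exact pow_le_pow_left₀ (by positivity) hhh' _
    calc residual U' P' i x ^ 2 * (hT T ^ (m + 3) * DT z T ^ α)
        = 1 / σ ^ (m + 3) * ((σ ^ (m + 3) * hT T ^ (m + 3)) * DT z T ^ α
            * residual U' P' i x ^ 2) := by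
          field_simp
      _ ≤ 1 / σ ^ (m + 3) * (hT T' ^ (m + 3) * DT z T ^ α * residual U' P' i x ^ 2) := by
          gcongr
      _ ≤ 1 / σ ^ (m + 3) * (C₁ * Q) := by gcongr
      _ ≤ A₀ * Q := by
        rw [hA₀]
        have : 0 ≤ C₁ * Q := by positivity
        linarith
  have hpoint : ∀ x ∈ simplex (side T T'),
      ‖stressJump uT pT T T' x‖ ^ 2 ≤ (m + 1 : ℕ) * (C₃ * Q / (hT T ^ (m + 1) * DT z T ^ α)) := by
    intro x hx
    have hxT := simplex_side_subset_left T T' hx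
    have hxT' := simplex_side_subset_right T T' hx
    have hxM : x ∈ Metric.closedBall y (1 / c * (c * hT T)) := by
      rw [Metric.mem_closedBall, one_div, inv_mul_cancel_left₀ hc0.ne']
      exact dist_le_hT hxT hyT
    have hne : ∀ {T : Finset (Eu (m + 1))} {w : Eu (m + 1)} {r : ℝ}, 0 < r →
        Metric.closedBall w r ⊆ simplex T → (interior (simplex T)).Nonempty := fun hr hw =>
      ⟨_, interior_maximal (Metric.ball_subset_closedBall.trans hw) Metric.isOpen_ball
        (Metric.mem_ball_self hr)⟩
    have hcomp : ∀ i, stressJump uT pT T T' x i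
        = normalFlux n U P i x - normalFlux n U' P' i x := by
      intro i
      rw [stressJump, PiLp.add_apply, hrep.normalStress_eq (hne (by positivity) hc₁) hxT,
        hrep'.normalStress_eq (hne (by positivity) hc₂) hxT', hneg, normalFlux_neg, ← hndef]
      ring
    rw [EuclideanSpace.real_norm_sq_eq]
    have hi : ∀ i, stressJump uT pT T T' x i ^ 2 ≤ C₃ * Q / (hT T ^ (m + 1) * DT z T ^ α) := by
      intro i
      have h1 := hjump h.exact_sol h.lt h.domain.isBounded hρ hBΩ hzB hn hrep.mem_u hrep.mem_p
        hrep'.mem_u hrep'.mem_p hae hae' hE hA1 hA2 x hxM (hplane x hx) i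
      rw [hcomp i, le_div_iff₀ (by positivity), hC₃, div_mul_eq_mul_div, le_div_iff₀ (by positivity)]
      have h2 : DT z T ^ α * ((c * hT T) ^ (m + 3) * A) = c ^ (m + 3) * A₀ * Q := by
        rw [hA, mul_pow]
        field_simp
      calc _ = DT z T ^ α * ((c * hT T) ^ (m + 1)
              * (normalFlux n U P i x - normalFlux n U' P' i x) ^ 2) := by
            rw [mul_pow]
            ring
        _ ≤ DT z T ^ α * (C₂ * ((∫ x in B, errDensity Du (jac uT) p pT x)
              + (c * hT T) ^ (m + 3) * A)) := by gcongr
        _ = C₂ * (DT z T ^ α * (∫ x in B, errDensity Du (jac uT) p pT x)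
              + DT z T ^ α * ((c * hT T) ^ (m + 3) * A)) := by ring
        _ ≤ C₂ * (K ^ α * Q + c ^ (m + 3) * A₀ * Q) := by
            rw [h2]
            gcongr
        _ = _ := by ring
    calc ∑ i, stressJump uT pT T T' x i ^ 2
        ≤ ∑ _i : Fin (m + 1), C₃ * Q / (hT T ^ (m + 1) * DT z T ^ α) :=
          Finset.sum_le_sum fun i _ => hi i
      _ = _ := by rw [Finset.sum_const, Finset.card_univ, Fintype.card_fin, nsmul_eq_mul]
  have hmeas := euclideanHausdorffMeasure_hyperplane_le hn (A := simplex (side T T')) (y := y)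
    (r := hT T) fun x hx => ⟨hplane x hx, dist_le_hT (simplex_side_subset_left T T' hx) hyT⟩
  have hfin : volume (Metric.closedBall (0 : Eu m) (hT T)) < ⊤ := measure_closedBall_lt_top
  have hreal : (Measure.euclideanHausdorffMeasure m : Measure (Eu (m + 1))).real
      (simplex (side T T')) ≤ hT T ^ m * κ := by
    rw [hκ, ← volume_real_closedBall hh 0]
    exact ENNReal.toReal_mono hfin.ne hmeas
  have hint := norm_setIntegral_le_of_norm_le_const
    (μ := (Measure.euclideanHausdorffMeasure m : Measure (Eu (m + 1))))
    (f := fun x => ‖stressJump uT pT T T' x‖ ^ 2) (hmeas.trans_lt hfin) fun x hx => by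
      rw [Real.norm_of_nonneg (sq_nonneg _)]
      exact hpoint x hx
  have hC₃0 : 0 < C₃ := by positivity
  calc _ ≤ hT T * DT z T ^ α * ((m + 1 : ℕ) * (C₃ * Q / (hT T ^ (m + 1) * DT z T ^ α))
        * (hT T ^ m * κ)) := by
        refine mul_le_mul_of_nonneg_left ?_ (by positivity)
        refine ((le_abs_self _).trans hint).trans ?_
        gcongr
    _ = (m + 1 : ℕ) * C₃ * κ * Q := by
        rw [pow_succ]
        field_simp

end JumpEstimate

/-! ### The remaining terms of the indicator -/

section IndicatorTerms

variable {d : ℕ} {Ω : Set (Eu d)} {z : Eu d} {α σ : ℝ} {π : StablePair}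
  {𝒯 : Triangulation Ω} {F : Eu d} {u : Eu d → Eu d} {Du : Eu d → Matrix (Fin d) (Fin d) ℝ}
  {p : Eu d → ℝ} {uT : Eu d → Eu d} {pT : Eu d → ℝ} {T : Finset (Eu d)}

theorem setIntegral_patch_le {f : Eu d → ℝ} (hTm : T ∈ 𝒯.cells) (hf : ∀ x, 0 ≤ f x)
    (hi : ∀ T ∈ 𝒯.cells, IntegrableOn f (simplex T)) :
    ∫ x in simplex T, f x ≤ ∫ x in patch 𝒯 T, f x :=
  setIntegral_mono_set (integrableOn_patch hTm hi) (Eventually.of_forall hf)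
    (Eventually.of_forall (simplex_subset_patch 𝒯))

theorem trace_sq_le (A : Matrix (Fin d) (Fin d) ℝ) : A.trace ^ 2 ≤ d * frob A A := by
  have h1 : A.trace ^ 2 ≤ d * ∑ i, A i i ^ 2 := by
    have := sq_sum_le_card_mul_sum_sq (s := Finset.univ) (f := fun i => A i i)
    simpa [Matrix.trace] using this
  refine h1.trans (mul_le_mul_of_nonneg_left ?_ (Nat.cast_nonneg d))
  rw [frob_self]
  exact Finset.sum_le_sum fun i _ =>
    Finset.single_le_sum (f := fun j => A i j ^ 2) (fun j _ => sq_nonneg _) (Finset.mem_univ i)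

namespace IsErrorSetting

/-- Since tr Du = 0 almost everywhere, the discrete divergence is minus the trace of the error, and
a squared trace is at most d times the squared Frobenius norm. -/
theorem divergence_le (h : IsErrorSetting Ω z α σ π 𝒯 F u Du p uT pT) (hTm : T ∈ 𝒯.cells) :
    ∫ x in simplex T, weight z α x * (jac uT x).trace ^ 2
      ≤ d * ∫ x in patch 𝒯 T, weight z α x * frob (Du x - jac uT x) (Du x - jac uT x) := by
  have := h.neZero
  have htr := h.exact_sol.trace_ae h.lt h.domain.isBounded h.domain.isOpen
  have hle : ∀ᵐ x ∂volume.restrict (simplex T), weight z α x * (jac uT x).trace ^ 2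
      ≤ d * (weight z α x * frob (Du x - jac uT x) (Du x - jac uT x)) := by
    filter_upwards [ae_restrict_of_ae htr, ae_restrict_of_ae (ae_mem_interior_simplex T),
      ae_restrict_mem (isClosed_simplex T).measurableSet] with x h1 h2 hx
    have h3 := trace_sq_le (Du x - jac uT x)
    rw [Matrix.trace_sub, h1 (𝒯.interior_simplex_subset h.domain hTm (h2 hx)), zero_sub,
      neg_sq] at h3
    calc _ ≤ weight z α x * (d * frob (Du x - jac uT x) (Du x - jac uT x)) :=
          mul_le_mul_of_nonneg_left h3 (weight_nonneg z α x)
      _ = _ := by ring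
  calc _ ≤ ∫ x in simplex T, d * (weight z α x * frob (Du x - jac uT x) (Du x - jac uT x)) :=
        integral_mono_of_nonneg (Eventually.of_forall fun x =>
          mul_nonneg (weight_nonneg z α x) (sq_nonneg _))
          ((h.integrableOn_frob hTm).const_mul _) hle
    _ = d * ∫ x in simplex T, weight z α x * frob (Du x - jac uT x) (Du x - jac uT x) :=
        integral_const_mul _ _
    _ ≤ _ := mul_le_mul_of_nonneg_left (setIntegral_patch_le hTm
        (fun x => mul_nonneg (weight_nonneg z α x) (frob_self_nonneg _))
        fun _ => h.integrableOn_frob) (Nat.cast_nonneg d)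

end IsErrorSetting

/-- The pointwise residual bound is integrated over the element, whose volume is at most that of a
ball of radius h_T. -/
theorem exists_residual_term_le (d : ℕ) (α σ : ℝ) : ∃ C : ℝ, 0 < C ∧
    ∀ {Ω : Set (Eu d)} {z : Eu d} {π : StablePair} {𝒯 : Triangulation Ω} {F : Eu d}
      {u : Eu d → Eu d} {Du : Eu d → Matrix (Fin d) (Fin d) ℝ} {p : Eu d → ℝ} {uT : Eu d → Eu d}
      {pT : Eu d → ℝ}, IsErrorSetting Ω z α σ π 𝒯 F u Du p uT pT → ∀ {T : Finset (Eu d)},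
      T ∈ 𝒯.cells →
      hT T ^ 2 * DT z T ^ α * ∫ x in simplex T, ‖Laplacian.laplacian uT x - gradient pT x‖ ^ 2
        ≤ C * patchError 𝒯 z α Du p uT pT T := by
  obtain ⟨C₁, hC₁, hres⟩ := exists_residual_le_patchError d α σ
  set κ := (volume : Measure (Eu d)).real (Metric.ball 0 1) with hκ
  have hκ0 : 0 < κ := measureReal_unitBall_pos d
  refine ⟨(d + 1) * C₁ * κ, by positivity, ?_⟩
  intro Ω z π 𝒯 F u Du p uT pT h T hTm
  obtain ⟨U, P, hrep⟩ := h.discrete_sol.exists_cellRep h.one_le hTm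
  have hh : 0 < hT T := 𝒯.hT_pos h.one_le hTm
  have hD : 0 < DT z T ^ α := Real.rpow_pos_of_pos (𝒯.DT_pos h.one_le hTm) α
  set Q := patchError 𝒯 z α Du p uT pT T with hQ
  have hQ0 : 0 ≤ Q := patchError_nonneg
  have hpoint : ∀ᵐ x, x ∈ simplex T → ‖‖Laplacian.laplacian uT x - gradient pT x‖ ^ 2‖
      ≤ d * (C₁ * Q / (hT T ^ (d + 2) * DT z T ^ α)) := by
    filter_upwards [ae_mem_interior_simplex T] with x hxi hx
    rw [Real.norm_of_nonneg (sq_nonneg _), EuclideanSpace.real_norm_sq_eq]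
    calc ∑ i, (Laplacian.laplacian uT x - gradient pT x) i ^ 2
        ≤ ∑ _i : Fin d, C₁ * Q / (hT T ^ (d + 2) * DT z T ^ α) :=
          Finset.sum_le_sum fun i _ => by
            rw [hrep.residual_eq (hxi hx), le_div_iff₀' (by positivity)]
            exact hres h hTm (Or.inl rfl) hrep hx (by rw [dist_self]; exact hh.le) i
      _ = _ := by rw [Finset.sum_const, Finset.card_univ, Fintype.card_fin, nsmul_eq_mul]
  have hint := norm_setIntegral_le_of_norm_le_const_ae'
    (isCompact_simplex T).measure_lt_top hpoint
  obtain ⟨y, hy, -⟩ := h.regular.exists_interior_ball h.sigma_pos h.one_le hTm z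
  have hvol : (volume : Measure (Eu d)).real (simplex T) ≤ hT T ^ d * κ := by
    rw [hκ, ← volume_real_closedBall hh y]
    exact measureReal_mono (fun x hx => dist_le_hT hx hy) measure_closedBall_lt_top.ne
  calc _ ≤ hT T ^ 2 * DT z T ^ α * (d * (C₁ * Q / (hT T ^ (d + 2) * DT z T ^ α))
        * (hT T ^ d * κ)) := by
        refine mul_le_mul_of_nonneg_left ?_ (by positivity)
        refine ((le_abs_self _).trans hint).trans ?_
        gcongr
    _ = d * C₁ * κ * Q := by
        rw [pow_add]
        field_simp
    _ ≤ _ := by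
        gcongr
        linarith

/-- On the element containing z the discrete pressure is affine and the exact one is close to a
dipole, so their weighted distance is bounded below. Here Ω and z are fixed first, because the
decomposition of the pressure depends on them. -/
theorem exists_dirac_term_le {Ω : Set (Eu d)} (hd : 2 ≤ d) (hΩ : IsLipschitzDomain Ω) {z : Eu d}
    (hz : z ∈ Ω) {α σ : ℝ} (hα₁ : (d : ℝ) - 2 < α) (hα₂ : α < d) (hσ : 0 < σ) :
    ∃ C : ℝ, 0 < C ∧
    ∀ {π : StablePair} {𝒯 : Triangulation Ω} {F : Eu d}
      {u : Eu d → Eu d} {Du : Eu d → Matrix (Fin d) (Fin d) ℝ} {p : Eu d → ℝ} {uT : Eu d → Eu d}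
      {pT : Eu d → ℝ}, IsErrorSetting Ω z α σ π 𝒯 F u Du p uT pT → ∀ {T : Finset (Eu d)},
      T ∈ 𝒯.cells → z ∈ simplex T →
      hT T ^ (α + 2 - (d : ℝ)) * ‖F‖ ^ 2
        ≤ C * ∫ x in patch 𝒯 T, weight z α x * (p x - pT x) ^ 2 := by
  have : NeZero d := ⟨by omega⟩
  have hα : 0 < α := by
    have : (2 : ℝ) ≤ d := by exact_mod_cast hd
    linarith
  obtain ⟨κ, r, C, hκ, hr, hC, hdec⟩ :=
    exists_pressure_decomposition hα hα₂ hΩ.isBounded hΩ.isOpen hz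
  obtain ⟨K, hK, hbound⟩ :=
    exists_dipole_lower_bound (L := Metric.diam (closure Ω)) hd hα₁ hκ hr hC hσ
  refine ⟨K, hK, ?_⟩
  intro π 𝒯 F u Du p uT pT h T hTm hzT
  obtain ⟨U, P, hrep⟩ := h.discrete_sol.exists_cellRep h.one_le hTm
  obtain ⟨c, hc⟩ := hdec F u Du p h.exact_sol
  obtain ⟨y, hy⟩ := h.regular T hTm
  have hmeas := (isClosed_simplex T).measurableSet
  have hcongr : ∀ x ∈ simplex T, weight z α x * (p x - pT x) ^ 2
      = weight z α x * (p x - P x) ^ 2 := fun x hx => by rw [hrep.eq_p x hx]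
  have hint := (h.integrableOn_pressure hTm).congr_fun hcongr hmeas
  have hmain := hbound P hc (convex_simplex T) (isClosed_simplex T) hzT (𝒯.hT_pos h.one_le hTm)
    (Metric.diam_mono (𝒯.simplex_subset hTm) hΩ.isBounded.closure)
    (fun x hx => dist_le_hT hx hzT) hy hint
  rw [← setIntegral_congr_fun hmeas hcongr] at hmain
  exact hmain.trans (mul_le_mul_of_nonneg_left (setIntegral_patch_le hTm
    (fun x => mul_nonneg (weight_nonneg z α x) (sq_nonneg _))
    fun _ => h.integrableOn_pressure) hK.le)

end IndicatorTerms

end StokesFEM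

/-! ### Assembly of the four bounds -/

open StokesFEM
theorem theorem5p6 {d : ℕ} (hd : d = 2 ∨ d = 3)
    (Ω : Set (Eu d)) (hΩ : IsLipschitzDomain Ω) (z : Eu d) (hz : z ∈ Ω)
    (α : ℝ) (hα₁ : (d : ℝ) - 2 < α) (hα₂ : α < (d : ℝ)) (σ : ℝ) (hσ : 0 < σ) :
    ∃ C : ℝ, 0 < C ∧
      ∀ (π : StablePair) (𝒯 : Triangulation Ω), ShapeRegular σ 𝒯 →
      ∀ (F : Eu d) (u : Eu d → Eu d) (Du : Eu d → Matrix (Fin d) (Fin d) ℝ) (p : Eu d → ℝ)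
        (uT : Eu d → Eu d) (pT : Eu d → ℝ),
        IsStokesSolution Ω z α F u Du p →
        IsDiscreteSolution π 𝒯 z F uT pT →
        ∀ T ∈ 𝒯.cells,
          errorIndicator 𝒯 z α F uT pT T ^ 2 ≤
            C * ((∫ x in patch 𝒯 T,
                    weight z α x * frob (Du x - jac uT x) (Du x - jac uT x))
                + ∫ x in patch 𝒯 T, weight z α x * (p x - pT x) ^ 2) := by
  have hd2 : 2 ≤ d := by omega
  have hα : 0 < α := by
    have : (2 : ℝ) ≤ d := by exact_mod_cast hd2
    linarith
  obtain ⟨C₁, hC₁, h₁⟩ := exists_residual_term_le d α σ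
  obtain ⟨C₃, hC₃, h₃⟩ : ∃ C : ℝ, 0 < C ∧
      ∀ {Ω : Set (Eu d)} {z : Eu d} {π : StablePair} {𝒯 : Triangulation Ω} {F : Eu d}
        {u : Eu d → Eu d} {Du : Eu d → Matrix (Fin d) (Fin d) ℝ} {p : Eu d → ℝ}
        {uT : Eu d → Eu d} {pT : Eu d → ℝ}, IsErrorSetting Ω z α σ π 𝒯 F u Du p uT pT →
      ∀ {T T' : Finset (Eu d)}, T ∈ 𝒯.cells → T' ∈ neighbours 𝒯 T →
        hT T * DT z T ^ α * ∫ x in simplex (side T T'), ‖stressJump uT pT T T' x‖ ^ 2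
            ∂(Measure.euclideanHausdorffMeasure (d - 1))
          ≤ C * patchError 𝒯 z α Du p uT pT T := by
    -- Writing d = m + 1 makes d - 1 reduce to m in the surface measure.
    obtain ⟨m, rfl⟩ : ∃ m, d = m + 1 := ⟨d - 1, by omega⟩
    exact exists_jump_le_patchError m α σ
  obtain ⟨C₄, hC₄, h₄⟩ := exists_dirac_term_le hd2 hΩ hz hα₁ hα₂ hσ
  -- One summand per term of the indicator; the factor d + 1 bounds the number of neighbours.
  refine ⟨C₁ + d + (d + 1) * C₃ + C₄, by positivity, ?_⟩
  intro π 𝒯 hreg F u Du p uT pT hu huT T hTm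
  have h : IsErrorSetting Ω z α σ π 𝒯 F u Du p uT pT :=
    ⟨hd2, hΩ, hα, hα₂, hσ, hreg, hu, huT⟩
  have hh : 0 < hT T := 𝒯.hT_pos h.one_le hTm
  have hD : 0 < DT z T ^ α := Real.rpow_pos_of_pos (𝒯.DT_pos h.one_le hTm) α
  have hI₁ : 0 ≤ ∫ x in patch 𝒯 T,
      weight z α x * frob (Du x - jac uT x) (Du x - jac uT x) :=
    integral_nonneg fun x => mul_nonneg (weight_nonneg z α x) (frob_self_nonneg _)
  have hI₂ : 0 ≤ ∫ x in patch 𝒯 T, weight z α x * (p x - pT x) ^ 2 :=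
    integral_nonneg fun x => mul_nonneg (weight_nonneg z α x) (sq_nonneg _)
  rw [← h.patchError_eq hTm]
  have hQ := h.patchError_eq hTm
  set Q := patchError 𝒯 z α Du p uT pT T with hQdef
  have hQ0 : 0 ≤ Q := patchError_nonneg
  have e₁ := h₁ h hTm
  have e₂ : ∫ x in simplex T, weight z α x * (jac uT x).trace ^ 2 ≤ d * Q :=
    (h.divergence_le hTm).trans (mul_le_mul_of_nonneg_left (by linarith) (Nat.cast_nonneg d))
  have e₃ : hT T * DT z T ^ α * (∑ T' ∈ neighbours 𝒯 T,
      ∫ x in simplex (side T T'), ‖stressJump uT pT T T' x‖ ^ 2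
        ∂(Measure.euclideanHausdorffMeasure (d - 1))) ≤ (d + 1) * C₃ * Q := by
    rw [Finset.mul_sum]
    have hcard : ((neighbours 𝒯 T).card : ℝ) ≤ d + 1 := by
      exact_mod_cast hreg.card_neighbours_le hσ h.one_le hTm
    calc _ ≤ ∑ _T' ∈ neighbours 𝒯 T, C₃ * Q := Finset.sum_le_sum fun T' hT' => h₃ h hTm hT'
      _ = (neighbours 𝒯 T).card * (C₃ * Q) := by rw [Finset.sum_const, nsmul_eq_mul]
      _ ≤ (d + 1) * (C₃ * Q) := mul_le_mul_of_nonneg_right hcard (by positivity)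
      _ = _ := by ring
  have e₄ : hT T ^ (α + 2 - (d : ℝ)) * ‖F‖ ^ 2
      * (@ite ℝ (z ∈ simplex T) (Classical.propDecidable _) 1 0) ≤ C₄ * Q := by
    split_ifs with hzT
    · rw [mul_one]
      exact (h₄ h hTm hzT).trans (mul_le_mul_of_nonneg_left (by linarith) hC₄.le)
    · rw [mul_zero]
      positivity
  have n₁ : 0 ≤ hT T ^ 2 * DT z T ^ α *
      (∫ x in simplex T, ‖Laplacian.laplacian uT x - gradient pT x‖ ^ 2) :=
    mul_nonneg (by positivity) (integral_nonneg fun x => sq_nonneg _)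
  have n₂ : 0 ≤ ∫ x in simplex T, weight z α x * (jac uT x).trace ^ 2 :=
    integral_nonneg fun x => mul_nonneg (weight_nonneg z α x) (sq_nonneg _)
  have n₃ : 0 ≤ hT T * DT z T ^ α * (∑ T' ∈ neighbours 𝒯 T,
      ∫ x in simplex (side T T'), ‖stressJump uT pT T T' x‖ ^ 2
        ∂(Measure.euclideanHausdorffMeasure (d - 1))) :=
    mul_nonneg (by positivity) (Finset.sum_nonneg fun T' _ => integral_nonneg fun x => sq_nonneg _)
  have n₄ : 0 ≤ hT T ^ (α + 2 - (d : ℝ)) * ‖F‖ ^ 2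
      * (@ite ℝ (z ∈ simplex T) (Classical.propDecidable _) 1 0) := by
    split_ifs <;> positivity
  -- Nonnegativity of the four terms is what allows the square to cancel the square root in the
  -- indicator.
  rw [errorIndicator, Real.sq_sqrt (by positivity)]
  linarith
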